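/- **Theorem 5.3 (rank 4 string C-groups in $\mathrm{PSL}(3,q)$, $q$ odd).** Let $q$ be a power of an odd prime $p$, and let $\mathrm{PSL}(3,q)$ act on the projective plane $\mathrm{PG}(2,q)$. Let $\rho_1,\rho_2,\rho_3,\rho_4\in\mathrm{PSL}(3,q)$ be involutions which, in this order, form a string C-group of rank $4$; that is, $\rho_i$ and $\rho_j$ commute whenever $|i-j|>1$, and $\langle\rho_i\mid i\in I\rangle\cap\langle\rho_i\mid i\in J\rangle=\langle\rho_i\mid i\in I\cap J\rangle$ for all $I,J\subseteq\{1,2,3,4\}$. Put $G=\langle\rho_1,\rho_2,\rho_3,\rho_4\rangle$, $G_1=\langle\rho_2,\rho_3,\rho_4\rangle$, $G_4=\langle\rho_1,\rho_2,\rho_3\rangle$, and let $k_1,k_2,k_3$ be the orders of $\rho_1\rho_2$, $\rho_2\rho_3$, $\rho_3\rho_4$ (the Schläfli type $[k_1,k_2,k_3]$). Then the following hold. 1. One of the following is true: - $G\cong D_{2p}^2=D_{2p}\times D_{2p}$, where $D_{2p}$ is the dihedral group of order $2p$, and $G$ preserves two distinct points or, dually, two distinct lines of $\mathrm{PG}(2,q)$;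 - $G\cong He_p:C_2^2$, and $G$ preserves a point and a line incident with it. Here $He_p:C_2^2$ is the group of upper triangular $3\times 3$ matrices over $\mathbb F_p$ of determinant $1$ with diagonal entries $\pm1$, the semidirect product of the Heisenberg group $He_p$ of unitriangular matrices by the diagonal matrices of determinant $1$ with entries $\pm 1$; - $G\cong\mathrm{P\Omega}(3,q')$ or $G\cong\mathrm{PSO}(3,q')$ for some $q'$ with $q=q'^m$, $m\ge 1$, and $G$ preserves a nondegenerate conic of $\mathrm{PG}(2,q)$. 2. If each of $G_1$ and $G_4$ is isomorphic to $\mathrm{Sym}(4)$ or $\mathrm{Alt}(5)$, then $$k_1,k_3\in\{3,5\},\quad k_2\in\{3,4,5\},\quad\text{and } k_2=4 \text{ only if } k_1=k_3=3.\qquad(*)$$ 3. Suppose that $(*)$ holds. Let $R_i\in\mathrm{SL}(3,q)$ be the lift of $\rho_i$ with $R_i^2=1$, and define $a,a'\in\mathbb F_q$ by $\operatorname{tr}(R_1R_2)=1+2a$ and $\operatorname{tr}(R_3R_4)=1+2a'$. Then the data are given by one of the rows of the following table, where $X\in\mathbb F_q$ is some element with $X^2=5$. | $[k_1,k_2,k_3]$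 | $a$ | $a'$ | $p$ | |---|---|---|---| | $[3,3,3]$ | $-\frac12$ | $-\frac12$ | $5$ | | $[3,5,3]$ | $-\frac12$ | $-\frac12$ | $11$ | | $[3,5,5]$ | $-\frac12$ | $\frac{-1+X}{4}$ | $59$ | | $[5,5,3]$ | $\frac{-1+X}{4}$ | $-\frac12$ | $59$ | | $[5,3,5]$ | $\frac{-1+X}{4}$ | $\frac{-1+X}{4}$ | $19$ | | $[5,5,5]$ | $\frac{-1+X}{4}$ | $\frac{-1+X}{4}$ | $3$ or $11$ | | $[5,5,5]$ | $\frac{-1+X}{4}$ | $\frac{-1-X}{4}$ | $19$ | -/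

import Mathlib

open scoped LinearAlgebra.Projectivization Pointwise

/-! ## String C-groups -/

/-- The involutions `ρ 0, …, ρ (r - 1)` of a group `Γ`, in this order, form a string C-group
(of rank `r`, with group `Subgroup.closure (Set.range ρ)`): non-adjacent involutions commute, and
the intersection property holds. -/
structure IsStringCGroup {Γ : Type*} [Group Γ] {r : ℕ} (ρ : Fin r → Γ) : Prop where
  involution : ∀ i, orderOf (ρ i) = 2
  string : ∀ i j : Fin r, (i : ℕ) + 1 < (j : ℕ) → Commute (ρ i) (ρ j)
  inter : ∀ I J : Set (Fin r),
    Subgroup.closure (ρ '' I) ⊓ Subgroup.closure (ρ '' J) = Subgroup.closure (ρ '' (I ∩ J))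

/-! ## The projective plane `PG(2,q)` -/

/-- `PSL(3,q)`, where `F` is the field with `q` elements. -/
abbrev PSL3 (F : Type*) [Field F] : Type _ := Matrix.ProjectiveSpecialLinearGroup (Fin 3) F

/-- The (points of the) projective plane over `F`, on which `PSL3 F` acts. -/
abbrev PG2 (F : Type*) [Field F] : Type _ := ℙ F (Fin 3 → F)

/-- A line of the projective plane, as the set of its points. -/
def IsLine {F : Type*} [Field F] (L : Set (PG2 F)) : Prop :=
  ∃ W : Submodule F (Fin 3 → F), Module.finrank F W = 2 ∧ L = {P | P.submodule ≤ W}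

/-- A (nondegenerate) conic of the projective plane (in odd characteristic), as the set of its
points: the zeros of a nondegenerate quadratic form. -/
def IsConic {F : Type*} [Field F] (C : Set (PG2 F)) : Prop :=
  ∃ Q : QuadraticForm F (Fin 3 → F), Q.polarBilin.Nondegenerate ∧ C = {P | Q P.rep = 0}

/-- The group `G` fixes the point `P`. -/
def FixesPoint {F : Type*} [Field F] (G : Subgroup (PSL3 F)) (P : PG2 F) : Prop :=
  ∀ g ∈ G, g • P = P

/-- The group `G` maps the set `S` of points onto itself. -/
def PreservesSet {F : Type*} [Field F] (G : Subgroup (PSL3 F)) (S : Set (PG2 F)) : Prop :=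
  ∀ g ∈ G, g • S = S

/-! ## The abstract groups -/

/-- `He_p : C_2²`: the group of upper triangular matrices of determinant `1` over the field with
`p` elements whose diagonal entries are `1` or `-1`. It is the (internal) semidirect product of
the Heisenberg group of order `p ^ 3` (the upper unitriangular matrices) by the group
`diag(±1, ±1, ±1)` of determinant `1`, which is elementary abelian of order `4` for odd `p`. -/
def heisenbergSemidirect (p : ℕ) : Subgroup (Matrix.SpecialLinearGroup (Fin 3) (ZMod p)) where
  carrier := {A | (A 1 0 = 0 ∧ A 2 0 = 0 ∧ A 2 1 = 0) ∧ ∀ i, A i i = 1 ∨ A i i = -1}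
  one_mem' := by
    constructor
    · simp
    · intro i; simp
  mul_mem' := by
    rintro A B ⟨⟨a1, a2, a3⟩, ha⟩ ⟨⟨b1, b2, b3⟩, hb⟩
    refine ⟨⟨?_, ?_, ?_⟩, ?_⟩
    · simp [Matrix.mul_apply, Fin.sum_univ_three, a1, b1, b2]
    · simp [Matrix.mul_apply, Fin.sum_univ_three, a2, a3, b1, b2]
    · simp [Matrix.mul_apply, Fin.sum_univ_three, a2, a3, b3]
    · intro i
      have h : (A * B) i i = A i i * B i i := by
        fin_cases i <;>
          simp [Matrix.mul_apply, Fin.sum_univ_three, a1, a2, a3, b1, b2, b3]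
      rw [h]
      rcases ha i with h1 | h1 <;> rcases hb i with h2 | h2 <;> simp [h1, h2]
  inv_mem' := by
    rintro A ⟨⟨a1, a2, a3⟩, ha⟩
    refine ⟨⟨?_, ?_, ?_⟩, ?_⟩
    · simp [Matrix.adjugate_fin_three, a1, a2, a3]
    · simp [Matrix.adjugate_fin_three, a1, a2, a3]
    · simp [Matrix.adjugate_fin_three, a1, a2, a3]
    · intro i
      rcases ha 0 with h0 | h0 <;> rcases ha 1 with h1 | h1 <;> rcases ha 2 with h2 | h2 <;>
        fin_cases i <;> simp [Matrix.adjugate_fin_three, a1, a2, a3, h0, h1, h2]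

/-- `SO(3,q)`, where `K` is the field with `q` elements, `q` odd: the group of the form
`x² + y² + z²`, to which every nondegenerate quadratic form in three variables is similar. -/
abbrev SO3 (K : Type*) [Field K] : Type _ := ↥(Matrix.specialOrthogonalGroup (Fin 3) K)

/-- `PSO(3,q)`. -/
abbrev PSO3 (K : Type*) [Field K] : Type _ := SO3 K ⧸ Subgroup.center (SO3 K)

/-- `Ω(3,q)`, the commutator subgroup of `SO(3,q)` (the kernel of the spinor norm). -/
abbrev Omega3 (K : Type*) [Field K] : Type _ := ↥(commutator (SO3 K))

/-- `PΩ(3,q)`. -/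
abbrev POmega3 (K : Type*) [Field K] : Type _ := Omega3 K ⧸ Subgroup.center (Omega3 K)

/-- The group `H` is isomorphic to `Sym(4)` or to `Alt(5)`. -/
def IsSym4OrAlt5 (H : Type*) [Group H] : Prop :=
  Nonempty (H ≃* Equiv.Perm (Fin 4)) ∨ Nonempty (H ≃* alternatingGroup (Fin 5))

/-! ## The exceptional Schläfli types -/

/-- The Schläfli types `[k₁, k₂, k₃]` in which `[k₁, k₂]` and `[k₂, k₃]` are both of one of the
forms `[3,3]`, `[3,4]`, `[4,3]`, `[3,5]`, `[5,3]`, `[5,5]` and `k₁`, `k₃` are odd. -/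
def IsExceptionalType (k₁ k₂ k₃ : ℕ) : Prop :=
  (k₁ = 3 ∨ k₁ = 5) ∧ (k₃ = 3 ∨ k₃ = 5) ∧
    (k₂ = 3 ∨ k₂ = 5 ∨ (k₂ = 4 ∧ k₁ = 3 ∧ k₃ = 3))

/-- The possibilities for the Schläfli type `[k₁, k₂, k₃]`, the characteristic `p`, and the
parameters `a`, `a'`; here `X` is a square root of `5`. -/
def ExceptionalTable {F : Type*} [Field F] (p k₁ k₂ k₃ : ℕ) (a a' X : F) : Prop :=
  ((k₁, k₂, k₃) = (3, 3, 3) ∧ a = -1 / 2 ∧ a' = -1 / 2 ∧ p = 5) ∨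
  ((k₁, k₂, k₃) = (3, 5, 3) ∧ a = -1 / 2 ∧ a' = -1 / 2 ∧ p = 11) ∨
  ((k₁, k₂, k₃) = (3, 5, 5) ∧ X ^ 2 = 5 ∧ a = -1 / 2 ∧ a' = (-1 + X) / 4 ∧ p = 59) ∨
  ((k₁, k₂, k₃) = (5, 5, 3) ∧ X ^ 2 = 5 ∧ a = (-1 + X) / 4 ∧ a' = -1 / 2 ∧ p = 59) ∨
  ((k₁, k₂, k₃) = (5, 3, 5) ∧ X ^ 2 = 5 ∧ a = (-1 + X) / 4 ∧ a' = (-1 + X) / 4 ∧ p = 19) ∨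
  ((k₁, k₂, k₃) = (5, 5, 5) ∧ X ^ 2 = 5 ∧ a = (-1 + X) / 4 ∧ a' = (-1 + X) / 4 ∧
    (p = 3 ∨ p = 11)) ∨
  ((k₁, k₂, k₃) = (5, 5, 5) ∧ X ^ 2 = 5 ∧ a = (-1 + X) / 4 ∧ a' = (-1 - X) / 4 ∧ p = 19)

/-! For q odd, an involution of PSL(3,q) lifts to an involutory homology u ↦ 2(φ·u)v - u of SL(3,q),
with centre v, axis φ = 0 and φ·v = 1. If two distinct homologies commute, each centre lies on the
other axis. So the four generators give centres v_i and axes φ_i for which the matrix (φ_i·v_j) is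
tridiagonal with diagonal 1. Put x = (φ_0·v_1)(φ_1·v_0), and let y and z be the same products for
the next two adjacent pairs. Four vectors in a space of dimension three have singular Gram matrix,
whence (1 - x)(1 - z) = y (`gram_eq`).

The product of the first two homologies has trace 4x - 1, so order 3, 4 or 5 is a polynomial
condition on x, and likewise for y and z. Eliminating x, y, z from these conditions and the Gram
relation leaves an integer that vanishes in F; its prime factors give the table
(`exceptionalTable_of_gram`). The outer products have odd order, since otherwise a power of one
would be the generator at the opposite end (`odd_orderOf_mul`). Hence x and z are nonzero; oddness
together with the element orders of Sym(4) and Alt(5) also gives the list of types.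

For the structure of G there are three cases. If φ_1·v_2 = φ_2·v_1 = 0, the generators split into
two commuting pairs, each pair sharing a centre or each sharing an axis, and G is a product of two
dihedral groups (`reducible_case`). Otherwise, up to reversal, the vectors can be rescaled so that
φ_i·v_{i+1} = 1, and then x = 1 if and only if z = 1 (`gen_three_mem`, `Normal.eq_one_iff`). If x =
z = 1, suitable coordinates lie in the prime field and G is the Heisenberg extension
(`heisenberg_case`).

If x and z differ from 1, G preserves a nondegenerate quadratic form (`irreducible_case`). Over the
subfield K generated by x and z this form is similar to a sum of three squares, so G becomes a group
H of rotations in SO(3,K) generated by four half-turns. A count of the nontrivial elements of H by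
their axes, in the manner of Dickson, gives |H| = Qe(Q + 1) with e = Q - 1 or (Q - 1)/2, where Q is
the number of rotations about an isotropic point (`RotationGroup.card_eq`). The traces that generate
K are fixed by a ↦ a^Q, so K has at most Q elements and H has index at most two in SO(3,K)
(`card_le_two_mul`). A group of that index generated by half-turns is SO(3,K) or Ω(3,K)
(`eq_top_or_eq_commutator`). -/

open Matrix

/-! ### Involutory homologies as matrices. -/

namespace Homology

variable {F : Type*} [Field F]

/-- The involutory homology with centre `v` and axis `φ = 0` (when `φ ⬝ᵥ v = 1`). -/
def refl (v φ : Fin 3 → F) : Matrix (Fin 3) (Fin 3) F := (2 : F) • vecMulVec v φ - 1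

theorem refl_mulVec (v φ u : Fin 3 → F) : refl v φ *ᵥ u = (2 * (φ ⬝ᵥ u)) • v - u := by
  simp [refl, sub_mulVec, smul_mulVec, vecMulVec_mulVec, smul_smul]

theorem vecMul_refl (v φ w : Fin 3 → F) : w ᵥ* refl v φ = (2 * (w ⬝ᵥ v)) • φ - w := by
  simp [refl, vecMul_sub, vecMul_smul, vecMul_vecMulVec, smul_smul]

theorem det_refl {v φ : Fin 3 → F} (h : φ ⬝ᵥ v = 1) : (refl v φ).det = 1 := by
  rw [dotProduct, Fin.sum_univ_three] at h
  simp [refl, det_fin_three, vecMulVec_apply]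
  linear_combination 2 * h

theorem refl_mul_self {v φ : Fin 3 → F} (h : φ ⬝ᵥ v = 1) : refl v φ * refl v φ = 1 := by
  apply Matrix.ext_of_mulVec_single
  intro i
  rw [← mulVec_mulVec]
  simp only [refl_mulVec, dotProduct_sub, dotProduct_smul, h, one_mulVec]
  simp only [smul_eq_mul, mul_one]
  module

theorem trace_refl_mul (v φ w ψ : Fin 3 → F) (h : φ ⬝ᵥ v = 1) (h' : ψ ⬝ᵥ w = 1) :
    (refl v φ * refl w ψ).trace = 4 * ((φ ⬝ᵥ w) * (ψ ⬝ᵥ v)) - 1 := by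
  simp only [dotProduct, Fin.sum_univ_three] at h h'
  simp [refl, trace, Matrix.mul_apply, Fin.sum_univ_three, vecMulVec_apply, dotProduct]
  linear_combination (-2) * h - 2 * h'

theorem refl_smul (v φ : Fin 3 → F) {t : F} (ht : t ≠ 0) : refl (t • v) (t⁻¹ • φ) = refl v φ := by
  ext i j
  simp only [refl, Matrix.sub_apply, Matrix.smul_apply, vecMulVec_apply, Pi.smul_apply, smul_eq_mul]
  field_simp

theorem mul_refl_mul (g g' : Matrix (Fin 3) (Fin 3) F) (h : g * g' = 1) (v φ : Fin 3 → F) :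
    g * refl v φ * g' = refl (g *ᵥ v) (φ ᵥ* g') := by
  rw [refl, refl, Matrix.mul_sub, Matrix.sub_mul, Matrix.mul_one, h, Matrix.mul_smul,
    Matrix.smul_mul, mul_vecMulVec, vecMulVec_mul]

/-- The Cayley–Hamilton identity divided by A; as a polynomial identity in the entries it needs no
invertibility. -/
theorem sq_sub_trace_smul (A : Matrix (Fin 3) (Fin 3) F) :
    A * A - A.trace • A + A.adjugate.trace • (1 : Matrix (Fin 3) (Fin 3) F) = A.adjugate := by
  ext i j
  fin_cases i <;> fin_cases j <;>
    simp [adjugate_fin_three, trace, Matrix.mul_apply, Fin.sum_univ_three] <;> ring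

theorem adjugate_eq {A : Matrix (Fin 3) (Fin 3) F} (h : A * A = 1) (hd : A.det = 1) :
    A.adjugate = A := by
  have := congrArg (fun M => A * M) (mul_adjugate A)
  simp only [← mul_assoc, h, one_mul, hd, one_smul, mul_one] at this
  exact this

/-- With A² = 1 and adj A = A, Cayley–Hamilton reads (1 + tr A)(1 - A) = 0. -/
theorem trace_involution {A : Matrix (Fin 3) (Fin 3) F} (h : A * A = 1) (hd : A.det = 1)
    (h1 : A ≠ 1) : A.trace = -1 := by
  have e := sq_sub_trace_smul A
  rw [adjugate_eq h hd, h] at e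
  by_contra h2
  have h3 : 1 + A.trace ≠ 0 := fun h3 => h2 (by linear_combination h3)
  apply h1
  ext i j
  have e' := congrFun (congrFun e i) j
  simp only [Matrix.add_apply, Matrix.sub_apply, Matrix.smul_apply, smul_eq_mul] at e' ⊢
  apply mul_left_cancel₀ h3
  linear_combination -e'

set_option maxHeartbeats 1000000 in
-- This says that A + 1 has rank at most one. Up to sign its 2×2 minors are the entries of adj A -
-- A, with tr A + 1 added on the diagonal.
theorem minors_involution {A : Matrix (Fin 3) (Fin 3) F} (ha : A.adjugate = A)
    (ht : A.trace = -1) (i j k l : Fin 3) :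
    (A + 1) i j * (A + 1) k l = (A + 1) i l * (A + 1) k j := by
  have e : ∀ i j, A.adjugate i j = A i j := fun i j => by rw [ha]
  rw [trace, Fin.sum_univ_three] at ht
  simp only [diag_apply] at ht
  have e00 := e 0 0
  have e01 := e 0 1
  have e02 := e 0 2
  have e10 := e 1 0
  have e11 := e 1 1
  have e12 := e 1 2
  have e20 := e 2 0
  have e21 := e 2 1
  have e22 := e 2 2
  simp [adjugate_fin_three] at e00 e01 e02 e10 e11 e12 e20 e21 e22
  fin_cases i <;> fin_cases j <;> fin_cases k <;> fin_cases l <;>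
    simp only [Matrix.add_apply, Fin.zero_eta, Fin.mk_one, Fin.reduceFinMk, Matrix.one_apply_eq,
      Matrix.one_apply, Fin.reduceEq, if_false] <;>
    first
    | ring1
    | linear_combination e00 + ht
    | linear_combination -e00 - ht
    | linear_combination e01
    | linear_combination -e01
    | linear_combination e02
    | linear_combination -e02
    | linear_combination e10
    | linear_combination -e10
    | linear_combination e11 + ht
    | linear_combination -e11 - ht
    | linear_combination e12
    | linear_combination -e12
    | linear_combination e20
    | linear_combination -e20
    | linear_combination e21
    | linear_combination -e21
    | linear_combination e22 + ht
    | linear_combination -e22 - ht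

/-- A + 1 has rank one and trace 2, hence equals 2vφ with φ·v = 1. -/
theorem exists_eq_refl (h2 : (2 : F) ≠ 0) {A : Matrix (Fin 3) (Fin 3) F} (h : A * A = 1)
    (hd : A.det = 1) (h1 : A ≠ 1) : ∃ v φ : Fin 3 → F, φ ⬝ᵥ v = 1 ∧ A = refl v φ := by
  have ht := trace_involution h hd h1
  have ha := adjugate_eq h hd
  have m := minors_involution ha ht
  -- Since tr (A + 1) = 2 is nonzero, some entry is nonzero; its column serves as v and its row,
  -- rescaled, as φ.
  obtain ⟨a, b, hab⟩ : ∃ a b, (A + 1) a b ≠ 0 := by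
    by_contra hc
    push Not at hc
    rw [trace, Fin.sum_univ_three] at ht
    simp only [diag_apply] at ht
    have c0 := hc 0 0
    have c1 := hc 1 1
    have c2 := hc 2 2
    simp at c0 c1 c2
    apply h2
    linear_combination c0 + c1 + c2 - ht
  have key : ∀ i j, (2 : F)⁻¹ * (A + 1) i j
      = (A + 1) i b * ((2 : F)⁻¹ * ((A + 1) a b)⁻¹ * (A + 1) a j) := by
    intro i j
    have := m i j a b
    field_simp
    linear_combination this
  refine ⟨fun i => (A + 1) i b, fun j => (2 : F)⁻¹ * ((A + 1) a b)⁻¹ * (A + 1) a j, ?_, ?_⟩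
  · simp only [dotProduct]
    have : ∀ i, (2 : F)⁻¹ * ((A + 1) a b)⁻¹ * (A + 1) a i * (A + 1) i b
        = (2 : F)⁻¹ * (A + 1) i i := fun i => by rw [key]; ring
    simp only [this]
    rw [Fin.sum_univ_three]
    rw [trace, Fin.sum_univ_three] at ht
    simp only [diag_apply] at ht
    simp
    field_simp
    linear_combination ht
  · ext i j
    simp only [refl, Matrix.sub_apply, Matrix.smul_apply, vecMulVec_apply, ← key, smul_eq_mul]
    simp only [Matrix.add_apply]
    field_simp
    ring

/-- The eigenvalue 1 of an involutory homology is simple on vectors and on covectors, so a fixed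
pair recovers the centre and the axis. -/
theorem eq_refl_of_fixes (h2 : (2 : F) ≠ 0) {A : Matrix (Fin 3) (Fin 3) F} (h : A * A = 1)
    (hd : A.det = 1) (h1 : A ≠ 1) {v φ : Fin 3 → F} (hv : φ ⬝ᵥ v = 1) (hR : A *ᵥ v = v)
    (hφ : φ ᵥ* A = φ) : A = refl v φ := by
  obtain ⟨u, ψ, hu, e⟩ := exists_eq_refl h2 h hd h1
  rw [e, refl_mulVec] at hR
  rw [e, vecMul_refl] at hφ
  have e1 : v = (ψ ⬝ᵥ v) • u := by
    ext i
    have := congrFun hR i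
    simp at this ⊢
    apply mul_left_cancel₀ h2
    linear_combination -this
  have e2 : φ = (φ ⬝ᵥ u) • ψ := by
    ext i
    have := congrFun hφ i
    simp at this ⊢
    apply mul_left_cancel₀ h2
    linear_combination -this
  have e3 : (ψ ⬝ᵥ v) * (φ ⬝ᵥ u) = 1 := by
    have := hv
    rw [e2, smul_dotProduct, smul_eq_mul] at this
    linear_combination this
  rw [e]
  have h0 : ψ ⬝ᵥ v ≠ 0 := left_ne_zero_of_mul_eq_one e3
  rw [← refl_smul u ψ h0, ← e1, ← eq_inv_of_mul_eq_one_right e3, ← e2]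

theorem refl_ne_one (h2 : (2 : F) ≠ 0) (v φ : Fin 3 → F) : refl v φ ≠ 1 := by
  intro h
  have m : ∀ i j, 2 * (v i * φ j) = 2 * (1 : Matrix (Fin 3) (Fin 3) F) i j := by
    intro i j
    have := congrFun (congrFun h i) j
    simp [refl, vecMulVec_apply] at this
    linear_combination this
  have a := mul_left_cancel₀ h2 (m 0 0)
  have b := mul_left_cancel₀ h2 (m 1 1)
  have c := mul_left_cancel₀ h2 (m 0 1)
  simp at a b c
  rcases c with c | c <;> simp [c] at a b

/-- Comparing the two products gives (φ·w) vψ = (ψ·v) wφ as rank-one maps. If φ·w were nonzero, the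
centres and the axes would be proportional and the homologies equal. -/
theorem dotProduct_eq_zero_of_commute (h2 : (2 : F) ≠ 0) {v φ w ψ : Fin 3 → F}
    (hv : φ ⬝ᵥ v = 1) (hw : ψ ⬝ᵥ w = 1) (hne : refl v φ ≠ refl w ψ)
    (hc : refl v φ * refl w ψ = refl w ψ * refl v φ) : φ ⬝ᵥ w = 0 ∧ ψ ⬝ᵥ v = 0 := by
  have key : ∀ u, (φ ⬝ᵥ w) • ((ψ ⬝ᵥ u) • v) = (ψ ⬝ᵥ v) • ((φ ⬝ᵥ u) • w) := by
    intro u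
    have := congrArg (fun M => M *ᵥ u) hc
    simp only [← mulVec_mulVec, refl_mulVec, dotProduct_sub, dotProduct_smul, smul_eq_mul] at this
    ext i
    have := congrFun this i
    simp at this ⊢
    apply mul_left_cancel₀ (mul_ne_zero h2 h2)
    linear_combination this
  have hkv := key v
  have hkw := key w
  rw [hv, one_smul] at hkv
  rw [hw, one_smul] at hkw
  by_cases ha : φ ⬝ᵥ w = 0
  · refine ⟨ha, ?_⟩
    have := congrArg (fun u => ψ ⬝ᵥ u) hkv
    simp only [ha, zero_smul, dotProduct_smul, dotProduct_zero, hw, smul_eq_mul, mul_one] at this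
    exact this.symm
  · exfalso
    have hb : ψ ⬝ᵥ v ≠ 0 := by
      intro hb
      have := congrArg (fun u => φ ⬝ᵥ u) hkw
      simp only [hb, zero_smul, dotProduct_smul, dotProduct_zero, hv, smul_eq_mul, mul_one] at this
      exact ha this
    have e1 : (φ ⬝ᵥ w) • v = w := by
      have : (ψ ⬝ᵥ v) • ((φ ⬝ᵥ w) • v) = (ψ ⬝ᵥ v) • w := by rw [← hkv, smul_comm]
      exact smul_right_injective _ hb this
    have e3 : (φ ⬝ᵥ w) * (ψ ⬝ᵥ v) = 1 := by
      have := congrArg (fun u => ψ ⬝ᵥ u) e1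
      simpa only [dotProduct_smul, hw, smul_eq_mul] using this
    have e2 : ψ = (φ ⬝ᵥ w)⁻¹ • φ := by
      apply dotProduct_eq
      intro u
      have h3 := congrArg (fun z => φ ⬝ᵥ z) (key u)
      simp only [dotProduct_smul, hv, smul_eq_mul, mul_one] at h3
      rw [smul_dotProduct, smul_eq_mul]
      apply mul_left_cancel₀ ha
      rw [h3, mul_inv_cancel_left₀ ha]
      linear_combination (φ ⬝ᵥ u) * e3
    apply hne
    rw [← refl_smul v φ ha, e1, ← e2]

end Homology

/-! ### Homologies in SL(3), lifting from PSL(3), and orders of products. -/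

namespace Homology

variable {F : Type*} [Field F]

theorem sl_smul_def (A : SpecialLinearGroup (Fin 3) F) (u : Fin 3 → F) : A • u = A.1 *ᵥ u := rfl

theorem sl_ext_smul {A B : SpecialLinearGroup (Fin 3) F} (h : ∀ u : Fin 3 → F, A • u = B • u) :
    A = B :=
  Subtype.ext (Matrix.ext_of_mulVec_single fun i => h (Pi.single i 1))

/-- The involutory homology with centre `v` and axis `φ = 0`, in the special linear group. -/
def reflSL (v φ : Fin 3 → F) (h : φ ⬝ᵥ v = 1) : SpecialLinearGroup (Fin 3) F :=
  ⟨refl v φ, det_refl h⟩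

theorem reflSL_smul (v φ : Fin 3 → F) (h : φ ⬝ᵥ v = 1) (u : Fin 3 → F) :
    reflSL v φ h • u = (2 * (φ ⬝ᵥ u)) • v - u := refl_mulVec v φ u

theorem reflSL_mul_self (v φ : Fin 3 → F) (h : φ ⬝ᵥ v = 1) : reflSL v φ h * reflSL v φ h = 1 :=
  Subtype.ext (refl_mul_self h)

theorem dotProduct_reflSL_smul (v φ ψ : Fin 3 → F) (h : φ ⬝ᵥ v = 1) (u : Fin 3 → F) :
    ψ ⬝ᵥ (reflSL v φ h • u) = 2 * (φ ⬝ᵥ u) * (ψ ⬝ᵥ v) - ψ ⬝ᵥ u := by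
  rw [reflSL_smul, dotProduct_sub, dotProduct_smul, smul_eq_mul]

theorem exists_eq_reflSL (h2 : (2 : F) ≠ 0) {R : SpecialLinearGroup (Fin 3) F} (h : R * R = 1)
    (h1 : R ≠ 1) : ∃ (v φ : Fin 3 → F) (hv : φ ⬝ᵥ v = 1), R = reflSL v φ hv := by
  obtain ⟨v, φ, hv, e⟩ := exists_eq_refl h2 (congrArg Subtype.val h) R.2
    (fun e => h1 (Subtype.ext e))
  exact ⟨v, φ, hv, Subtype.ext e⟩

theorem eq_reflSL_of_fixes (h2 : (2 : F) ≠ 0) {R : SpecialLinearGroup (Fin 3) F} (h : R * R = 1)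
    (h1 : R ≠ 1) {v φ : Fin 3 → F} (hv : φ ⬝ᵥ v = 1) (hR : R • v = v)
    (hφ : ∀ u : Fin 3 → F, φ ⬝ᵥ (R • u) = φ ⬝ᵥ u) : R = reflSL v φ hv := by
  refine Subtype.ext (eq_refl_of_fixes h2 (congrArg Subtype.val h) R.2
    (fun e => h1 (Subtype.ext e)) hv hR ?_)
  refine dotProduct_eq _ _ fun u => ?_
  rw [← dotProduct_mulVec]
  exact hφ u

theorem center_pow_three {Z : SpecialLinearGroup (Fin 3) F}
    (hZ : Z ∈ Subgroup.center (SpecialLinearGroup (Fin 3) F)) : Z ^ 3 = 1 := by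
  obtain ⟨c, hc, e⟩ := Matrix.SpecialLinearGroup.mem_center_iff.mp hZ
  apply sl_ext_smul
  intro u
  have h : ∀ w : Fin 3 → F, Z • w = c • w := by
    intro w
    rw [sl_smul_def, ← e]
    simp
  rw [pow_succ, pow_two, mul_smul, mul_smul, h, h, h, one_smul, smul_smul, smul_smul]
  have : c * c * c = 1 := by
    rw [← hc]; simp; ring
  rw [this, one_smul]

theorem center_eq_one {Z : SpecialLinearGroup (Fin 3) F}
    (hZ : Z ∈ Subgroup.center (SpecialLinearGroup (Fin 3) F)) {u : Fin 3 → F} (hu : u ≠ 0)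
    (h : Z • u = u) : Z = 1 := by
  obtain ⟨c, hc, e⟩ := Matrix.SpecialLinearGroup.mem_center_iff.mp hZ
  have h' : ∀ w : Fin 3 → F, Z • w = c • w := by
    intro w
    rw [sl_smul_def, ← e]
    simp
  have hc1 : c = 1 := by
    have h3 : (c - 1) • u = 0 := by rw [sub_smul, ← h', h, one_smul, sub_self]
    exact sub_eq_zero.mp ((smul_eq_zero.mp h3).resolve_right hu)
  apply sl_ext_smul
  intro w
  rw [h', hc1, one_smul, one_smul]

/-- The centre has exponent dividing 3. If A is a lift, A² is central, so A³ is another lift, and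
its square (A²)³ is 1. -/
theorem exists_lift_involution {ρ : PSL3 F} (h : orderOf ρ = 2) :
    ∃ R : SpecialLinearGroup (Fin 3) F, R * R = 1 ∧ R ≠ 1 ∧ (QuotientGroup.mk R : PSL3 F) = ρ := by
  obtain ⟨A, rfl⟩ := QuotientGroup.mk_surjective ρ
  have hp : (QuotientGroup.mk (A ^ 2) : PSL3 F) = 1 := by
    rw [QuotientGroup.mk_pow, ← h, pow_orderOf_eq_one]
  have hA := center_pow_three ((QuotientGroup.eq_one_iff _).mp hp)
  have e : (QuotientGroup.mk (A ^ 3) : PSL3 F) = QuotientGroup.mk A := by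
    rw [pow_succ, QuotientGroup.mk_mul, hp, one_mul]
  refine ⟨A ^ 3, ?_, ?_, e⟩
  · rw [← hA]; group
  · intro h1
    rw [h1, QuotientGroup.mk_one] at e
    rw [← e, orderOf_one] at h
    omega

/-- The commutator RSRS is central with cube 1. Conjugation by R inverts it, so its square is also
1, and it is trivial. -/
theorem commute_of_commute_mk {R S : SpecialLinearGroup (Fin 3) F} (hR : R * R = 1) (hS : S * S = 1)
    (h : Commute (QuotientGroup.mk R : PSL3 F) (QuotientGroup.mk S)) : R * S = S * R := by
  have hR' : R⁻¹ = R := inv_eq_of_mul_eq_one_left hR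
  have hS' : S⁻¹ = S := inv_eq_of_mul_eq_one_left hS
  have hz : R * S * R * S ∈ Subgroup.center (SpecialLinearGroup (Fin 3) F) := by
    rw [← QuotientGroup.eq_one_iff]
    have : R * S * R * S = R * S * (S * R)⁻¹ := by rw [_root_.mul_inv_rev, hR', hS', ← mul_assoc]
    rw [this, QuotientGroup.mk_mul, QuotientGroup.mk_inv, QuotientGroup.mk_mul,
      QuotientGroup.mk_mul, h.eq, mul_inv_cancel]
  have h3 := center_pow_three hz
  have hcomm := Subgroup.mem_center_iff.mp hz R
  have h2 : (R * S * R * S) * (R * S * R * S) = 1 := by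
    have : R * (R * S * R * S) * R⁻¹ = (R * S * R * S)⁻¹ := by
      simp only [_root_.mul_inv_rev, hR', hS', ← mul_assoc, hR, one_mul]
    rw [hcomm, mul_inv_cancel_right] at this
    nth_rewrite 2 [this]
    exact mul_inv_cancel _
  have h1 : R * S * R * S = 1 := by
    rw [pow_succ, pow_two, h2, one_mul] at h3
    exact h3
  have : R * S * R * S = R * S * (S * R)⁻¹ := by rw [_root_.mul_inv_rev, hR', hS', ← mul_assoc]
  rw [this] at h1
  exact mul_inv_eq_one.mp h1

theorem exists_common_zero (φ ψ : Fin 3 → F) : ∃ u : Fin 3 → F, u ≠ 0 ∧ φ ⬝ᵥ u = 0 ∧ ψ ⬝ᵥ u = 0 := by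
  obtain ⟨u, hu, e⟩ := (exists_mulVec_eq_zero_iff (M := Matrix.of ![φ, ψ, 0])).mpr
    (by simp [det_fin_three])
  refine ⟨u, hu, ?_, ?_⟩
  · simpa [mulVec] using congrFun e 0
  · simpa [mulVec] using congrFun e 1

/-- The two axes share a nonzero vector, which the product fixes; a scalar power of the product is
therefore 1. -/
theorem orderOf_mk_reflSL_mul (v φ w ψ : Fin 3 → F) (h : φ ⬝ᵥ v = 1) (h' : ψ ⬝ᵥ w = 1) :
    orderOf ((QuotientGroup.mk (reflSL v φ h) : PSL3 F) * QuotientGroup.mk (reflSL w ψ h')) =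
      orderOf (reflSL v φ h * reflSL w ψ h') := by
  obtain ⟨u, hu, h1, h2⟩ := exists_common_zero φ ψ
  have hfix : (reflSL v φ h * reflSL w ψ h') • u = u := by
    rw [mul_smul, reflSL_smul w, h2, mul_zero, zero_smul, zero_sub, smul_neg, reflSL_smul, h1,
      mul_zero, zero_smul, zero_sub, neg_neg]
  have hpow : ∀ m : ℕ, (reflSL v φ h * reflSL w ψ h') ^ m • u = u := by
    intro m
    induction m with
    | zero => rw [pow_zero, one_smul]
    | succ m ih => rw [pow_succ, mul_smul, hfix, ih]
  rw [← QuotientGroup.mk_mul]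
  apply orderOf_eq_orderOf_iff.mpr
  intro m
  rw [← QuotientGroup.mk_pow, QuotientGroup.eq_one_iff]
  constructor
  · intro hm
    exact center_eq_one hm hu (hpow m)
  · intro hm
    rw [hm]
    exact Subgroup.one_mem _

/-- If the homologies with centres `v`, `w` commute with the homology with centre `z`, and the
latter is not in the group they generate, then their product has odd order. -/
theorem odd_orderOf_mul [Finite F] (h2 : (2 : F) ≠ 0) {v φ w ψ z χ : Fin 3 → F} (h : φ ⬝ᵥ v = 1)
    (h' : ψ ⬝ᵥ w = 1) (h'' : χ ⬝ᵥ z = 1) (e1 : φ ⬝ᵥ z = 0) (e2 : ψ ⬝ᵥ z = 0) (e3 : χ ⬝ᵥ v = 0)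
    (e4 : χ ⬝ᵥ w = 0)
    (hn : reflSL z χ h'' ∉ Subgroup.closure {reflSL v φ h, reflSL w ψ h'}) :
    Odd (orderOf (reflSL v φ h * reflSL w ψ h')) := by
  set r := reflSL v φ h * reflSL w ψ h' with hr
  rw [← Nat.not_even_iff_odd]
  rintro ⟨m, hm⟩
  have hpos : 0 < orderOf r := orderOf_pos r
  have hfix : ∀ j : ℕ, r ^ j • z = z := by
    intro j
    induction j with
    | zero => rw [pow_zero, one_smul]
    | succ j ih =>
      rw [pow_succ, mul_smul, hr, mul_smul, reflSL_smul w, e2, mul_zero, zero_smul, zero_sub,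
        smul_neg, reflSL_smul, e1, mul_zero, zero_smul, zero_sub, neg_neg, ← hr, ih]
  have hcov : ∀ j : ℕ, ∀ u : Fin 3 → F, χ ⬝ᵥ (r ^ j • u) = χ ⬝ᵥ u := by
    intro j
    induction j with
    | zero => intro u; rw [pow_zero, one_smul]
    | succ j ih =>
      intro u
      rw [pow_succ, mul_smul, ih, hr, mul_smul, dotProduct_reflSL_smul, e3, mul_zero, zero_sub,
        dotProduct_reflSL_smul, e4]
      ring
  apply hn
  -- If the order were 2m, the power r^m would be an involution fixing z and χ, hence the excluded
  -- homology.
  rw [← eq_reflSL_of_fixes h2 (R := r ^ m) ?_ ?_ h'' (hfix m) (hcov m)]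
  · apply Subgroup.pow_mem
    apply Subgroup.mul_mem <;> apply Subgroup.subset_closure <;> simp
  · rw [← pow_add, ← hm, pow_orderOf_eq_one]
  · intro h1
    have := orderOf_le_of_pow_eq_one (by omega) h1
    omega

/-- If the product vanished, one of the centres would be an eigenvector of RS for the eigenvalue -1,
which is impossible in odd order. -/
theorem dotProduct_mul_ne_zero [Finite F] (h2 : (2 : F) ≠ 0) {v φ w ψ : Fin 3 → F}
    (h : φ ⬝ᵥ v = 1) (h' : ψ ⬝ᵥ w = 1) (ho : Odd (orderOf (reflSL v φ h * reflSL w ψ h'))) :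
    (φ ⬝ᵥ w) * (ψ ⬝ᵥ v) ≠ 0 := by
  intro h0
  obtain ⟨u, hu, e⟩ : ∃ u : Fin 3 → F, u ≠ 0 ∧ (reflSL v φ h * reflSL w ψ h') • u = -u := by
    by_cases h3 : ψ ⬝ᵥ v = 0
    · refine ⟨v, ?_, ?_⟩
      · rintro rfl
        simp at h
      · rw [mul_smul, reflSL_smul w, h3, mul_zero, zero_smul, zero_sub, smul_neg, reflSL_smul, h]
        module
    · have h4 := (mul_eq_zero.mp h0).resolve_right h3
      refine ⟨w, ?_, ?_⟩
      · rintro rfl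
        simp at h'
      · rw [mul_smul, reflSL_smul w, h', smul_sub, smul_comm, reflSL_smul v, h4]
        module
  have hpow : ∀ m : ℕ, (reflSL v φ h * reflSL w ψ h') ^ m • u = (-1 : F) ^ m • u := by
    intro m
    induction m with
    | zero => rw [pow_zero, one_smul, pow_zero, one_smul]
    | succ m ih => rw [pow_succ, mul_smul, e, smul_neg, ih, pow_succ]; module
  have := hpow (orderOf (reflSL v φ h * reflSL w ψ h'))
  rw [pow_orderOf_eq_one, ho.neg_one_pow, one_smul] at this
  have h5 : (2 : F) • u = 0 := by
    rw [two_smul]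
    nth_rewrite 1 [this]
    module
  exact (smul_ne_zero h2 hu) h5

/-- The cyclotomic relations between the trace and the order of an element of `SL(3)`, with
equal trace and trace of the inverse. -/
theorem sub_one_mul_sq {A : Matrix (Fin 3) (Fin 3) F} (hd : A.det = 1)
    (ht : A.adjugate.trace = A.trace) :
    (A - 1) * A ^ 2 = (A.trace - 1) • ((A - 1) * A) - (A - 1) := by
  have e := congrArg (fun M => M * A) (sq_sub_trace_smul A)
  simp only [adjugate_mul, hd, ht, one_smul, add_mul, sub_mul, smul_mul_assoc, one_mul] at e
  simp only [sub_mul, one_mul]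
  have e3 : A * A ^ 2 = A * A * A := by rw [pow_two, mul_assoc]
  rw [e3, pow_two]
  ext i j
  have e' := congrFun (congrFun e i) j
  simp only [Matrix.add_apply, Matrix.sub_apply, Matrix.smul_apply, smul_eq_mul] at e' ⊢
  linear_combination e'

/-- Put s = tr A - 1. On the image of A - 1 one has A² - sA + 1 = 0 by `sub_one_mul_sq`, and A² + A
+ 1 = 0 because A³ = 1. Subtraction gives (s + 1)A = 0 there. -/
theorem trace_of_pow_three {A : Matrix (Fin 3) (Fin 3) F} (hd : A.det = 1)
    (ht : A.adjugate.trace = A.trace) (h : A ^ 3 = 1) (h1 : A ≠ 1) : A.trace - 1 = -1 := by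
  have e := sub_one_mul_sq hd ht
  by_contra h0
  have h3 : A.trace ≠ 0 := fun h3 => h0 (by rw [h3]; ring)
  have e2 : A.trace • (A * (A - 1)) = 0 := by
    have : A * A ^ 2 = 1 := by rw [← h]; exact (pow_succ' A 2).symm
    rw [sub_mul, sub_mul, this, one_mul, one_mul] at e
    rw [mul_sub, mul_one]
    rw [pow_two] at e
    ext i j
    have e' := congrFun (congrFun e i) j
    simp only [Matrix.sub_apply, Matrix.smul_apply, smul_eq_mul, Matrix.zero_apply] at e' ⊢
    linear_combination -e'
  have e4 := (smul_eq_zero.mp e2).resolve_left h3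
  apply h1
  have := congrArg (fun M => A.adjugate * M) e4
  simp only [← mul_assoc, adjugate_mul, hd, one_smul, one_mul, mul_zero] at this
  exact sub_eq_zero.mp this

theorem mul_pow_cancel {A : Matrix (Fin 3) (Fin 3) F} (hd : A.det = 1) {M : Matrix (Fin 3) (Fin 3) F}
    (h : M * A = 0) : M = 0 := by
  have := congrArg (fun N => N * A.adjugate) h
  simpa only [mul_assoc, mul_adjugate, hd, one_smul, mul_one, zero_mul] using this

/-- On the image of A - 1 the element A + A⁻¹ acts as s, and the fifth cyclotomic polynomial divided
by X² is s² + s - 1 in s = X + X⁻¹. -/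
theorem trace_of_pow_five {A : Matrix (Fin 3) (Fin 3) F} (hd : A.det = 1)
    (ht : A.adjugate.trace = A.trace) (h : A ^ 5 = 1) (h1 : A ≠ 1) :
    (A.trace - 1) ^ 2 + (A.trace - 1) - 1 = 0 := by
  have e := sub_one_mul_sq hd ht
  set s := A.trace - 1
  set a0 := A - 1 with ha0
  have e3 := congrArg (fun M => M * A) e
  have e4 := congrArg (fun M => M * A) e3
  have e5 : a0 * A * A * A * A + a0 * A * A * A + a0 * A * A + a0 * A + a0 = 0 := by
    have : A ^ 5 - 1 = 0 := by rw [h, sub_self]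
    rw [← this, ha0]
    noncomm_ring
  simp only [sub_mul, smul_mul_assoc, pow_two, ← mul_assoc] at e e3 e4
  by_contra h0
  have e6 : (s ^ 2 + s - 1) • (a0 * A * A) = 0 := by
    ext i j
    have f := congrFun (congrFun e i) j
    have f3 := congrFun (congrFun e3 i) j
    have f4 := congrFun (congrFun e4 i) j
    have f5 := congrFun (congrFun e5 i) j
    simp only [Matrix.add_apply, Matrix.sub_apply, Matrix.smul_apply, smul_eq_mul,
      Matrix.zero_apply] at f f3 f4 f5 ⊢
    linear_combination f5 - f4 - (1 + s) * f3 - f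
  have e7 := (smul_eq_zero.mp e6).resolve_left h0
  exact h1 (sub_eq_zero.mp (mul_pow_cancel hd (mul_pow_cancel hd e7)))

/-- As for order 5: reducing X³ + X² + X + 1 modulo X² - sX + 1 leaves s(A² - 1)A = 0. -/
theorem trace_of_pow_four {A : Matrix (Fin 3) (Fin 3) F} (hd : A.det = 1)
    (ht : A.adjugate.trace = A.trace) (h : A ^ 4 = 1) (h1 : A ^ 2 ≠ 1) :
    A.trace - 1 = 0 := by
  have e := sub_one_mul_sq hd ht
  set s := A.trace - 1
  set a0 := A - 1 with ha0
  have e3 := congrArg (fun M => M * A) e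
  have e5 : a0 * A * A * A + a0 * A * A + a0 * A + a0 = 0 := by
    have : A ^ 4 - 1 = 0 := by rw [h, sub_self]
    rw [← this, ha0]
    noncomm_ring
  simp only [sub_mul, smul_mul_assoc, pow_two, ← mul_assoc] at e e3
  by_contra h0
  have e6 : s • ((A ^ 2 - 1) * A) = 0 := by
    have : (A ^ 2 - 1) * A = a0 * A * A + a0 * A := by rw [ha0]; noncomm_ring
    rw [this]
    ext i j
    have f := congrFun (congrFun e i) j
    have f3 := congrFun (congrFun e3 i) j
    have f5 := congrFun (congrFun e5 i) j
    simp only [Matrix.add_apply, Matrix.sub_apply, Matrix.smul_apply, smul_eq_mul,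
      Matrix.zero_apply] at f f3 f5 ⊢
    linear_combination f5 - f3 - f
  have e7 := (smul_eq_zero.mp e6).resolve_left h0
  exact h1 (sub_eq_zero.mp (mul_pow_cancel hd e7))

end Homology

/-! ### Frames: four centres and axes, with their symmetries and normalisation. -/

namespace Homology

variable {F : Type*} [Field F]

theorem reflSL_congr {v φ w ψ : Fin 3 → F} {h : φ ⬝ᵥ v = 1} {h' : ψ ⬝ᵥ w = 1}
    (e : refl v φ = refl w ψ) : reflSL v φ h = reflSL w ψ h' := Subtype.ext e

/-- Centres and axes of four homologies of which non-adjacent ones commute. -/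
structure Frame (F : Type*) [Field F] where
  v : Fin 4 → Fin 3 → F
  φ : Fin 4 → Fin 3 → F
  pair : ∀ i, φ i ⬝ᵥ v i = 1
  orth : ∀ i j : Fin 4, (i : ℕ) + 1 < (j : ℕ) → φ i ⬝ᵥ v j = 0 ∧ φ j ⬝ᵥ v i = 0

namespace Frame

/-- The homologies of a frame. -/
def gen (S : Frame F) (i : Fin 4) : SpecialLinearGroup (Fin 3) F :=
  reflSL (S.v i) (S.φ i) (S.pair i)

/-- No homology of the frame lies in the group generated by the others. -/
def Indep (S : Frame F) : Prop :=
  ∀ (i : Fin 4) (s : Set (Fin 4)), i ∉ s → S.gen i ∉ Subgroup.closure (S.gen '' s)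

theorem gen_mul_self (S : Frame F) (i : Fin 4) : S.gen i * S.gen i = 1 := reflSL_mul_self _ _ _

theorem gen_smul (S : Frame F) (i : Fin 4) (u : Fin 3 → F) :
    S.gen i • u = (2 * (S.φ i ⬝ᵥ u)) • S.v i - u := reflSL_smul _ _ _ _

theorem Indep.gen_ne {S : Frame F} (hS : S.Indep) {i j : Fin 4} (h : i ≠ j) :
    S.gen i ≠ S.gen j := by
  intro e
  apply hS i {j} (by simpa using h)
  rw [e]
  exact Subgroup.subset_closure ⟨j, rfl, rfl⟩

/-- Reversal of the order of the homologies. -/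
def rev (S : Frame F) : Frame F where
  v i := S.v i.rev
  φ i := S.φ i.rev
  pair i := S.pair _
  orth i j h := (S.orth j.rev i.rev (by simp only [Fin.val_rev]; omega)).symm

theorem Indep.rev {S : Frame F} (hS : S.Indep) : S.rev.Indep := by
  intro i s hi h
  apply hS i.rev (Fin.rev '' s)
  · rintro ⟨j, hj, e⟩
    exact hi (Fin.rev_injective e ▸ hj)
  · rw [Set.image_image]
    exact h

/-- The dual frame: centres and axes are interchanged. -/
def dual (S : Frame F) : Frame F where
  v := S.φ
  φ := S.v
  pair i := by rw [dotProduct_comm]; exact S.pair i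
  orth i j h := by
    rw [dotProduct_comm, dotProduct_comm (S.v j)]
    exact (S.orth i j h).symm

/-- The inverse transpose automorphism. -/
def invTranspose : SpecialLinearGroup (Fin 3) F →* SpecialLinearGroup (Fin 3) F where
  toFun A := A⁻¹.transpose
  map_one' := by
    rw [inv_one]
    exact Subtype.ext transpose_one
  map_mul' A B := by
    rw [_root_.mul_inv_rev]
    exact Subtype.ext (transpose_mul _ _)

theorem invTranspose_gen (S : Frame F) (i : Fin 4) : invTranspose (S.gen i) = S.dual.gen i := by
  change (S.gen i)⁻¹.transpose = _
  rw [inv_eq_of_mul_eq_one_left (S.gen_mul_self i)]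
  apply Subtype.ext
  change (refl (S.v i) (S.φ i))ᵀ = refl (S.φ i) (S.v i)
  rw [refl, refl, transpose_sub, transpose_smul, transpose_vecMulVec, transpose_one]

theorem dual_dual (S : Frame F) : S.dual.dual = S := rfl

theorem Indep.dual {S : Frame F} (hS : S.Indep) : S.dual.Indep := by
  intro i s hi h
  apply hS i s hi
  have h' := Subgroup.mem_map_of_mem invTranspose h
  rw [MonoidHom.map_closure, Set.image_image, invTranspose_gen, dual_dual] at h'
  simpa only [invTranspose_gen, dual_dual] using h'

/-- Rescaling of the centres. -/
def scale (S : Frame F) (t : Fin 4 → F) (ht : ∀ i, t i ≠ 0) : Frame F where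
  v i := t i • S.v i
  φ i := (t i)⁻¹ • S.φ i
  pair i := by
    rw [smul_dotProduct, dotProduct_smul, S.pair, smul_smul, inv_mul_cancel₀ (ht i), one_smul]
  orth i j h := by
    obtain ⟨h1, h2⟩ := S.orth i j h
    simp only [smul_dotProduct, dotProduct_smul, h1, h2, smul_zero, and_self]

theorem scale_gen (S : Frame F) (t : Fin 4 → F) (ht : ∀ i, t i ≠ 0) (i : Fin 4) :
    (S.scale t ht).gen i = S.gen i := reflSL_congr (refl_smul _ _ (ht i))

theorem Indep.of_gen_eq {S T : Frame F} (hS : S.Indep) (h : ∀ i, T.gen i = S.gen i) : T.Indep := by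
  have : T.gen = S.gen := funext h
  intro i s hi
  rw [this]
  exact hS i s hi

theorem orth' (S : Frame F) : S.φ 0 ⬝ᵥ S.v 2 = 0 ∧ S.φ 2 ⬝ᵥ S.v 0 = 0 ∧ S.φ 0 ⬝ᵥ S.v 3 = 0 ∧
    S.φ 3 ⬝ᵥ S.v 0 = 0 ∧ S.φ 1 ⬝ᵥ S.v 3 = 0 ∧ S.φ 3 ⬝ᵥ S.v 1 = 0 :=
  ⟨(S.orth 0 2 (by decide)).1, (S.orth 0 2 (by decide)).2, (S.orth 0 3 (by decide)).1,
    (S.orth 0 3 (by decide)).2, (S.orth 1 3 (by decide)).1, (S.orth 1 3 (by decide)).2⟩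

/-- The Gram determinant of a frame vanishes. -/
theorem gram_eq (S : Frame F) :
    (1 - (S.φ 0 ⬝ᵥ S.v 1) * (S.φ 1 ⬝ᵥ S.v 0)) * (1 - (S.φ 2 ⬝ᵥ S.v 3) * (S.φ 3 ⬝ᵥ S.v 2)) =
      (S.φ 1 ⬝ᵥ S.v 2) * (S.φ 2 ⬝ᵥ S.v 1) := by
  -- Four vectors in dimension three are dependent, and the dependence is a null vector of the
  -- tridiagonal Gram matrix, whose determinant is (1 - x)(1 - z) - y.
  have h0 : ¬ LinearIndependent F S.v := by
    intro h
    have := h.fintype_card_le_finrank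
    simp at this
  obtain ⟨c, hc, i, hi⟩ := Fintype.not_linearIndependent_iff.mp h0
  obtain ⟨h1, h2, h3, h4, h5, h6⟩ := S.orth'
  have hdet : (Matrix.of fun i j => S.φ i ⬝ᵥ S.v j).det = 0 := by
    rw [← exists_mulVec_eq_zero_iff]
    refine ⟨c, fun e => hi (congrFun e i), ?_⟩
    ext j
    have := congrArg (fun w => S.φ j ⬝ᵥ w) hc
    simp only [dotProduct_sum, dotProduct_smul, dotProduct_zero, smul_eq_mul] at this
    simp only [mulVec, dotProduct, of_apply, Pi.zero_apply]
    rw [← this]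
    simp only [dotProduct]
    exact Finset.sum_congr rfl fun k _ => mul_comm _ _
  rw [det_succ_row_zero] at hdet
  simp [Fin.sum_univ_succ, det_fin_three, h1, h3, h2, h4, h5, h6, S.pair, Fin.succAbove] at hdet
  linear_combination hdet

theorem odd_orderOf_zero_one [Finite F] (h2 : (2 : F) ≠ 0) {S : Frame F} (hS : S.Indep) :
    Odd (orderOf (S.gen 0 * S.gen 1)) := by
  obtain ⟨e1, e2, e3, e4, e5, e6⟩ := S.orth'
  refine odd_orderOf_mul h2 (S.pair 0) (S.pair 1) (S.pair 3) e3 e5 e4 e6 ?_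
  have := hS 3 {0, 1} (by decide)
  rwa [Set.image_pair] at this

theorem odd_orderOf_two_three [Finite F] (h2 : (2 : F) ≠ 0) {S : Frame F} (hS : S.Indep) :
    Odd (orderOf (S.gen 2 * S.gen 3)) := by
  obtain ⟨e1, e2, e3, e4, e5, e6⟩ := S.orth'
  refine odd_orderOf_mul h2 (S.pair 2) (S.pair 3) (S.pair 0) e2 e4 e1 e3 ?_
  have := hS 0 {2, 3} (by decide)
  rwa [Set.image_pair] at this

theorem Indep.orderOf_ne_one {S : Frame F} (hS : S.Indep) {i j : Fin 4} (h : i ≠ j) :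
    orderOf (S.gen i * S.gen j) ≠ 1 := by
  rw [Ne, orderOf_eq_one_iff]
  intro e
  apply hS.gen_ne h
  have := mul_eq_one_iff_eq_inv.mp e
  rwa [inv_eq_of_mul_eq_one_left (S.gen_mul_self j)] at this

theorem x_ne_zero [Finite F] (h2 : (2 : F) ≠ 0) {S : Frame F} (hS : S.Indep) :
    (S.φ 0 ⬝ᵥ S.v 1) * (S.φ 1 ⬝ᵥ S.v 0) ≠ 0 :=
  dotProduct_mul_ne_zero h2 (S.pair 0) (S.pair 1) (odd_orderOf_zero_one h2 hS)

theorem z_ne_zero [Finite F] (h2 : (2 : F) ≠ 0) {S : Frame F} (hS : S.Indep) :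
    (S.φ 2 ⬝ᵥ S.v 3) * (S.φ 3 ⬝ᵥ S.v 2) ≠ 0 :=
  dotProduct_mul_ne_zero h2 (S.pair 2) (S.pair 3) (odd_orderOf_two_three h2 hS)

/-- Normalisation of the scalar products of adjacent centres and axes. -/
structure Normal (S : Frame F) (x z : F) : Prop where
  h01 : S.φ 0 ⬝ᵥ S.v 1 = 1
  h12 : S.φ 1 ⬝ᵥ S.v 2 = 1
  h23 : S.φ 2 ⬝ᵥ S.v 3 = 1
  h10 : S.φ 1 ⬝ᵥ S.v 0 = x
  h32 : S.φ 3 ⬝ᵥ S.v 2 = z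
  x_ne : x ≠ 0
  z_ne : z ≠ 0

theorem Normal.h21 {S : Frame F} {x z : F} (h : S.Normal x z) :
    S.φ 2 ⬝ᵥ S.v 1 = (1 - x) * (1 - z) := by
  have := S.gram_eq
  rw [h.h01, h.h12, h.h23, h.h10, h.h32] at this
  linear_combination -this

theorem exists_normal [Finite F] (h2 : (2 : F) ≠ 0) {S : Frame F} (hS : S.Indep)
    (h : S.φ 1 ⬝ᵥ S.v 2 ≠ 0) :
    ∃ (T : Frame F) (x z : F), T.Normal x z ∧ ∀ i, T.gen i = S.gen i := by
  have hx := x_ne_zero h2 hS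
  have hz := z_ne_zero h2 hS
  have hx1 := left_ne_zero_of_mul hx
  have hz1 := left_ne_zero_of_mul hz
  set a := S.φ 0 ⬝ᵥ S.v 1 with ha
  set b := S.φ 1 ⬝ᵥ S.v 2 with hb
  set c := S.φ 2 ⬝ᵥ S.v 3 with hc
  -- Each centre is divided by the product of the preceding scalar products φ_j·v_{j+1}, so that
  -- these all become 1.
  have ht : ∀ i, (![1, a⁻¹, a⁻¹ * b⁻¹, a⁻¹ * b⁻¹ * c⁻¹] : Fin 4 → F) i ≠ 0 := by
    intro i
    fin_cases i <;> simp [hx1, h, hz1]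
  refine ⟨S.scale _ ht, a * (S.φ 1 ⬝ᵥ S.v 0), c * (S.φ 3 ⬝ᵥ S.v 2),
    ⟨?_, ?_, ?_, ?_, ?_, hx, hz⟩, S.scale_gen _ ht⟩ <;>
  · simp only [scale, smul_dotProduct, dotProduct_smul, smul_eq_mul, ← ha, ← hb, ← hc]
    simp
    try field_simp

/-- Independence is the intersection property for a singleton and a set not containing it. -/
theorem exists_frame (h2 : (2 : F) ≠ 0) {ρ : Fin 4 → PSL3 F} (hρ : IsStringCGroup ρ) :
    ∃ S : Frame F, S.Indep ∧ ∀ i, (QuotientGroup.mk (S.gen i) : PSL3 F) = ρ i := by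
  choose R hR1 hR2 hR3 using fun i => exists_lift_involution (hρ.involution i)
  choose v φ hp hR4 using fun i => exists_eq_reflSL h2 (hR1 i) (hR2 i)
  have hind : ∀ (i : Fin 4) (s : Set (Fin 4)), i ∉ s → R i ∉ Subgroup.closure (R '' s) := by
    intro i s hi h
    have h' := Subgroup.mem_map_of_mem (QuotientGroup.mk' (Subgroup.center (Matrix.SpecialLinearGroup (Fin 3) F))) h
    rw [MonoidHom.map_closure, Set.image_image] at h'
    simp only [QuotientGroup.mk'_apply, hR3] at h'
    have h3 : ρ i ∈ Subgroup.closure (ρ '' {i}) := Subgroup.subset_closure ⟨i, rfl, rfl⟩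
    have h4 := Subgroup.mem_inf.mpr ⟨h3, h'⟩
    rw [hρ.inter, Set.singleton_inter_eq_empty.mpr hi, Set.image_empty, Subgroup.closure_empty,
      Subgroup.mem_bot] at h4
    have := hρ.involution i
    rw [h4, orderOf_one] at this
    omega
  have horth : ∀ i j : Fin 4, (i : ℕ) + 1 < (j : ℕ) → φ i ⬝ᵥ v j = 0 ∧ φ j ⬝ᵥ v i = 0 := by
    intro i j hij
    have hc := hρ.string i j hij
    rw [← hR3, ← hR3] at hc
    have hc' := commute_of_commute_mk (hR1 i) (hR1 j) hc
    rw [hR4 i, hR4 j] at hc'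
    refine dotProduct_eq_zero_of_commute h2 (hp i) (hp j) ?_ (congrArg Subtype.val hc')
    intro e
    have hne : i ≠ j := by rintro rfl; omega
    apply hind i {j} (by simpa using hne)
    rw [hR4 i, reflSL_congr (h' := hp j) e, ← hR4 j]
    exact Subgroup.subset_closure ⟨j, rfl, rfl⟩
  have hgen : Frame.gen ⟨v, φ, hp, horth⟩ = R := funext fun i => (hR4 i).symm
  refine ⟨⟨v, φ, hp, horth⟩, fun i s hi => ?_, fun i => ?_⟩
  · rw [hgen]
    exact hind i s hi
  · rw [hgen, hR3]

end Frame

end Homology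

/-! ### Schläfli types, traces and the table. -/

namespace Homology

variable {F : Type*} [Field F]

namespace Frame

/-- The inverse of a product of two involutions is the product in the other order, which has the
same trace. -/
theorem adjugate_trace_gen_mul (S : Frame F) (i j : Fin 4) :
    (S.gen i * S.gen j).1.adjugate.trace = (S.gen i * S.gen j).1.trace := by
  have h : (S.gen i * S.gen j)⁻¹ = S.gen j * S.gen i := by
    rw [_root_.mul_inv_rev, inv_eq_of_mul_eq_one_left (S.gen_mul_self i),
      inv_eq_of_mul_eq_one_left (S.gen_mul_self j)]
  have h' : (S.gen i * S.gen j).1.adjugate = (S.gen j).1 * (S.gen i).1 := congrArg Subtype.val h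
  rw [h', trace_mul_comm]
  rfl

theorem trace_gen_mul (S : Frame F) (i j : Fin 4) :
    (S.gen i * S.gen j).1.trace = 4 * ((S.φ i ⬝ᵥ S.v j) * (S.φ j ⬝ᵥ S.v i)) - 1 :=
  trace_refl_mul _ _ _ _ (S.pair i) (S.pair j)

theorem of_orderOf_eq_three (S : Frame F) {i j : Fin 4} (h : orderOf (S.gen i * S.gen j) = 3) :
    4 * ((S.φ i ⬝ᵥ S.v j) * (S.φ j ⬝ᵥ S.v i)) - 1 = 0 := by
  have := trace_of_pow_three (S.gen i * S.gen j).2 (S.adjugate_trace_gen_mul i j)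
    (congrArg Subtype.val (h ▸ pow_orderOf_eq_one (S.gen i * S.gen j)))
    (fun e => by rw [orderOf_eq_one_iff.mpr
      (show S.gen i * S.gen j = 1 from Subtype.ext e)] at h; omega)
  rw [trace_gen_mul] at this
  linear_combination this

theorem of_orderOf_eq_four (S : Frame F) {i j : Fin 4} (h : orderOf (S.gen i * S.gen j) = 4) :
    4 * ((S.φ i ⬝ᵥ S.v j) * (S.φ j ⬝ᵥ S.v i)) - 2 = 0 := by
  have := trace_of_pow_four (S.gen i * S.gen j).2 (S.adjugate_trace_gen_mul i j)
    (congrArg Subtype.val (h ▸ pow_orderOf_eq_one (S.gen i * S.gen j)))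
    (fun e => by
      have := orderOf_le_of_pow_eq_one two_pos
        (show (S.gen i * S.gen j) ^ 2 = 1 from Subtype.ext e)
      omega)
  rw [trace_gen_mul] at this
  linear_combination this

theorem of_orderOf_eq_five (S : Frame F) {i j : Fin 4} (h : orderOf (S.gen i * S.gen j) = 5) :
    (4 * ((S.φ i ⬝ᵥ S.v j) * (S.φ j ⬝ᵥ S.v i)) - 2) ^ 2 +
      (4 * ((S.φ i ⬝ᵥ S.v j) * (S.φ j ⬝ᵥ S.v i)) - 2) - 1 = 0 := by
  have := trace_of_pow_five (S.gen i * S.gen j).2 (S.adjugate_trace_gen_mul i j)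
    (congrArg Subtype.val (h ▸ pow_orderOf_eq_one (S.gen i * S.gen j)))
    (fun e => by rw [orderOf_eq_one_iff.mpr
      (show S.gen i * S.gen j = 1 from Subtype.ext e)] at h; omega)
  rw [trace_gen_mul] at this
  linear_combination this

end Frame

theorem eq_of_natCast_eq_zero (p : ℕ) [CharP F p] [Fact p.Prime] {n : ℕ} (hn : n.Prime)
    (h : (n : F) = 0) : p = n :=
  (Nat.prime_dvd_prime_iff_eq Fact.out hn).mp ((CharP.cast_eq_zero_iff F p n).mp h)

/-- The parameters x, y, z are 1/4 for order 3, 1/2 for order 4, and a root of 16t² - 12t + 1 for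
order 5. In each case the relation (1 - x)(1 - z) = y then forces an explicit integer to vanish in
F. If that integer is ±1, the type does not occur. -/
theorem exceptionalTable_of_gram (p : ℕ) [CharP F p] [Fact p.Prime] (h2 : (2 : F) ≠ 0)
    {k₁ k₂ k₃ : ℕ} (hk : IsExceptionalType k₁ k₂ k₃) (x y z : F)
    (h : (1 - x) * (1 - z) = y)
    (x3 : k₁ = 3 → 4 * x - 1 = 0) (x5 : k₁ = 5 → (4 * x - 2) ^ 2 + (4 * x - 2) - 1 = 0)
    (y3 : k₂ = 3 → 4 * y - 1 = 0) (y4 : k₂ = 4 → 4 * y - 2 = 0)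
    (y5 : k₂ = 5 → (4 * y - 2) ^ 2 + (4 * y - 2) - 1 = 0)
    (z3 : k₃ = 3 → 4 * z - 1 = 0) (z5 : k₃ = 5 → (4 * z - 2) ^ 2 + (4 * z - 2) - 1 = 0) :
    ∃ X : F, ExceptionalTable p k₁ k₂ k₃ (2 * x - 1) (2 * z - 1) X := by
  have h4 : (4 : F) ≠ 0 := by
    have : (4 : F) = 2 * 2 := by norm_num
    rw [this]; exact mul_ne_zero h2 h2
  have half : ∀ w : F, 4 * w - 1 = 0 → 2 * w - 1 = -1 / 2 := by
    intro w hw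
    field_simp
    linear_combination hw
  subst h
  unfold ExceptionalTable
  obtain ⟨h1, h3, h2'⟩ := hk
  rcases h1 with rfl | rfl <;> rcases h3 with rfl | rfl
  · -- k₁ = k₃ = 3
    have ex := x3 rfl
    have ez := z3 rfl
    have xz : z = x := mul_left_cancel₀ h4 (by linear_combination ez - ex)
    subst xz
    rcases h2' with rfl | rfl | ⟨rfl, -⟩
    · refine ⟨0, Or.inl ⟨rfl, half _ ex, half _ ex, eq_of_natCast_eq_zero (F := F) p (by norm_num) ?_⟩⟩
      push_cast
      linear_combination (4 : F) * y3 rfl + (7 - 4 * z) * ex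
    · refine ⟨0, Or.inr (Or.inl ⟨rfl, half _ ex, half _ ex,
        eq_of_natCast_eq_zero (F := F) p (by norm_num) ?_⟩)⟩
      push_cast
      have e := y5 rfl
      have hy : 16 * ((1 - z) * (1 - z)) - 9 = 0 := by linear_combination (4 * z - 7) * ex
      linear_combination (-16 : F) * e + (16 * ((1 - z) * (1 - z)) - 3) * hy
    · exfalso
      have hy : 16 * ((1 - z) * (1 - z)) - 9 = 0 := by linear_combination (4 * z - 7) * ex
      exact one_ne_zero (show (1 : F) = 0 by linear_combination 4 * y4 rfl - hy)
  · -- k₁ = 3, k₃ = 5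
    have ex := x3 rfl
    have ez := z5 rfl
    rcases h2' with rfl | rfl | ⟨-, -, h⟩
    · exfalso
      have ey : 3 * z - 2 = 0 := by linear_combination (-1 : F) * y3 rfl - (1 - z) * ex
      exact one_ne_zero (show (1 : F) = 0 by
        linear_combination 9 * ez + (4 - 48 * z) * ey)
    -- Solving 2z - 1 = (-1 + X)/4 gives X = 8z - 3.
    · refine ⟨8 * z - 3, Or.inr (Or.inr (Or.inl ⟨rfl, ?_, half _ ex, ?_,
        eq_of_natCast_eq_zero (F := F) p (by norm_num) ?_⟩))⟩
      · linear_combination 4 * ez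
      · field_simp; ring
      · push_cast
        have hy : 4 * ((1 - x) * (1 - z)) - 3 * (1 - z) = 0 := by
          linear_combination -(1 - z) * ex
        have e := y5 rfl
        -- Here 4y = 3(1 - z). The equation for y, combined with the one for z, becomes linear in z;
        -- substituting its solution leaves 59.
        have e9 : 9 * z ^ 2 - 9 * z + 1 = 0 := by
          linear_combination e - (4 * ((1 - x) * (1 - z)) + 3 * (1 - z) - 3) * hy
        have e7 : 36 * z - 7 = 0 := by linear_combination 9 * ez - 16 * e9
        linear_combination (-144 : F) * e9 + (36 * z - 29) * e7
    · omega
  · -- k₁ = 5, k₃ = 3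
    have ex := x5 rfl
    have ez := z3 rfl
    rcases h2' with rfl | rfl | ⟨-, h, -⟩
    · exfalso
      have ey : 3 * x - 2 = 0 := by linear_combination (-1 : F) * y3 rfl - (1 - x) * ez
      exact one_ne_zero (show (1 : F) = 0 by
        linear_combination 9 * ex + (4 - 48 * x) * ey)
    · refine ⟨8 * x - 3, Or.inr (Or.inr (Or.inr (Or.inl ⟨rfl, ?_, ?_, half _ ez,
        eq_of_natCast_eq_zero (F := F) p (by norm_num) ?_⟩)))⟩
      · linear_combination 4 * ex
      · field_simp; ring
      · push_cast
        have hy : 4 * ((1 - x) * (1 - z)) - 3 * (1 - x) = 0 := by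
          linear_combination -(1 - x) * ez
        have e := y5 rfl
        have e9 : 9 * x ^ 2 - 9 * x + 1 = 0 := by
          linear_combination e - (4 * ((1 - x) * (1 - z)) + 3 * (1 - x) - 3) * hy
        have e7 : 36 * x - 7 = 0 := by linear_combination 9 * ex - 16 * e9
        linear_combination (-144 : F) * e9 + (36 * x - 29) * e7
    · omega
  · -- k₁ = k₃ = 5
    have ex := x5 rfl
    have ez := z5 rfl
    have hX : (8 * x - 3) ^ 2 = 5 := by linear_combination 4 * ex
    have hxa : 2 * x - 1 = (-1 + (8 * x - 3)) / 4 := by field_simp; ring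
    -- Both are roots of 16t² - 12t + 1, whose roots have sum 3/4.
    have hxz : z = x ∨ 4 * z = 3 - 4 * x := by
      have : (4 * (z - x)) * (4 * z - (3 - 4 * x)) = 0 := by linear_combination ez - ex
      rcases mul_eq_zero.mp this with h | h
      · left
        exact sub_eq_zero.mp ((mul_eq_zero.mp h).resolve_left h4)
      · right
        exact sub_eq_zero.mp h
    rcases hxz with rfl | hxz
    · rcases h2' with rfl | rfl | ⟨-, h, -⟩
      · refine ⟨8 * z - 3, Or.inr (Or.inr (Or.inr (Or.inr (Or.inl ⟨rfl, hX, hxa, hxa,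
          eq_of_natCast_eq_zero (F := F) p (by norm_num) ?_⟩))))⟩
        push_cast
        have hy := y3 rfl
        have e : (2 * z - 1) * (2 * z - 3) = 0 := by linear_combination hy
        rcases mul_eq_zero.mp e with e | e
        · exfalso
          exact one_ne_zero (show (1 : F) = 0 by linear_combination -ex + (8 * z - 2) * e)
        · linear_combination ex - (8 * z + 6) * e
      · refine ⟨8 * z - 3, Or.inr (Or.inr (Or.inr (Or.inr (Or.inr (Or.inl ⟨rfl, hX, hxa, hxa,
          ?_⟩)))))⟩
        have hy := y5 rfl
        -- The element y is a root of the same quadratic, so it is z or the conjugate root. The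
        -- first option leads to 99 = 0, the second to (2z - 1)² = 0, which is impossible.
        have e : (4 * ((1 - z) * (1 - z)) - 4 * z) *
            (4 * ((1 - z) * (1 - z)) + 4 * z - 3) = 0 := by
          linear_combination hy - ex
        rcases mul_eq_zero.mp e with e | e
        · have e3 : (36 : F) * z - 15 = 0 := by linear_combination ex - 4 * e
          have e99 : (3 : F) * 3 * 11 = 0 := by
            linear_combination (36 * z - 93) * e3 - 324 * e
          rcases mul_eq_zero.mp e99 with e3 | e11
          · left
            have e3' : (3 : F) = 0 := by simpa using e3
            exact eq_of_natCast_eq_zero (F := F) p (by norm_num) (by exact_mod_cast e3')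
          · right
            exact eq_of_natCast_eq_zero (F := F) p (by norm_num) (by exact_mod_cast e11)
        · exfalso
          have e' : (2 * z - 1) * (2 * z - 1) = 0 := by linear_combination e
          have e'' := mul_self_eq_zero.mp e'
          exact one_ne_zero (show (1 : F) = 0 by linear_combination -ex + (8 * z - 2) * e'')
      · omega
    -- For conjugate roots the sum is 3/4 and the product 1/16, so (1 - x)(1 - z) = 5/16.
    · have h5 : 16 * ((1 - x) * (1 - z)) = 5 := by
        linear_combination -ex + (-4 + 4 * x) * hxz
      have hza : 2 * z - 1 = (-1 - (8 * x - 3)) / 4 := by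
        field_simp
        linear_combination 2 * hxz
      rcases h2' with rfl | rfl | ⟨-, h, -⟩
      · exfalso
        exact one_ne_zero (show (1 : F) = 0 by linear_combination 4 * y3 rfl - h5)
      · refine ⟨8 * x - 3, Or.inr (Or.inr (Or.inr (Or.inr (Or.inr (Or.inr ⟨rfl, hX, hxa, hza,
          eq_of_natCast_eq_zero (F := F) p (by norm_num) ?_⟩)))))⟩
        push_cast
        have e := y5 rfl
        linear_combination (-16 : F) * e + (16 * ((1 - x) * (1 - z)) - 7) * h5
      · omega

theorem pow_cases_perm_four : ∀ σ : Equiv.Perm (Fin 4), σ ^ 3 = 1 ∨ σ ^ 4 = 1 := by decide +kernel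

theorem center_perm_four : ∀ σ : Equiv.Perm (Fin 4), (∀ τ, σ * τ = τ * σ) → σ = 1 := by decide +kernel

theorem pow_cases_perm_five : ∀ σ : Equiv.Perm (Fin 5), Equiv.Perm.sign σ = 1 →
    σ ^ 2 = 1 ∨ σ ^ 3 = 1 ∨ σ ^ 5 = 1 := by decide +kernel

/-- Of Sym(4) and Alt(5) only the triviality of the centre and the possible element orders are
needed. -/
theorem isSym4OrAlt5_cases {H : Type*} [Group H] (h : IsSym4OrAlt5 H) :
    (∀ c : H, (∀ d, c * d = d * c) → c = 1) ∧
      ((∀ g : H, g ^ 3 = 1 ∨ g ^ 4 = 1) ∨ ∀ g : H, g ^ 2 = 1 ∨ g ^ 3 = 1 ∨ g ^ 5 = 1) := by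
  rcases h with ⟨⟨e⟩⟩ | ⟨⟨e⟩⟩
  · refine ⟨fun c hc => ?_, Or.inl fun g => ?_⟩
    · refine (map_eq_one_iff e e.injective).mp (center_perm_four _ fun τ => ?_)
      obtain ⟨d, rfl⟩ := e.surjective τ
      rw [← map_mul, ← map_mul, hc]
    · rcases pow_cases_perm_four (e g) with h | h
      · exact Or.inl ((map_eq_one_iff e e.injective).mp (by rw [map_pow, h]))
      · exact Or.inr ((map_eq_one_iff e e.injective).mp (by rw [map_pow, h]))
  · refine ⟨fun c hc => ?_, Or.inr fun g => ?_⟩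
    · refine (map_eq_one_iff e e.injective).mp ?_
      have hb := alternatingGroup.center_eq_bot (α := Fin 5) (by simp)
      rw [← Subgroup.mem_bot, ← hb, Subgroup.mem_center_iff]
      intro τ
      obtain ⟨d, rfl⟩ := e.surjective τ
      rw [← map_mul, ← map_mul, hc]
    · have key : ∀ n : ℕ, (e g : Equiv.Perm (Fin 5)) ^ n = 1 → g ^ n = 1 := by
        intro n hn
        refine (map_eq_one_iff e e.injective).mp ?_
        rw [map_pow]
        exact Subtype.ext hn
      exact (pow_cases_perm_five _ (Equiv.Perm.mem_alternatingGroup.mp (e g).2)).imp (key 2)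
        (Or.imp (key 3) (key 5))

theorem orderOf_cases {H : Type*} [Group H] (h : IsSym4OrAlt5 H) :
    (∀ g : H, orderOf g ∣ 3 ∨ orderOf g ∣ 4) ∨
      ∀ g : H, orderOf g ∣ 2 ∨ orderOf g ∣ 3 ∨ orderOf g ∣ 5 := by
  refine (isSym4OrAlt5_cases h).2.imp (fun h g => (h g).imp orderOf_dvd_of_pow_eq_one
    orderOf_dvd_of_pow_eq_one) (fun h g => (h g).imp orderOf_dvd_of_pow_eq_one
    (Or.imp orderOf_dvd_of_pow_eq_one orderOf_dvd_of_pow_eq_one))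

/-- The orders of products of adjacent generators when both maximal parabolic subgroups are
symmetric of degree four or alternating of degree five. -/
theorem isExceptionalType_of_orders {Γ : Type*} [Group Γ] {a b c d : Γ} {H K : Subgroup Γ}
    (ha : a ∈ H) (hb : b ∈ H) (hc : c ∈ H) (hb' : b ∈ K) (hc' : c ∈ K) (hd' : d ∈ K)
    (hH : IsSym4OrAlt5 H) (hK : IsSym4OrAlt5 K) (h1 : Odd (orderOf (a * b)))
    (h1' : orderOf (a * b) ≠ 1) (h2 : orderOf (b * c) ≠ 1) (h2' : orderOf (b * c) ≠ 2)
    (h3 : Odd (orderOf (c * d))) (h3' : orderOf (c * d) ≠ 1) :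
    IsExceptionalType (orderOf (a * b)) (orderOf (b * c)) (orderOf (c * d)) := by
  have d3 : ∀ n : ℕ, n ∣ 3 → n = 1 ∨ n = 3 := fun n => (Nat.dvd_prime (by norm_num)).mp
  have d5 : ∀ n : ℕ, n ∣ 5 → n = 1 ∨ n = 5 := fun n => (Nat.dvd_prime (by norm_num)).mp
  have d2 : ∀ n : ℕ, n ∣ 2 → n = 1 ∨ n = 2 := fun n => (Nat.dvd_prime (by norm_num)).mp
  have d4 : ∀ n : ℕ, n ∣ 4 → n = 1 ∨ n = 2 ∨ n = 4 := by
    intro n hn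
    have := Nat.le_of_dvd (by norm_num) hn
    interval_cases n <;> omega
  have o : ∀ (L : Subgroup Γ), IsSym4OrAlt5 L →
      (∀ g ∈ L, orderOf g = 1 ∨ orderOf g = 2 ∨ orderOf g = 3 ∨ orderOf g = 4) ∨
      (∀ g ∈ L, orderOf g = 1 ∨ orderOf g = 2 ∨ orderOf g = 3 ∨ orderOf g = 5) := by
    intro L hL
    refine (orderOf_cases hL).imp (fun h g hg => ?_) (fun h g hg => ?_)
    · have := h ⟨g, hg⟩
      rw [Subgroup.orderOf_mk] at this
      rcases this with h | h
      · have := d3 _ h; omega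
      · have := d4 _ h; omega
    · have := h ⟨g, hg⟩
      rw [Subgroup.orderOf_mk] at this
      rcases this with h | h | h
      · have := d2 _ h; omega
      · have := d3 _ h; omega
      · have := d5 _ h; omega
  have hab := Subgroup.mul_mem _ ha hb
  have hbc := Subgroup.mul_mem _ hb hc
  have hbc' := Subgroup.mul_mem _ hb' hc'
  have hcd := Subgroup.mul_mem _ hc' hd'
  unfold IsExceptionalType
  rw [Nat.odd_iff] at h1 h3
  -- The product bc lies in both subgroups. If its order is 4, both have element orders 1 to 4, and
  -- the odd nontrivial orders of the outer products are 3.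
  rcases o H hH with hH | hH <;> rcases o K hK with hK | hK <;>
  · have := hH _ hab
    have := hH _ hbc
    have := hK _ hbc'
    have := hK _ hcd
    omega

end Homology

/-! ### Dihedral groups, and points and lines preserved by homologies. -/

namespace Homology

section Dihedral

variable {Γ : Type*} [Group Γ]

/-- The rotations in a group, as a homomorphism from `ZMod n`. -/
def rotation {n : ℕ} {a : Γ} (h : a ^ n = 1) : ZMod n →+ Additive Γ :=
  ZMod.lift n ⟨zmultiplesHom (Additive Γ) (Additive.ofMul a), by
    rw [zmultiplesHom_apply, natCast_zsmul, ← ofMul_pow, h, ofMul_one]⟩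

theorem rotation_intCast {n : ℕ} {a : Γ} (h : a ^ n = 1) (m : ℤ) :
    (rotation h (m : ZMod n)).toMul = a ^ m := by
  rw [rotation, ZMod.lift_coe]
  rfl

theorem rotation_conj {n : ℕ} {s t : Γ} (hs : s * s = 1) (ht : t * t = 1) (h : (s * t) ^ n = 1)
    (i : ZMod n) : (rotation h i).toMul * s = s * (rotation h (-i)).toMul := by
  obtain ⟨m, rfl⟩ := ZMod.intCast_surjective i
  rw [← Int.cast_neg, rotation_intCast, rotation_intCast]
  have hc : s * (s * t) * s⁻¹ = (s * t)⁻¹ := by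
    rw [_root_.mul_inv_rev, inv_eq_of_mul_eq_one_left hs, inv_eq_of_mul_eq_one_left ht, ← mul_assoc,
      hs, one_mul]
  rw [_root_.zpow_neg, ← _root_.inv_zpow, ← hc, conj_zpow]
  simp only [← mul_assoc, hs, one_mul]
  rw [inv_eq_of_mul_eq_one_left hs]

/-- The homomorphism from the dihedral group given by two involutions. -/
def dihedralHom {n : ℕ} {s t : Γ} (hs : s * s = 1) (ht : t * t = 1) (h : (s * t) ^ n = 1) :
    DihedralGroup n →* Γ where
  toFun
    | .r i => (rotation h i).toMul
    | .sr i => s * (rotation h i).toMul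
  map_one' := by
    change (rotation h 0).toMul = 1
    rw [map_zero]; rfl
  map_mul' := by
    have key := rotation_conj hs ht h
    rintro (i | i) (j | j)
    · rw [DihedralGroup.r_mul_r]
      simp only [map_add]; rfl
    · rw [DihedralGroup.r_mul_sr]
      simp only
      rw [← mul_assoc, key, mul_assoc, sub_eq_neg_add, map_add]; rfl
    · rw [DihedralGroup.sr_mul_r]
      simp only [map_add]
      rw [mul_assoc]; rfl
    · rw [DihedralGroup.sr_mul_sr]
      simp only
      rw [mul_assoc, ← mul_assoc _ s, key, mul_assoc, ← mul_assoc s s, hs, one_mul, sub_eq_neg_add,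
        map_add]; rfl

/-- A reflection in the kernel would place the involution s in the cyclic group generated by st,
which has odd order. -/
theorem dihedralHom_injective {n : ℕ} {s t : Γ} (hs : s * s = 1) (hs1 : s ≠ 1) (ht : t * t = 1)
    (h : orderOf (s * t) = n) (hn : Odd n) :
    Function.Injective (dihedralHom hs ht (h ▸ pow_orderOf_eq_one (s * t))) := by
  have h' : (s * t) ^ n = 1 := h ▸ pow_orderOf_eq_one (s * t)
  rw [injective_iff_map_eq_one]
  rintro (i | i) hi
  · obtain ⟨m, rfl⟩ := ZMod.intCast_surjective i
    have : (s * t) ^ m = 1 := by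
      rw [← rotation_intCast h']
      exact hi
    have hd := orderOf_dvd_iff_zpow_eq_one.mpr this
    rw [h] at hd
    rw [(ZMod.intCast_zmod_eq_zero_iff_dvd m n).mpr hd]
    rfl
  · exfalso
    obtain ⟨m, rfl⟩ := ZMod.intCast_surjective i
    have e : s * (s * t) ^ m = 1 := by
      rw [← rotation_intCast h']
      exact hi
    have e1 : s = (s * t) ^ (-m) := by rw [_root_.zpow_neg]; exact eq_inv_of_mul_eq_one_left e
    apply hs1
    have e2 : s ^ n = 1 := by
      rw [e1, ← zpow_natCast, ← _root_.zpow_mul, mul_comm, _root_.zpow_mul, zpow_natCast, h', _root_.one_zpow]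
    obtain ⟨k, hk⟩ := hn
    rw [hk, pow_succ, pow_mul, pow_two, hs, one_pow, one_mul] at e2
    exact e2

theorem dihedralHom_range {n : ℕ} {s t : Γ} (hs : s * s = 1) (ht : t * t = 1)
    (h : (s * t) ^ n = 1) : (dihedralHom hs ht h).range = Subgroup.closure {s, t} := by
  have r1 : (rotation h 1).toMul = s * t := by
    have := rotation_intCast h 1
    rwa [zpow_one, Int.cast_one] at this
  apply le_antisymm
  · have hs' : s ∈ Subgroup.closure {s, t} := Subgroup.subset_closure (by simp)
    have ht' : t ∈ Subgroup.closure {s, t} := Subgroup.subset_closure (by simp)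
    have hr : ∀ i : ZMod n, (rotation h i).toMul ∈ Subgroup.closure {s, t} := by
      intro i
      obtain ⟨m, rfl⟩ := ZMod.intCast_surjective i
      rw [rotation_intCast]
      exact Subgroup.zpow_mem _ (Subgroup.mul_mem _ hs' ht') m
    rintro _ ⟨i | i, rfl⟩
    · exact hr i
    · exact Subgroup.mul_mem _ hs' (hr i)
  · rw [Subgroup.closure_le]
    rintro x (rfl | rfl)
    · refine ⟨.sr 0, ?_⟩
      change x * (rotation h 0).toMul = x
      rw [map_zero]
      exact mul_one x
    · refine ⟨.sr 1, ?_⟩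
      change s * (rotation h 1).toMul = _
      rw [r1, ← mul_assoc, hs, one_mul]

/-- Two commuting disjoint dihedral groups generate their direct product. -/
theorem dihedral_prod_equiv {n : ℕ} {s t s' t' : Γ} (hn : Odd n) (hs : s * s = 1) (hs1 : s ≠ 1)
    (ht : t * t = 1) (h : orderOf (s * t) = n) (hs' : s' * s' = 1) (hs1' : s' ≠ 1)
    (ht' : t' * t' = 1) (h' : orderOf (s' * t') = n)
    (hc : ∀ a ∈ ({s, t} : Set Γ), ∀ b ∈ ({s', t'} : Set Γ), a * b = b * a)
    (hd : Subgroup.closure {s, t} ⊓ Subgroup.closure {s', t'} = ⊥) :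
    Nonempty (↥(Subgroup.closure {s, t} ⊔ Subgroup.closure {s', t'}) ≃*
      DihedralGroup n × DihedralGroup n) := by
  set f := dihedralHom hs ht (h ▸ pow_orderOf_eq_one (s * t))
  set g := dihedralHom hs' ht' (h' ▸ pow_orderOf_eq_one (s' * t'))
  have hf : f.range = Subgroup.closure {s, t} := dihedralHom_range hs ht _
  have hg : g.range = Subgroup.closure {s', t'} := dihedralHom_range hs' ht' _
  have hcomm : ∀ a ∈ Subgroup.closure {s, t}, ∀ b ∈ Subgroup.closure {s', t'}, a * b = b * a := by
    have h1 : Subgroup.closure {s', t'} ≤ Subgroup.centralizer {s, t} := by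
      rw [Subgroup.closure_le]
      intro b hb
      rw [SetLike.mem_coe, Subgroup.mem_centralizer_iff]
      exact fun a ha => hc a ha b hb
    have h2 : Subgroup.closure {s, t} ≤
        Subgroup.centralizer (Subgroup.closure {s', t'} : Set Γ) := by
      rw [Subgroup.closure_le]
      intro a ha
      rw [SetLike.mem_coe, Subgroup.mem_centralizer_iff]
      exact fun b hb => (Subgroup.mem_centralizer_iff.mp (h1 hb) a ha).symm
    intro a ha b hb
    exact (Subgroup.mem_centralizer_iff.mp (h2 ha) b hb).symm
  have comm : ∀ m k, Commute (f m) (g k) := fun m k =>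
    hcomm _ (hf ▸ ⟨m, rfl⟩) _ (hg ▸ ⟨k, rfl⟩)
  have hinj : Function.Injective (f.noncommCoprod g comm) := by
    rw [MonoidHom.noncommCoprod_injective]
    refine ⟨dihedralHom_injective hs hs1 ht h hn, dihedralHom_injective hs' hs1' ht' h' hn, ?_⟩
    rw [hf, hg, disjoint_iff]
    exact hd
  have hr := MonoidHom.noncommCoprod_range f g comm
  rw [hf, hg] at hr
  rw [← hr]
  exact ⟨(MonoidHom.ofInjective hinj).symm⟩

end Dihedral

variable {F : Type*} [Field F]

/-- The line `ψ = 0` of the projective plane. -/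
def lineOf (ψ : Fin 3 → F) : Set (PG2 F) :=
  {P | P.submodule ≤ LinearMap.ker (dotProductBilin F F ψ)}

theorem mk_mem_lineOf {ψ v : Fin 3 → F} (hv : v ≠ 0) :
    Projectivization.mk F v hv ∈ lineOf ψ ↔ ψ ⬝ᵥ v = 0 := by
  rw [lineOf, Set.mem_ofPred_eq, Projectivization.submodule_mk, Submodule.span_singleton_le_iff_mem,
    LinearMap.mem_ker]
  rfl

theorem isLine_lineOf {ψ : Fin 3 → F} (h : ψ ≠ 0) : IsLine (lineOf ψ) := by
  refine ⟨_, ?_, rfl⟩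
  have hne : (dotProductBilin F F ψ) ≠ 0 := by
    intro e
    apply h
    apply dotProduct_eq_zero
    intro w
    exact LinearMap.congr_fun e w
  have := Module.Dual.finrank_ker_add_one_of_ne_zero hne
  simp at this
  omega

theorem fixesPoint_of_gen {S : Frame F} {ρ : Fin 4 → PSL3 F}
    (h : ∀ i, (QuotientGroup.mk (S.gen i) : PSL3 F) = ρ i) {v : Fin 3 → F} (hv : v ≠ 0)
    (hf : ∀ i, ∃ c : F, S.gen i • v = c • v) :
    FixesPoint (Subgroup.closure (Set.range ρ)) (Projectivization.mk F v hv) := by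
  have hle : Subgroup.closure (Set.range ρ) ≤
      MulAction.stabilizer (PSL3 F) (Projectivization.mk F v hv) := by
    rw [Subgroup.closure_le]
    rintro _ ⟨i, rfl⟩
    rw [SetLike.mem_coe, MulAction.mem_stabilizer_iff, ← h,
      ProjectiveSpecialLinearGroup.smul_proj_mk, Projectivization.smul_mk,
      Projectivization.mk_eq_mk_iff']
    obtain ⟨c, hc⟩ := hf i
    exact ⟨c, hc.symm⟩
  exact fun g hg => MulAction.mem_stabilizer_iff.mp (hle hg)

theorem preservesSet_of_gen {ρ : Fin 4 → PSL3 F} (h2 : ∀ i, ρ i * ρ i = 1) {L : Set (PG2 F)}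
    (hf : ∀ i, ∀ P ∈ L, ρ i • P ∈ L) : PreservesSet (Subgroup.closure (Set.range ρ)) L := by
  have hle : Subgroup.closure (Set.range ρ) ≤ MulAction.stabilizer (PSL3 F) L := by
    rw [Subgroup.closure_le]
    rintro _ ⟨i, rfl⟩
    rw [SetLike.mem_coe, MulAction.mem_stabilizer_iff]
    ext P
    rw [Set.mem_smul_set_iff_inv_smul_mem, inv_eq_of_mul_eq_one_left (h2 i)]
    refine ⟨fun hP => ?_, hf i P⟩
    have := hf i _ hP
    rwa [← mul_smul, h2, one_smul] at this
  exact fun g hg => MulAction.mem_stabilizer_iff.mp (hle hg)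

/-- A homology preserves its axis and every line through its centre. -/
theorem preservesSet_lineOf {S : Frame F} {ρ : Fin 4 → PSL3 F}
    (h : ∀ i, (QuotientGroup.mk (S.gen i) : PSL3 F) = ρ i) {ψ : Fin 3 → F}
    (hf : ∀ i, S.φ i = ψ ∨ ψ ⬝ᵥ S.v i = 0) :
    PreservesSet (Subgroup.closure (Set.range ρ)) (lineOf ψ) := by
  apply preservesSet_of_gen
  · intro i
    rw [← h, ← QuotientGroup.mk_mul, S.gen_mul_self]
    rfl
  · intro i P
    induction P using Projectivization.ind with | _ v hv =>
    rw [← h, ProjectiveSpecialLinearGroup.smul_proj_mk, Projectivization.smul_mk, mk_mem_lineOf,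
      mk_mem_lineOf, S.gen_smul, dotProduct_sub, dotProduct_smul, smul_eq_mul]
    intro h0
    rcases hf i with e | e
    · rw [e, h0]; ring
    · rw [e, h0]; ring

/-- Trace 3 turns the cubic relation into (A - 1)³ = 0. As p ≥ 3, this gives A^p - 1 = (A - 1)^p =
0. -/
theorem orderOf_eq_char (p : ℕ) [CharP F p] [Fact p.Prime] (hp : p ≠ 2)
    {A : SpecialLinearGroup (Fin 3) F} (h1 : A ≠ 1) (ht : A.1.adjugate.trace = A.1.trace)
    (h3 : A.1.trace = 3) : orderOf A = p := by
  refine orderOf_eq_prime ?_ h1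
  have e := sub_one_mul_sq A.2 ht
  rw [h3] at e
  have e3 : (A.1 - 1) ^ 3 = 0 := by
    have h31 : (3 : F) - 1 = 2 := by norm_num
    rw [h31] at e
    have : (A.1 - 1) ^ 3 = (A.1 - 1) * A.1 ^ 2 - ((2 : F) • ((A.1 - 1) * A.1) - (A.1 - 1)) := by
      rw [two_smul]
      noncomm_ring
    rw [this, e, sub_self]
  have hp3 : 3 ≤ p := by
    have := (Fact.out : p.Prime).two_le
    omega
  have e4 : (A.1 - 1) ^ p = 0 := pow_eq_zero_of_le hp3 e3
  rw [sub_pow_char_of_commute p (Commute.one_right _), one_pow] at e4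
  exact Subtype.ext (sub_eq_zero.mp e4)

end Homology

/-! ### The case of two commuting dihedral groups. -/

namespace Homology

variable {F : Type*} [Field F]

theorem exists_smul_of_cross_eq_zero {c d : Fin 3 → F} (hc : c ≠ 0) (h : c ⨯₃ d = 0) :
    ∃ l : F, d = l • c := by
  obtain ⟨i, hi⟩ : ∃ i, c i ≠ 0 := by
    by_contra hcon
    push Not at hcon
    exact hc (funext hcon)
  rw [cross_apply] at h
  have h0 := congrFun h 0
  have h1 := congrFun h 1
  have h2 := congrFun h 2
  simp at h0 h1 h2
  refine ⟨d i / c i, ?_⟩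
  ext j
  simp only [Pi.smul_apply, smul_eq_mul]
  fin_cases i <;> fin_cases j <;> simp at hi ⊢ <;> field_simp <;>
    first
    | ring1
    | linear_combination h0
    | linear_combination h1
    | linear_combination h2
    | linear_combination -h0
    | linear_combination -h1
    | linear_combination -h2

theorem exists_smul_cross {u w d : Fin 3 → F} (h : u ⨯₃ w ≠ 0) (hu : u ⬝ᵥ d = 0) (hw : w ⬝ᵥ d = 0) :
    ∃ l : F, d = l • (u ⨯₃ w) := by
  apply exists_smul_of_cross_eq_zero h
  simp only [dotProduct, Fin.sum_univ_three] at hu hw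
  simp only [cross_apply]
  ext j
  fin_cases j <;> simp
  · linear_combination (-u 0) * hw + w 0 * hu
  · linear_combination (-u 1) * hw + w 1 * hu
  · linear_combination (-u 2) * hw + w 2 * hu

namespace Frame

theorem v_ne_zero (S : Frame F) (i : Fin 4) : S.v i ≠ 0 := by
  intro h
  have := S.pair i
  rw [h, dotProduct_zero] at this
  exact zero_ne_one this

theorem φ_ne_zero (S : Frame F) (i : Fin 4) : S.φ i ≠ 0 := S.dual.v_ne_zero i

theorem Indep.not_parallel {S : Frame F} (hS : S.Indep) {i j : Fin 4} (h : i ≠ j) {c d : F}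
    (hv : S.v j = c • S.v i) (hφ : S.φ j = d • S.φ i) : False := by
  have h1 := S.pair j
  rw [hv, hφ, smul_dotProduct, dotProduct_smul, S.pair i, smul_eq_mul, smul_eq_mul, mul_one] at h1
  apply hS.gen_ne h
  apply reflSL_congr
  rw [hv, hφ, eq_inv_of_mul_eq_one_left h1, refl_smul _ _ (right_ne_zero_of_mul_eq_one h1)]

/-- Two vectors annihilated by two covectors: one of the pairs is proportional. -/
theorem parallel_of_cross_ne_zero {u w d e : Fin 3 → F} (hd : d ≠ 0) (h : u ⨯₃ w ≠ 0)
    (h1 : u ⬝ᵥ d = 0) (h2 : w ⬝ᵥ d = 0) (h3 : u ⬝ᵥ e = 0) (h4 : w ⬝ᵥ e = 0) :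
    ∃ c : F, e = c • d := by
  obtain ⟨a, ha⟩ := exists_smul_cross h h1 h2
  obtain ⟨b, hb⟩ := exists_smul_cross h h3 h4
  have ha0 : a ≠ 0 := by
    rintro rfl
    rw [zero_smul] at ha
    exact hd ha
  exact ⟨b * a⁻¹, by rw [ha, smul_smul, mul_assoc, inv_mul_cancel₀ ha0, mul_one, hb]⟩

/-- Every centre of one pair lies on both axes of the other pair. If v_0 and v_1 are independent,
φ_2 and φ_3 are proportional; then v_2 and v_3 are independent, since the homologies differ, and φ_0
and φ_1 are proportional. The case of proportional v_0 and v_1 is similar. -/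
theorem centres_or_axes {S : Frame F} (hS : S.Indep) (h12 : S.φ 1 ⬝ᵥ S.v 2 = 0)
    (h21 : S.φ 2 ⬝ᵥ S.v 1 = 0) :
    (∃ c d : F, S.v 1 = c • S.v 0 ∧ S.v 3 = d • S.v 2) ∨
      ∃ c d : F, S.φ 1 = c • S.φ 0 ∧ S.φ 3 = d • S.φ 2 := by
  obtain ⟨e1, e2, e3, e4, e5, e6⟩ := S.orth'
  by_cases h : S.v 0 ⨯₃ S.v 1 = 0
  · left
    obtain ⟨c, hc⟩ := exists_smul_of_cross_eq_zero (S.v_ne_zero 0) h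
    have h' : S.φ 0 ⨯₃ S.φ 1 ≠ 0 := by
      intro h'
      obtain ⟨d, hd⟩ := exists_smul_of_cross_eq_zero (S.φ_ne_zero 0) h'
      exact hS.not_parallel (by decide) hc hd
    obtain ⟨d, hd⟩ := parallel_of_cross_ne_zero (S.v_ne_zero 2) h' e1 h12 e3 e5
    exact ⟨c, d, hc, hd⟩
  · right
    obtain ⟨d, hd⟩ := parallel_of_cross_ne_zero (S.φ_ne_zero 2) h
      (by rw [dotProduct_comm]; exact e2) (by rw [dotProduct_comm]; exact h21)
      (by rw [dotProduct_comm]; exact e4) (by rw [dotProduct_comm]; exact e6)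
    have h' : S.v 2 ⨯₃ S.v 3 ≠ 0 := by
      intro h'
      obtain ⟨c, hc⟩ := exists_smul_of_cross_eq_zero (S.v_ne_zero 2) h'
      exact hS.not_parallel (by decide) hc hd
    obtain ⟨c, hc⟩ := parallel_of_cross_ne_zero (S.φ_ne_zero 0) h'
      (by rw [dotProduct_comm]; exact e1) (by rw [dotProduct_comm]; exact e3)
      (by rw [dotProduct_comm]; exact h12) (by rw [dotProduct_comm]; exact e5)
    exact ⟨c, d, hc, hd⟩

theorem orderOf_gen_mul_eq_char (p : ℕ) [CharP F p] [Fact p.Prime] (hp : p ≠ 2) {S : Frame F}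
    (hS : S.Indep) {i j : Fin 4} (hij : i ≠ j) (h : (S.φ i ⬝ᵥ S.v j) * (S.φ j ⬝ᵥ S.v i) = 1) :
    orderOf (S.gen i * S.gen j) = p := by
  refine orderOf_eq_char p hp ?_ (S.adjugate_trace_gen_mul i j) ?_
  · rw [Ne, ← orderOf_eq_one_iff]
    exact hS.orderOf_ne_one hij
  · rw [trace_gen_mul, h]
    norm_num

theorem orderOf_mk_gen_mul {S : Frame F} {ρ : Fin 4 → PSL3 F}
    (h : ∀ i, (QuotientGroup.mk (S.gen i) : PSL3 F) = ρ i) (i j : Fin 4) :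
    orderOf (ρ i * ρ j) = orderOf (S.gen i * S.gen j) := by
  rw [← h, ← h]
  exact orderOf_mk_reflSL_mul _ _ _ _ _ _

/-- A shared centre or axis in each pair makes x = z = 1, so both outer products are unipotent of
order p. The two dihedral groups commute, and they meet trivially by the intersection property. The
invariant points are the shared centres, the invariant lines the shared axes. -/
theorem reducible_case (p : ℕ) [CharP F p] [Fact p.Prime] (hp : p ≠ 2) {ρ : Fin 4 → PSL3 F}
    (hρ : IsStringCGroup ρ) {S : Frame F} (hS : S.Indep)
    (h : ∀ i, (QuotientGroup.mk (S.gen i) : PSL3 F) = ρ i) (h12 : S.φ 1 ⬝ᵥ S.v 2 = 0)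
    (h21 : S.φ 2 ⬝ᵥ S.v 1 = 0) :
    Nonempty (Subgroup.closure (Set.range ρ) ≃* DihedralGroup p × DihedralGroup p) ∧
        ((∃ P P' : PG2 F, P ≠ P' ∧ FixesPoint (Subgroup.closure (Set.range ρ)) P ∧
          FixesPoint (Subgroup.closure (Set.range ρ)) P') ∨
          ∃ L L' : Set (PG2 F), IsLine L ∧ IsLine L' ∧ L ≠ L' ∧
            PreservesSet (Subgroup.closure (Set.range ρ)) L ∧
            PreservesSet (Subgroup.closure (Set.range ρ)) L') := by
  obtain ⟨e1, e2, e3, e4, e5, e6⟩ := S.orth'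
  have hca := centres_or_axes hS h12 h21
  have hx : (S.φ 0 ⬝ᵥ S.v 1) * (S.φ 1 ⬝ᵥ S.v 0) = 1 ∧
      (S.φ 2 ⬝ᵥ S.v 3) * (S.φ 3 ⬝ᵥ S.v 2) = 1 := by
    have p0 := S.pair 0
    have p1 := S.pair 1
    have p2 := S.pair 2
    have p3 := S.pair 3
    rcases hca with ⟨c, d, hc, hd⟩ | ⟨c, d, hc, hd⟩
    · rw [hc, dotProduct_smul, smul_eq_mul] at p1 ⊢
      rw [hd, dotProduct_smul, smul_eq_mul] at p3 ⊢
      rw [p0, p2, mul_one, mul_one]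
      exact ⟨p1, p3⟩
    · rw [hc, smul_dotProduct, smul_eq_mul] at p1 ⊢
      rw [hd, smul_dotProduct, smul_eq_mul] at p3 ⊢
      rw [p0, p2, mul_one, mul_one, mul_comm, mul_comm _ d]
      exact ⟨p1, p3⟩
  have hsq : ∀ i, ρ i * ρ i = 1 := by
    intro i
    rw [← h, ← QuotientGroup.mk_mul, S.gen_mul_self]
    rfl
  have hne : ∀ i, ρ i ≠ 1 := by
    intro i e
    have := hρ.involution i
    rw [e, orderOf_one] at this
    omega
  constructor
  · have hinter := hρ.inter {0, 1} {2, 3}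
    have hempty : ({0, 1} : Set (Fin 4)) ∩ {2, 3} = ∅ := by
      ext i
      simp only [Set.mem_inter_iff, Set.mem_insert_iff, Set.mem_singleton_iff, Set.mem_empty_iff_false,
        iff_false]
      fin_cases i <;> simp
    rw [hempty, Set.image_empty, Subgroup.closure_empty, Set.image_pair, Set.image_pair] at hinter
    have hrange : Set.range ρ = {ρ 0, ρ 1} ∪ {ρ 2, ρ 3} := by
      ext g
      simp only [Set.mem_range, Fin.exists_fin_succ, Set.mem_union, Set.mem_insert_iff,
        Set.mem_singleton_iff]
      simp [eq_comm, or_assoc]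
    rw [hrange, Subgroup.closure_union]
    have hodd : Odd p := (Fact.out : p.Prime).odd_of_ne_two hp
    refine dihedral_prod_equiv hodd (hsq 0) (hne 0) (hsq 1) ?_ (hsq 2) (hne 2) (hsq 3) ?_ ?_ hinter
    · rw [orderOf_mk_gen_mul h]
      exact orderOf_gen_mul_eq_char p hp hS (by decide) hx.1
    · rw [orderOf_mk_gen_mul h]
      exact orderOf_gen_mul_eq_char p hp hS (by decide) hx.2
    · have h12c : S.gen 1 * S.gen 2 = S.gen 2 * S.gen 1 := by
        apply sl_ext_smul
        intro u
        simp only [mul_smul, gen_smul, dotProduct_sub, dotProduct_smul, h12, h21, smul_eq_mul]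
        module
      rintro a (rfl | rfl) b (rfl | rfl)
      · exact hρ.string 0 2 (by decide)
      · exact hρ.string 0 3 (by decide)
      · rw [← h, ← h, ← QuotientGroup.mk_mul, h12c]
        rfl
      · exact hρ.string 1 3 (by decide)
  · rcases hca with ⟨c, d, hc, hd⟩ | ⟨c, d, hc, hd⟩
    · left
      refine ⟨_, _, ?_, fixesPoint_of_gen h (S.v_ne_zero 0) fun i => ?_,
        fixesPoint_of_gen h (S.v_ne_zero 2) fun i => ?_⟩
      · intro e
        rw [Projectivization.mk_eq_mk_iff'] at e
        obtain ⟨a, ha⟩ := e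
        have := S.pair 0
        rw [← ha, dotProduct_smul, e1, smul_zero] at this
        exact zero_ne_one this
      · fin_cases i
        · exact ⟨2 * (S.φ 0 ⬝ᵥ S.v 0) - 1, by
            simp only [Fin.zero_eta]; rw [gen_smul]; module⟩
        · exact ⟨2 * (S.φ 1 ⬝ᵥ S.v 0) * c - 1, by
            simp only [Fin.mk_one]; rw [gen_smul, hc]; module⟩
        · exact ⟨-1, by simp only [Fin.reduceFinMk]; rw [gen_smul, e2]; module⟩
        · exact ⟨-1, by simp only [Fin.reduceFinMk]; rw [gen_smul, e4]; module⟩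
      · fin_cases i
        · exact ⟨-1, by simp only [Fin.zero_eta]; rw [gen_smul, e1]; module⟩
        · exact ⟨-1, by simp only [Fin.mk_one]; rw [gen_smul, h12]; module⟩
        · exact ⟨2 * (S.φ 2 ⬝ᵥ S.v 2) - 1, by
            simp only [Fin.reduceFinMk]; rw [gen_smul]; module⟩
        · exact ⟨2 * (S.φ 3 ⬝ᵥ S.v 2) * d - 1, by
            simp only [Fin.reduceFinMk]; rw [gen_smul, hd]; module⟩
    · right
      have hc0 : c ≠ 0 := by
        rintro rfl
        rw [zero_smul] at hc
        exact S.φ_ne_zero 1 hc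
      have hd0 : d ≠ 0 := by
        rintro rfl
        rw [zero_smul] at hd
        exact S.φ_ne_zero 3 hd
      have hsub : ∀ i, ∃ a : F, a ≠ 0 ∧ (S.φ i = a • S.φ 0 ∨ S.φ 0 ⬝ᵥ S.v i = 0) ∧
          (S.φ i = a • S.φ 2 ∨ S.φ 2 ⬝ᵥ S.v i = 0) := by
        intro i
        fin_cases i
        · exact ⟨1, one_ne_zero, Or.inl (one_smul _ _).symm, Or.inr e2⟩
        · exact ⟨c, hc0, Or.inl hc, Or.inr h21⟩
        · exact ⟨1, one_ne_zero, Or.inr e1, Or.inl (one_smul _ _).symm⟩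
        · exact ⟨d, hd0, Or.inr e3, Or.inl hd⟩
      -- Rescaling makes proportional axes equal, which is the form in which `preservesSet_lineOf`
      -- applies.
      choose a ha0 ha1 ha2 using hsub
      have hgen : ∀ i, (QuotientGroup.mk ((S.scale a ha0).gen i) : PSL3 F) = ρ i := by
        intro i
        rw [scale_gen, h]
      refine ⟨lineOf (S.φ 0), lineOf (S.φ 2), isLine_lineOf (S.φ_ne_zero 0),
        isLine_lineOf (S.φ_ne_zero 2), ?_, preservesSet_lineOf hgen fun i => ?_,
        preservesSet_lineOf hgen fun i => ?_⟩
      · intro e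
        have := (mk_mem_lineOf (S.v_ne_zero 2)).mpr e1
        rw [e, mk_mem_lineOf, S.pair] at this
        exact one_ne_zero this
      · refine (ha1 i).imp (fun e => ?_) (fun e => ?_)
        · simp only [scale]
          rw [e, smul_smul, inv_mul_cancel₀ (ha0 i), one_smul]
        · simp only [scale]
          rw [dotProduct_smul, e, smul_zero]
      · refine (ha2 i).imp (fun e => ?_) (fun e => ?_)
        · simp only [scale]
          rw [e, smul_smul, inv_mul_cancel₀ (ha0 i), one_smul]
        · simp only [scale]
          rw [dotProduct_smul, e, smul_zero]

end Frame

end Homology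

/-! ### In a normalised frame, x = 1 if and only if z = 1. -/

namespace Homology

variable {F : Type*} [Field F]

open Polynomial in
/-- A matrix with a generic trace and a `p`-power of whose power is trivial. -/
theorem pow_eq_one_of_pow_mul_eq_one [Finite F] (p : ℕ) [CharP F p] [Fact p.Prime] {s : F}
    (hs : s ≠ 2) (hs' : s ≠ -2) {A : Matrix (Fin 3) (Fin 3) F}
    (e : (A - 1) * A ^ 2 = s • ((A - 1) * A) - (A - 1)) {m : ℕ} (hm : A ^ (m * p) = 1) :
    A ^ m = 1 := by
  have hd : 4 - s ^ 2 ≠ 0 := by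
    have : 4 - s ^ 2 = (2 - s) * (s - -2) := by ring
    rw [this]
    exact mul_ne_zero (sub_ne_zero.mpr hs.symm) (sub_ne_zero.mpr hs')
  have hd' : 2 - s ≠ 0 := sub_ne_zero.mpr hs.symm
  have hC2 : (C 2 : F[X]) = 2 := map_ofNat C 2
  have hC4 : (C 4 : F[X]) = 4 := map_ofNat C 4
  -- For s ≠ ±2 the polynomial q is squarefree and annihilates A, so A is semisimple. Since (A^m -
  -- 1)^p = A^(mp) - 1 = 0, the semisimple A^m - 1 is nilpotent and hence zero.
  set q : F[X] := (X - C 1) * (X ^ 2 - C s * X + 1) with hq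
  have hsep : Squarefree q := by
    apply Separable.squarefree
    apply Separable.mul separable_X_sub_C
    · rw [separable_def']
      -- Bézout coefficients from 4(X² - sX + 1) - (2X - s)² = 4 - s².
      refine ⟨C (4 - s ^ 2)⁻¹ * 4, C (4 - s ^ 2)⁻¹ * (C s - 2 * X), ?_⟩
      have hone : C (4 - s ^ 2)⁻¹ * (4 - C s ^ 2) = (1 : F[X]) := by
        rw [← hC4, ← C_pow, ← C_sub, ← C_mul, inv_mul_cancel₀ hd, C_1]
      have hder : derivative (X ^ 2 - C s * X + 1 : F[X]) = 2 * X - C s := by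
        simp [one_add_one_eq_two, hC2]
      rw [hder]
      linear_combination hone
    · refine ⟨C (2 - s)⁻¹ * (C s - 1 - X), C (2 - s)⁻¹, ?_⟩
      have hone : C (2 - s)⁻¹ * (2 - C s) = (1 : F[X]) := by
        rw [← hC2, ← C_sub, ← C_mul, inv_mul_cancel₀ hd', C_1]
      rw [C_1]
      linear_combination hone
  have haeval : aeval A q = 0 := by
    simp only [hq, map_mul, map_sub, map_add, map_pow, aeval_X, aeval_C, map_one]
    rw [mul_add, mul_sub, e, mul_one, Algebra.algebraMap_eq_smul_one, smul_mul_assoc, one_mul,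
      mul_smul_comm]
    abel
  have hnil : aeval A ((X ^ m - 1 : F[X]) ^ p) = 0 := by
    rw [map_pow, map_sub, map_pow, aeval_X, map_one, sub_pow_char_of_commute p
      (Commute.one_right _), one_pow, ← pow_mul, hm, sub_self]
  have hrad : IsRadical (minpoly F A) :=
    (hsep.squarefree_of_dvd (minpoly.dvd F A haeval)).isRadical
  have := hrad p _ (minpoly.dvd F A hnil)
  obtain ⟨c, hc⟩ := this
  have h := congrArg (aeval A) hc
  rw [map_mul, minpoly.aeval, zero_mul, map_sub, map_pow, aeval_X, map_one] at h
  exact sub_eq_zero.mp h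

namespace Frame

/-- In characteristic `p`, the product of two homologies whose trace is generic has order prime
to `p`. -/
theorem orderOf_gen_mul_ne_zero [Finite F] (p : ℕ) [CharP F p] [Fact p.Prime] (h2 : (2 : F) ≠ 0)
    (S : Frame F) {i j : Fin 4} (h0 : (S.φ i ⬝ᵥ S.v j) * (S.φ j ⬝ᵥ S.v i) ≠ 0)
    (h1 : (S.φ i ⬝ᵥ S.v j) * (S.φ j ⬝ᵥ S.v i) ≠ 1) :
    ((orderOf (S.gen i * S.gen j) : ℕ) : F) ≠ 0 := by
  intro hk
  have hpos : 0 < orderOf (S.gen i * S.gen j) := orderOf_pos _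
  have htr := S.trace_gen_mul i j
  have e := sub_one_mul_sq (S.gen i * S.gen j).2 (S.adjugate_trace_gen_mul i j)
  rw [htr] at e
  rw [CharP.cast_eq_zero_iff F p] at hk
  obtain ⟨m, hm⟩ := hk
  have h4 : (4 : F) ≠ 0 := by
    have : (4 : F) = 2 * 2 := by norm_num
    rw [this]; exact mul_ne_zero h2 h2
  have h5 := pow_orderOf_eq_one (S.gen i * S.gen j)
  rw [hm, mul_comm] at h5
  have h3 := pow_eq_one_of_pow_mul_eq_one p (m := m) ?_ ?_ e (congrArg Subtype.val h5)
  · have h6 : (S.gen i * S.gen j) ^ m = 1 := Subtype.ext h3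
    have hmpos : 0 < m := by
      rcases Nat.eq_zero_or_pos m with rfl | h
      · omega
      · exact h
    have := orderOf_le_of_pow_eq_one hmpos h6
    rw [hm] at this
    exact absurd this (not_le.mpr (lt_mul_left hmpos (Fact.out : p.Prime).one_lt))
  · intro h
    exact h1 (mul_left_cancel₀ h4 (by linear_combination h))
  · intro h
    exact h0 ((mul_eq_zero.mp (show (4:F) * _ = 0 by linear_combination h)).resolve_left h4)

theorem cross_v_ne_zero {S : Frame F} {x z : F} (h : S.Normal x z) (hx : x ≠ 1) :
    S.v 0 ⨯₃ S.v 1 ≠ 0 := by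
  intro h0
  obtain ⟨c, hc⟩ := exists_smul_of_cross_eq_zero (S.v_ne_zero 0) h0
  have h1 := h.h01
  rw [hc, dotProduct_smul, S.pair, smul_eq_mul, mul_one] at h1
  have h2 := S.pair 1
  rw [hc, h1, one_smul, h.h10] at h2
  exact hx h2

theorem cross_φ_ne_zero {S : Frame F} {x z : F} (h : S.Normal x z) (hx : x ≠ 1) :
    S.φ 0 ⨯₃ S.φ 1 ≠ 0 := by
  intro h0
  obtain ⟨c, hc⟩ := exists_smul_of_cross_eq_zero (S.φ_ne_zero 0) h0
  have h1 := S.pair 1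
  rw [hc, smul_dotProduct, h.h01, smul_eq_mul, mul_one] at h1
  have h2 := h.h10
  rw [hc, h1, one_smul, S.pair] at h2
  exact hx h2.symm

/-- If the last two homologies have the same axis and the product of the first two is not
unipotent, then the last homology is in the group generated by the others. -/
theorem gen_three_mem [Finite F] (p : ℕ) [CharP F p] [Fact p.Prime] (h2 : (2 : F) ≠ 0)
    {S : Frame F} {x : F} (h : S.Normal x 1) (hx : x ≠ 1) :
    S.gen 3 ∈ Subgroup.closure (S.gen '' {0, 1, 2}) := by
  obtain ⟨e1, e2, e3, e4, e5, e6⟩ := S.orth'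
  have h21 : S.φ 2 ⬝ᵥ S.v 1 = 0 := by rw [h.h21]; ring
  -- Both covectors vanish on the independent vectors v_0 and v_1, and both take the value 1 on v_3.
  have hφ : S.φ 3 = S.φ 2 := by
    obtain ⟨a, ha⟩ := exists_smul_cross (cross_v_ne_zero h hx) (d := S.φ 2)
      (by rw [dotProduct_comm]; exact e2) (by rw [dotProduct_comm]; exact h21)
    obtain ⟨b, hb⟩ := exists_smul_cross (cross_v_ne_zero h hx) (d := S.φ 3)
      (by rw [dotProduct_comm]; exact e4) (by rw [dotProduct_comm]; exact e6)
    have h3 := S.pair 3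
    have h4 := h.h23
    rw [hb, smul_dotProduct, smul_eq_mul] at h3
    rw [ha, smul_dotProduct, smul_eq_mul] at h4
    rw [ha, hb, mul_right_cancel₀ (right_ne_zero_of_mul_eq_one h4) (h4.trans h3.symm)]
  have hmem : ∀ i ∈ ({0, 1, 2} : Set (Fin 4)), S.gen i ∈ Subgroup.closure (S.gen '' {0, 1, 2}) :=
    fun i hi => Subgroup.subset_closure ⟨i, hi, rfl⟩
  set H := Subgroup.closure (S.gen '' {0, 1, 2}) with hH
  have m0 := hmem 0 (by simp)
  have m1 := hmem 1 (by simp)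
  have m2 := hmem 2 (by simp)
  set r := S.gen 0 * S.gen 1 with hr
  have mr : r ∈ H := H.mul_mem m0 m1
  have hrφ : ∀ u, S.φ 2 ⬝ᵥ (r • u) = S.φ 2 ⬝ᵥ u := by
    intro u
    rw [hr, mul_smul, gen_smul, dotProduct_sub, dotProduct_smul, e2, smul_zero, zero_sub, gen_smul,
      dotProduct_sub, dotProduct_smul, h21, smul_zero, zero_sub, neg_neg]
  have hrφ' : ∀ (n : ℕ) u, S.φ 2 ⬝ᵥ (r ^ n • u) = S.φ 2 ⬝ᵥ u := by
    intro n
    induction n with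
    | zero => intro u; rw [pow_zero, one_smul]
    | succ n ih => intro u; rw [pow_succ, mul_smul, ih, hrφ]
  set k := orderOf r with hk
  -- The sum over the r-orbit of v_2 is fixed by r and so lies on the axes φ_0 and φ_1; evaluating
  -- φ_2 shows that it is k v_3.
  set N := ∑ n ∈ Finset.range k, r ^ n • S.v 2 with hN
  have hrN : r • N = N := by
    rw [hN, Finset.smul_sum]
    have : ∀ n, r • r ^ n • S.v 2 = r ^ (n + 1) • S.v 2 := fun n => by
      rw [smul_smul, ← pow_succ']
    simp only [this]
    have hs := Finset.sum_range_succ' (fun n => r ^ n • S.v 2) k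
    rw [Finset.sum_range_succ, hk, pow_orderOf_eq_one, pow_zero] at hs
    exact (add_right_cancel hs).symm
  have hφN : S.φ 2 ⬝ᵥ N = (k : F) := by
    rw [hN, dotProduct_sum]
    simp only [hrφ', S.pair]
    simp
  have hN0 : S.φ 1 ⬝ᵥ N = S.φ 0 ⬝ᵥ N ∧ S.φ 1 ⬝ᵥ N = x * (S.φ 0 ⬝ᵥ N) := by
    have h3 : S.gen 1 • N = S.gen 0 • N := by
      have : S.gen 0 • r • N = S.gen 0 • N := by rw [hrN]
      rwa [hr, ← mul_smul, ← mul_assoc, S.gen_mul_self, one_mul] at this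
    rw [gen_smul, gen_smul] at h3
    have h4 := sub_left_injective h3
    have h5 := congrArg (fun u => S.φ 0 ⬝ᵥ u) h4
    have h6 := congrArg (fun u => S.φ 1 ⬝ᵥ u) h4
    simp only [dotProduct_smul, S.pair, h.h01, h.h10, smul_eq_mul, mul_one] at h5 h6
    refine ⟨mul_left_cancel₀ h2 h5, mul_left_cancel₀ h2 ?_⟩
    linear_combination h6
  have hφ0N : S.φ 0 ⬝ᵥ N = 0 := by
    have : (1 - x) * (S.φ 0 ⬝ᵥ N) = 0 := by linear_combination hN0.2 - hN0.1
    exact (mul_eq_zero.mp this).resolve_left (sub_ne_zero.mpr (Ne.symm hx))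
  have hNv : N = (k : F) • S.v 3 := by
    obtain ⟨c, hc⟩ := parallel_of_cross_ne_zero (S.v_ne_zero 3) (cross_φ_ne_zero h hx) e3 e5
      hφ0N (hN0.1.trans hφ0N)
    have := hφN
    rw [hc, dotProduct_smul, h.h23, smul_eq_mul, mul_one] at this
    rw [hc, this]
  -- Since x is neither 0 nor 1, the order k of r is prime to p.
  have hk0 : (k : F) ≠ 0 := by
    refine orderOf_gen_mul_ne_zero p h2 S ?_ ?_
    · rw [h.h01, h.h10, one_mul]; exact h.x_ne
    · rw [h.h01, h.h10, one_mul]; exact hx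
  -- The vectors u for which the elation w ↦ w + 2(φ_2·w)u belongs to H. They are closed under
  -- addition because elations with a common axis compose additively.
  let U : AddSubmonoid (Fin 3 → F) :=
    { carrier := {u | S.φ 2 ⬝ᵥ u = 0 ∧ ∃ g ∈ H, ∀ w : Fin 3 → F, g • w = w + (2 * (S.φ 2 ⬝ᵥ w)) • u}
      zero_mem' := ⟨dotProduct_zero _, 1, H.one_mem, fun w => by rw [one_smul, smul_zero, add_zero]⟩
      add_mem' := by
        rintro u u' ⟨hu, g, hg, hgw⟩ ⟨hu', g', hg', hgw'⟩
        refine ⟨by rw [dotProduct_add, hu, hu', add_zero], g * g', H.mul_mem hg hg', fun w => ?_⟩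
        rw [mul_smul, hgw', hgw, dotProduct_add, dotProduct_smul, hu']
        module }
  -- The product of the r^n-conjugate of the third homology with that homology is the elation with
  -- vector r^n v_2 - v_2. These vectors sum to k(v_3 - v_2), and k is then cancelled modulo p.
  have hU1 : ∀ n : ℕ, r ^ n • S.v 2 - S.v 2 ∈ U := by
    intro n
    refine ⟨by rw [dotProduct_sub, hrφ', sub_self], r ^ n * S.gen 2 * (r ^ n)⁻¹ * S.gen 2,
      H.mul_mem (H.mul_mem (H.mul_mem (H.pow_mem mr n) m2) (H.inv_mem (H.pow_mem mr n))) m2,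
      fun w => ?_⟩
    have hinv : ∀ w, S.φ 2 ⬝ᵥ ((r ^ n)⁻¹ • w) = S.φ 2 ⬝ᵥ w := by
      intro w
      rw [← hrφ' n, smul_inv_smul]
    rw [mul_smul, mul_smul, mul_smul, gen_smul, gen_smul, hinv, smul_sub, smul_inv_smul,
      dotProduct_sub, dotProduct_smul, S.pair, smul_eq_mul, smul_comm (r ^ n)]
    generalize r ^ n • S.v 2 = u
    module
  have hU2 : (k : F) • (S.v 3 - S.v 2) ∈ U := by
    have : (k : F) • (S.v 3 - S.v 2) = ∑ n ∈ Finset.range k, (r ^ n • S.v 2 - S.v 2) := by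
      rw [Finset.sum_sub_distrib, ← hN, hNv, smul_sub, Finset.sum_const, Finset.card_range, Nat.cast_smul_eq_nsmul F k (S.v 2)]
    rw [this]
    exact U.sum_mem fun n _ => hU1 n
  obtain ⟨m, hm⟩ : ∃ m : ℕ, (m : F) * k = 1 := by
    have hk' : (k : ZMod p) ≠ 0 := by
      rw [Ne, ZMod.natCast_eq_zero_iff, ← CharP.cast_eq_zero_iff F p]
      exact hk0
    refine ⟨((k : ZMod p)⁻¹).val, ?_⟩
    have := congrArg (ZMod.castHom (dvd_refl p) F) (inv_mul_cancel₀ hk')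
    rw [map_mul, map_one, map_natCast, ← ZMod.natCast_zmod_val ((k : ZMod p)⁻¹), map_natCast] at this
    exact this
  have hU3 : S.v 3 - S.v 2 ∈ U := by
    have := U.nsmul_mem hU2 m
    rwa [← Nat.cast_smul_eq_nsmul F, smul_smul, hm, one_smul] at this
  obtain ⟨-, g, hg, hgw⟩ := hU3
  have : S.gen 3 = g * S.gen 2 := by
    apply sl_ext_smul
    intro w
    rw [mul_smul, hgw, gen_smul, gen_smul, hφ, dotProduct_sub, dotProduct_smul, S.pair, smul_eq_mul]
    module
  rw [this]
  exact H.mul_mem hg m2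

/-- Reversal alone turns the products φ_i·v_{i+1} into φ_{i+1}·v_i; passing to the dual exchanges
them back, so that the normalisation survives with x and z swapped. -/
theorem Normal.dual_rev {S : Frame F} {x z : F} (h : S.Normal x z) : S.rev.dual.Normal z x where
  h01 := by rw [dotProduct_comm]; exact h.h23
  h12 := by rw [dotProduct_comm]; exact h.h12
  h23 := by rw [dotProduct_comm]; exact h.h01
  h10 := by rw [dotProduct_comm]; exact h.h32
  h32 := by rw [dotProduct_comm]; exact h.h10
  x_ne := h.z_ne
  z_ne := h.x_ne

theorem Normal.eq_one_iff [Finite F] (p : ℕ) [CharP F p] [Fact p.Prime] (h2 : (2 : F) ≠ 0)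
    {S : Frame F} (hS : S.Indep) {x z : F} (h : S.Normal x z) : x = 1 ↔ z = 1 := by
  constructor
  · rintro rfl
    by_contra hz
    exact hS.rev.dual 3 {0, 1, 2} (by decide) (gen_three_mem p h2 h.dual_rev hz)
  · rintro rfl
    by_contra hx
    exact hS 3 {0, 1, 2} (by decide) (gen_three_mem p h2 h hx)

end Frame

end Homology

/-! ### Change of basis and field, and the Heisenberg case. -/

namespace Homology

variable {F L : Type*} [Field F] [Field L]

/-- Extension of scalars along `f`, followed by a change of basis. -/
def changeBasis (f : L →+* F) {g g' : Matrix (Fin 3) (Fin 3) F} (hg : g * g' = 1) :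
    SpecialLinearGroup (Fin 3) L →* SpecialLinearGroup (Fin 3) F where
  toFun A := ⟨g * A.1.map f * g', by
    rw [det_mul, det_mul, mul_right_comm, ← det_mul, hg, det_one, one_mul]
    exact (RingHom.map_det f A.1).symm.trans (by rw [A.2, map_one])⟩
  map_one' := Subtype.ext (by
    change g * (1 : Matrix (Fin 3) (Fin 3) L).map f * g' = 1
    rw [Matrix.map_one f (map_zero f) (map_one f), mul_one, hg])
  map_mul' A B := Subtype.ext (by
    change g * (A.1 * B.1).map f * g' = (g * A.1.map f * g') * (g * B.1.map f * g')
    rw [Matrix.map_mul, show g * A.1.map f * g' * (g * B.1.map f * g') =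
      g * A.1.map f * (g' * g) * B.1.map f * g' by noncomm_ring, mul_eq_one_comm.mp hg]
    noncomm_ring)

/-- Extension of scalars along `f`, followed by a change of basis, modulo scalars. -/
def toPSL (f : L →+* F) {g g' : Matrix (Fin 3) (Fin 3) F} (hg : g * g' = 1) :
    SpecialLinearGroup (Fin 3) L →* PSL3 F :=
  (QuotientGroup.mk' _).comp (changeBasis f hg)

theorem eq_smul_one_of_toPSL_eq_one (f : L →+* F) {g g' : Matrix (Fin 3) (Fin 3) F}
    (hg : g * g' = 1) {A : SpecialLinearGroup (Fin 3) L} (h : toPSL f hg A = 1) :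
    ∃ c : L, A.1 = c • (1 : Matrix (Fin 3) (Fin 3) L) := by
  have h1 : changeBasis f hg A ∈ Subgroup.center _ := (QuotientGroup.eq_one_iff _).mp h
  obtain ⟨c, -, e⟩ := Matrix.SpecialLinearGroup.mem_center_iff.mp h1
  have e1 : g * A.1.map f * g' = c • 1 := by
    refine Eq.trans e.symm ?_
    rw [scalar_apply, ← smul_one_eq_diagonal]
  have e2 : A.1.map f = c • 1 := by
    have : A.1.map f = (g' * g) * A.1.map f * (g' * g) := by
      rw [mul_eq_one_comm.mp hg, one_mul, mul_one]
    rw [this, show g' * g * A.1.map f * (g' * g) = g' * (g * A.1.map f * g') * g by noncomm_ring,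
      e1, mul_smul_comm, smul_mul_assoc, mul_one, mul_eq_one_comm.mp hg]
  generalize A.1 = B at e2
  refine ⟨B 0 0, ?_⟩
  ext i j
  apply f.injective
  have h00 := congrFun (congrFun e2 0) 0
  have hij := congrFun (congrFun e2 i) j
  simp only [map_apply, Matrix.smul_apply, one_apply, smul_eq_mul] at h00 hij
  rw [Matrix.smul_apply, smul_eq_mul, map_mul, h00, hij, one_apply]
  split_ifs <;> simp

/-- An element of the kernel is a scalar c with c³ = 1 by the determinant; together with c² = 1 this
gives c = 1. -/
theorem eq_one_of_toPSL_eq_one (f : L →+* F) {g g' : Matrix (Fin 3) (Fin 3) F}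
    (hg : g * g' = 1) {A : SpecialLinearGroup (Fin 3) L} (h : toPSL f hg A = 1)
    (h2 : ∀ c : L, A.1 = c • (1 : Matrix (Fin 3) (Fin 3) L) → c ^ 2 = 1) : A = 1 := by
  obtain ⟨c, hc⟩ := eq_smul_one_of_toPSL_eq_one f hg h
  have h2 := h2 c hc
  have h3 : c ^ 3 = 1 := by
    have := A.2
    rw [hc] at this
    simpa using this
  have hc1 : c = 1 := by rw [← h3, pow_succ, h2, one_mul]
  exact Subtype.ext (by rw [hc, hc1, one_smul]; rfl)

theorem toPSL_reflSL (f : L →+* F) {g g' : Matrix (Fin 3) (Fin 3) F} (hg : g * g' = 1)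
    {v φ : Fin 3 → L} (h : φ ⬝ᵥ v = 1) {w ψ : Fin 3 → F} (h' : ψ ⬝ᵥ w = 1)
    (hw : g' *ᵥ w = f ∘ v) (hψ : ψ ᵥ* g = f ∘ φ) :
    toPSL f hg (reflSL v φ h) = QuotientGroup.mk (reflSL w ψ h') := by
  refine congrArg QuotientGroup.mk (Subtype.ext ?_)
  change g * (refl v φ).map f * g' = refl w ψ
  have e : (refl v φ).map f = refl (f ∘ v) (f ∘ φ) := by
    ext i j
    simp only [refl, map_apply, Matrix.sub_apply, Matrix.smul_apply, vecMulVec_apply, one_apply, smul_eq_mul,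
      map_sub, map_mul, map_ofNat, Function.comp_apply]
    split_ifs <;> simp
  rw [e, mul_refl_mul g g' hg, ← hw, ← hψ, mulVec_mulVec, vecMul_vecMul, hg, one_mulVec, vecMul_one]

theorem exists_equiv_closure {Γ Δ : Type*} [Group Γ] [Group Δ] {ι : Type*} (Ψ : Γ →* Δ)
    (hΨ : Function.Injective Ψ) {s : ι → Γ} {ρ : ι → Δ} (h : ∀ i, Ψ (s i) = ρ i) :
    Nonempty (Subgroup.closure (Set.range ρ) ≃* Subgroup.closure (Set.range s)) := by
  have e : Subgroup.closure (Set.range ρ) = (Subgroup.closure (Set.range s)).map Ψ := by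
    rw [MonoidHom.map_closure, ← Set.range_comp]
    congr 2
    exact funext fun i => (h i).symm
  rw [e]
  exact ⟨((Subgroup.closure (Set.range s)).equivMapOfInjective Ψ hΨ).symm⟩

/-- The matrix with the given columns. -/
def ofCols (a b c : Fin 3 → F) : Matrix (Fin 3) (Fin 3) F := (Matrix.of ![a, b, c])ᵀ

/-- The matrix with the given rows. -/
def ofRows (a b c : Fin 3 → F) : Matrix (Fin 3) (Fin 3) F := Matrix.of ![a, b, c]

theorem ofRows_mulVec (a b c u : Fin 3 → F) :
    ofRows a b c *ᵥ u = ![a ⬝ᵥ u, b ⬝ᵥ u, c ⬝ᵥ u] := by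
  ext i; fin_cases i <;> rfl

theorem vecMul_ofCols (a b c u : Fin 3 → F) :
    u ᵥ* ofCols a b c = ![u ⬝ᵥ a, u ⬝ᵥ b, u ⬝ᵥ c] := by
  ext i; fin_cases i <;> rfl

theorem ofRows_mul_ofCols (a b c a' b' c' : Fin 3 → F) : ofRows a b c * ofCols a' b' c' =
    !![a ⬝ᵥ a', a ⬝ᵥ b', a ⬝ᵥ c'; b ⬝ᵥ a', b ⬝ᵥ b', b ⬝ᵥ c'; c ⬝ᵥ a', c ⬝ᵥ b', c ⬝ᵥ c'] := by
  ext i j; fin_cases i <;> fin_cases j <;> rfl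

section Heisenberg

/-- An upper unitriangular matrix. -/
def unitri (a b c : L) : SpecialLinearGroup (Fin 3) L :=
  ⟨!![1, a, c; 0, 1, b; 0, 0, 1], by simp [det_fin_three]⟩

theorem unitri_mul (a b c a' b' c' : L) :
    unitri a b c * unitri a' b' c' = unitri (a + a') (b + b') (c + c' + a * b') := by
  apply Subtype.ext
  change !![1, a, c; 0, 1, b; 0, 0, 1] * !![1, a', c'; 0, 1, b'; 0, 0, 1] =
    !![1, a + a', c + c' + a * b'; 0, 1, b + b'; 0, 0, 1]
  ext i j
  fin_cases i <;> fin_cases j <;> simp [Matrix.mul_apply, Fin.sum_univ_three] <;> ring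

theorem unitri_zero : unitri (0 : L) 0 0 = 1 := by
  apply Subtype.ext
  change !![1, 0, 0; 0, 1, 0; 0, 0, 1] = 1
  ext i j
  fin_cases i <;> fin_cases j <;> rfl

theorem mem_of_unitri {n : ℕ} [Fact n.Prime] (h2 : (2 : ZMod n) ≠ 0)
    {H : Subgroup (SpecialLinearGroup (Fin 3) (ZMod n))}
    (h0 : unitri 2 0 0 ∈ H) (h1 : unitri 0 2 0 ∈ H) (a b c : ZMod n) : unitri a b c ∈ H := by
  have hcov : ∀ a : ZMod n, ∃ m : ℕ, a = m * 2 := by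
    intro a
    refine ⟨(a / 2).val, ?_⟩
    rw [ZMod.natCast_zmod_val, div_mul_cancel₀ _ h2]
  have ha : ∀ a, unitri a 0 0 ∈ H := by
    intro a
    obtain ⟨m, rfl⟩ := hcov a
    induction m with
    | zero => simp [unitri_zero, H.one_mem]
    | succ m ih =>
      have := H.mul_mem ih h0
      rw [unitri_mul] at this
      convert this using 2 <;> push_cast <;> ring
  have hb : ∀ b, unitri 0 b 0 ∈ H := by
    intro a
    obtain ⟨m, rfl⟩ := hcov a
    induction m with
    | zero => simp [unitri_zero, H.one_mem]
    | succ m ih =>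
      have := H.mul_mem ih h1
      rw [unitri_mul] at this
      convert this using 2 <;> push_cast <;> ring
  -- The commutator of two elementary unitriangular matrices supplies the central entry.
  have hc : unitri 0 0 (c - a * b) ∈ H := by
    have := H.mul_mem (H.mul_mem (H.mul_mem (ha (c - a * b)) (hb 1)) (ha (-(c - a * b)))) (hb (-1))
    simp only [unitri_mul] at this
    convert this using 2 <;> ring
  have := H.mul_mem hc (H.mul_mem (ha a) (hb b))
  simp only [unitri_mul] at this
  convert this using 2 <;> ring

theorem mul_eq_unitri {d A : Matrix (Fin 3) (Fin 3) L} {e : Fin 3 → L} (hd : d = diagonal e)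
    (h0 : A 1 0 = 0) (h1 : A 2 0 = 0) (h2 : A 2 1 = 0) (h : ∀ i, e i * A i i = 1) :
    d * A = !![1, e 0 * A 0 1, e 0 * A 0 2; 0, 1, e 1 * A 1 2; 0, 0, 1] := by
  subst hd
  ext i j
  rw [diagonal_mul]
  fin_cases i <;> fin_cases j <;> simp [h0, h1, h2, h]

theorem mem_of_upperTriangular {n : ℕ} [Fact n.Prime]
    {H : Subgroup (SpecialLinearGroup (Fin 3) (ZMod n))}
    (hU : ∀ a b c, unitri a b c ∈ H) {A d : SpecialLinearGroup (Fin 3) (ZMod n)}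
    {e : Fin 3 → ZMod n} (hd : d.1 = diagonal e) (hdH : d ∈ H)
    (h0 : A.1 1 0 = 0) (h1 : A.1 2 0 = 0) (h2 : A.1 2 1 = 0) (h : ∀ i, e i * A.1 i i = 1) :
    A ∈ H := by
  have e1 := mul_eq_unitri hd h0 h1 h2 h
  have e2 : d * A = unitri (e 0 * A.1 0 1) (e 1 * A.1 1 2) (e 0 * A.1 0 2) := Subtype.ext e1
  have := hU (e 0 * A.1 0 1) (e 1 * A.1 1 2) (e 0 * A.1 0 2)
  rw [← e2] at this
  exact (H.mul_mem_cancel_left hdH).mp this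

/-- Centres of four homologies that generate `heisenbergSemidirect`. -/
def heisV (n : ℕ) : Fin 4 → Fin 3 → ZMod n := ![![1, 0, 0], ![1, 0, 0], ![0, 1, 1], ![0, 0, 1]]

/-- Axes of four homologies that generate `heisenbergSemidirect`. -/
def heisφ (n : ℕ) : Fin 4 → Fin 3 → ZMod n := ![![1, 0, 0], ![1, 1, 0], ![0, 0, 1], ![0, 0, 1]]

theorem heis_pair (n : ℕ) (i : Fin 4) : heisφ n i ⬝ᵥ heisV n i = 1 := by
  fin_cases i <;> simp [heisφ, heisV, dotProduct, Fin.sum_univ_three]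

/-- Four homologies that generate `heisenbergSemidirect`. -/
def heisGen (n : ℕ) [Fact n.Prime] (i : Fin 4) : SpecialLinearGroup (Fin 3) (ZMod n) :=
  reflSL _ _ (heis_pair n i)

theorem heis_matrices (n : ℕ) [Fact n.Prime] :
    refl (heisV n 0) (heisφ n 0) = diagonal ![1, -1, -1] ∧
    refl (heisV n 1) (heisφ n 1) = !![1, 2, 0; 0, -1, 0; 0, 0, -1] ∧
    refl (heisV n 2) (heisφ n 2) = !![-1, 0, 0; 0, -1, 2; 0, 0, 1] ∧
    refl (heisV n 3) (heisφ n 3) = diagonal ![-1, -1, 1] := by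
  refine ⟨?_, ?_, ?_, ?_⟩ <;>
  · ext i j
    fin_cases i <;> fin_cases j <;>
      simp [refl, heisV, heisφ, Matrix.sub_apply, one_apply] <;> norm_num

/-- The products of the outer pairs are the elementary matrices with entry 2, which generate all
unitriangular matrices as 2 is invertible. The first and last generators generate the diagonal
matrices with entries ±1 and determinant 1. -/
theorem closure_heisGen {n : ℕ} [Fact n.Prime] (hn : (2 : ZMod n) ≠ 0) :
    Subgroup.closure (Set.range (heisGen n)) = heisenbergSemidirect n := by
  obtain ⟨m0, m1, m2, m3⟩ := heis_matrices n
  apply le_antisymm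
  · rw [Subgroup.closure_le]
    rintro _ ⟨i, rfl⟩
    have key : ∀ {A : SpecialLinearGroup (Fin 3) (ZMod n)} {B : Matrix (Fin 3) (Fin 3) (ZMod n)},
        A.1 = B → ((B 1 0 = 0 ∧ B 2 0 = 0 ∧ B 2 1 = 0) ∧ ∀ i, B i i = 1 ∨ B i i = -1) →
        A ∈ heisenbergSemidirect n := by
      rintro A _ rfl h
      exact h
    fin_cases i
    · refine key m0 ⟨by simp, fun i => ?_⟩
      fin_cases i <;> simp
    · refine key m1 ⟨by simp, fun i => ?_⟩
      fin_cases i <;> simp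
    · refine key m2 ⟨by simp, fun i => ?_⟩
      fin_cases i <;> simp
    · refine key m3 ⟨by simp, fun i => ?_⟩
      fin_cases i <;> simp
  · set H := Subgroup.closure (Set.range (heisGen n))
    have hm : ∀ i, heisGen n i ∈ H := fun i => Subgroup.subset_closure ⟨i, rfl⟩
    have u0 : unitri 2 0 0 ∈ H := by
      have : heisGen n 0 * heisGen n 1 = unitri 2 0 0 := by
        apply Subtype.ext
        change refl (heisV n 0) (heisφ n 0) * refl (heisV n 1) (heisφ n 1) = !![1, 2, 0; 0, 1, 0; 0, 0, 1]
        rw [m0, m1]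
        ext i j
        rw [diagonal_mul]
        fin_cases i <;> fin_cases j <;> simp
      rw [← this]
      exact H.mul_mem (hm 0) (hm 1)
    have u1 : unitri 0 2 0 ∈ H := by
      have h23 : heisGen n 2 * heisGen n 3 = unitri 0 2 0 := by
        apply Subtype.ext
        change refl (heisV n 2) (heisφ n 2) * refl (heisV n 3) (heisφ n 3) = !![1, 0, 0; 0, 1, 2; 0, 0, 1]
        rw [m2, m3]
        ext i j
        rw [mul_diagonal]
        fin_cases i <;> fin_cases j <;> simp
      rw [← h23]
      exact H.mul_mem (hm 2) (hm 3)
    have hU := mem_of_unitri hn u0 u1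
    rintro A ⟨⟨a0, a1, a2⟩, hA⟩
    have hdet : A.1 0 0 * A.1 1 1 * A.1 2 2 = 1 := by
      have := A.2
      rw [det_fin_three] at this
      have a0' : A.1 1 0 = 0 := a0
      have a1' : A.1 2 0 = 0 := a1
      have a2' : A.1 2 1 = 0 := a2
      rw [a0', a1', a2'] at this
      linear_combination this
    have hA' : ∀ i, A.1 i i = 1 ∨ A.1 i i = -1 := hA
    have hne : (-1 : ZMod n) ≠ 1 := by
      intro h
      apply hn
      linear_combination -h
    have d03 : (heisGen n 0 * heisGen n 3).1 = diagonal ![-1, 1, -1] := by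
      change refl (heisV n 0) (heisφ n 0) * refl (heisV n 3) (heisφ n 3) = _
      rw [m0, m3, diagonal_mul_diagonal]
      congr 1
      ext i; fin_cases i <;> simp
    rcases hA' 0 with b0 | b0 <;> rcases hA' 1 with b1 | b1 <;> rcases hA' 2 with b2 | b2 <;>
      rw [b0, b1, b2] at hdet <;> norm_num at hdet <;> try exact absurd hdet hne
    · refine mem_of_upperTriangular hU (d := 1) (e := 1) diagonal_one.symm H.one_mem a0 a1 a2 fun i => ?_
      fin_cases i <;> simp [b0, b1, b2]
    · refine mem_of_upperTriangular hU (d := heisGen n 0) m0 (hm 0) a0 a1 a2 fun i => ?_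
      fin_cases i <;> simp [b0, b1, b2]
    · refine mem_of_upperTriangular hU (d := heisGen n 0 * heisGen n 3) d03 (H.mul_mem (hm 0) (hm 3))
        a0 a1 a2 fun i => ?_
      fin_cases i <;> simp [b0, b1, b2]
    · refine mem_of_upperTriangular hU (d := heisGen n 3) m3 (hm 3) a0 a1 a2 fun i => ?_
      fin_cases i <;> simp [b0, b1, b2]

end Heisenberg

namespace Frame

theorem heisenberg_case (p : ℕ) [CharP F p] [Fact p.Prime] (h2 : (2 : F) ≠ 0) {ρ : Fin 4 → PSL3 F}
    {S : Frame F} (h : ∀ i, (QuotientGroup.mk (S.gen i) : PSL3 F) = ρ i) (hN : S.Normal 1 1) :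
    Nonempty (Subgroup.closure (Set.range ρ) ≃* heisenbergSemidirect p) ∧
        ∃ (P : PG2 F) (L : Set (PG2 F)), IsLine L ∧ P ∈ L ∧
          FixesPoint (Subgroup.closure (Set.range ρ)) P ∧
          PreservesSet (Subgroup.closure (Set.range ρ)) L := by
  obtain ⟨e1, e2, e3, e4, e5, e6⟩ := S.orth'
  have h21 : S.φ 2 ⬝ᵥ S.v 1 = 0 := by rw [hN.h21]; ring
  have p0 := S.pair 0
  have p1 := S.pair 1
  have p2 := S.pair 2
  have p3 := S.pair 3
  have h01 := hN.h01
  have h12 := hN.h12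
  have h23 := hN.h23
  have h10 := hN.h10
  have h32 := hN.h32
  -- The covectors φ_0, φ_1 - φ_0, φ_3 form the basis dual to v_0, v_2 - v_3, v_3. In it all centres
  -- and axes have entries 0 and 1, so the frame descends to the prime field.
  have hg' : ofRows (S.φ 0) (S.φ 1 - S.φ 0) (S.φ 3) * ofCols (S.v 0) (S.v 2 - S.v 3) (S.v 3) = 1 := by
    rw [ofRows_mul_ofCols]
    simp only [sub_dotProduct, dotProduct_sub, *]
    ext i j
    fin_cases i <;> fin_cases j <;> simp
  have hg := mul_eq_one_comm.mp hg'
  have hv : S.v 1 = S.v 0 := by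
    have : ofRows (S.φ 0) (S.φ 1 - S.φ 0) (S.φ 3) *ᵥ S.v 1 =
        ofRows (S.φ 0) (S.φ 1 - S.φ 0) (S.φ 3) *ᵥ S.v 0 := by
      rw [ofRows_mulVec, ofRows_mulVec]
      simp only [sub_dotProduct, *]
    have := congrArg (ofCols (S.v 0) (S.v 2 - S.v 3) (S.v 3) *ᵥ ·) this
    simpa only [mulVec_mulVec, hg, one_mulVec] using this
  have hφ : S.φ 2 = S.φ 3 := by
    have : S.φ 2 ᵥ* ofCols (S.v 0) (S.v 2 - S.v 3) (S.v 3) =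
        S.φ 3 ᵥ* ofCols (S.v 0) (S.v 2 - S.v 3) (S.v 3) := by
      rw [vecMul_ofCols, vecMul_ofCols]
      simp only [dotProduct_sub, *]
    have := congrArg (· ᵥ* ofRows (S.φ 0) (S.φ 1 - S.φ 0) (S.φ 3)) this
    simpa only [vecMul_vecMul, hg, vecMul_one] using this
  let f : ZMod p →+* F := ZMod.castHom (dvd_refl p) F
  have hn : (2 : ZMod p) ≠ 0 := by
    intro h
    apply h2
    rw [← map_ofNat f 2, h, map_zero]
  have hgen : ∀ i, toPSL f hg (heisGen p i) = ρ i := by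
    intro i
    rw [← h]
    refine toPSL_reflSL f hg _ _ ?_ ?_
    · rw [ofRows_mulVec]
      fin_cases i <;> ext j <;> fin_cases j <;> simp [heisV, sub_dotProduct, *]
    · rw [vecMul_ofCols]
      fin_cases i <;> ext j <;> fin_cases j <;> simp [heisφ, dotProduct_sub, *]
  refine ⟨?_, Projectivization.mk F (S.v 0) (S.v_ne_zero 0), lineOf (S.φ 3),
    isLine_lineOf (S.φ_ne_zero 3), ?_, ?_, ?_⟩
  · have hinj : Function.Injective ((toPSL f hg).comp (heisenbergSemidirect p).subtype) := by
      rw [injective_iff_map_eq_one]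
      rintro ⟨A, hA⟩ hA1
      apply Subtype.ext
      refine eq_one_of_toPSL_eq_one f hg hA1 fun c hc => ?_
      have h0 : A.1 0 0 = 1 ∨ A.1 0 0 = -1 := hA.2 0
      rw [hc] at h0
      rcases h0 with h0 | h0 <;> simp at h0 <;> rw [h0] <;> ring
    obtain ⟨E⟩ := exists_equiv_closure _ hinj (ρ := ρ)
      (s := fun i => ⟨heisGen p i, closure_heisGen hn ▸ Subgroup.subset_closure ⟨i, rfl⟩⟩) hgen
    have htop : Subgroup.closure (Set.range fun i => (⟨heisGen p i, closure_heisGen hn ▸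
        Subgroup.subset_closure ⟨i, rfl⟩⟩ : heisenbergSemidirect p)) = ⊤ := by
      apply Subgroup.map_injective (heisenbergSemidirect p).subtype_injective
      rw [MonoidHom.map_closure, ← Set.range_comp, ← MonoidHom.range_eq_map, Subgroup.range_subtype]
      exact closure_heisGen hn
    rw [htop] at E
    exact ⟨E.trans Subgroup.topEquiv⟩
  · rw [mk_mem_lineOf]
    exact e4
  · refine fixesPoint_of_gen h _ fun i => ?_
    rw [S.gen_smul]
    fin_cases i
    · exact ⟨1, by change (2 * (S.φ 0 ⬝ᵥ S.v 0)) • S.v 0 - S.v 0 = _; rw [p0]; module⟩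
    · exact ⟨1, by change (2 * (S.φ 1 ⬝ᵥ S.v 0)) • S.v 1 - S.v 0 = _; rw [h10, hv]; module⟩
    · exact ⟨-1, by change (2 * (S.φ 2 ⬝ᵥ S.v 0)) • S.v 2 - S.v 0 = _; rw [e2]; module⟩
    · exact ⟨-1, by change (2 * (S.φ 3 ⬝ᵥ S.v 0)) • S.v 3 - S.v 0 = _; rw [e4]; module⟩
  · refine preservesSet_lineOf h fun i => ?_
    fin_cases i
    · exact Or.inr e4
    · exact Or.inr e6
    · exact Or.inl hφ
    · exact Or.inl rfl

end Frame

end Homology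

/-! ### Dickson's count, in abstract form. -/

/-- Axes of the elements of a finite group of rotations: every nontrivial element `h` is a rotation
about exactly one point `x`, and `T x` is the group of rotations about `x`. The points are
either isotropic (`iso x`) or not. -/
structure RotationGroup (p : ℕ) (H X : Type*) [Group H] [MulAction H X] where
  T : X → Subgroup H
  iso : X → Prop
  le_stab : ∀ x, T x ≤ MulAction.stabilizer H x
  conj_mem : ∀ (x : X) (g h : H), h ∈ T x → g * h * g⁻¹ ∈ T (g • x)
  iso_smul : ∀ (x : X) (g : H), iso x → iso (g • x)
  exists_mem : ∀ h : H, h ≠ 1 → ∃ x, h ∈ T x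
  unique : ∀ (x y : X) (h : H), h ≠ 1 → h ∈ T x → h ∈ T y → x = y
  mul_mem : ∀ (x : X) (a b : H), ¬ iso x → a • x = x → b • x = x → a ∉ T x → b ∉ T x → a * b ∈ T x
  pGroup : ∀ x, iso x → IsPGroup p (T x)
  fixed : ∀ (x y : X) (h : H), iso x → iso y → h ∈ T x → h ≠ 1 → h • y = y → x = y
  torus : ∀ x, iso x → MulAction.stabilizer H x ≠ T x → ∃ y, ¬ iso y ∧
    T y ≤ MulAction.stabilizer H x ∧ Nat.card (T y) * Nat.card (T x) =
      Nat.card (MulAction.stabilizer H x)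
  not_fixed : ∀ x, iso x → MulAction.stabilizer H x ≠ ⊤

namespace RotationGroup

theorem card_dvd_of_free {G X : Type*} [Group G] [MulAction G X]
    (h : ∀ (g : G) (x : X), g • x = x → g = 1) : Nat.card G ∣ Nat.card X := by
  have h' : ∀ x : X, MulAction.stabilizer G x = ⊥ := fun x =>
    (Subgroup.eq_bot_iff_forall _).mpr fun g hg => h g x hg
  rw [Nat.card_congr (MulAction.selfEquivOrbitsQuotientProd h'), Nat.card_prod]
  exact dvd_mul_left _ _

variable {p : ℕ} {H X : Type*} [Group H] [MulAction H X] (D : RotationGroup p H X)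

theorem mem_T_iff (x : X) (g h : H) : g * h * g⁻¹ ∈ D.T (g • x) ↔ h ∈ D.T x := by
  refine ⟨fun hh => ?_, D.conj_mem x g h⟩
  have := D.conj_mem _ g⁻¹ _ hh
  rw [inv_smul_smul] at this
  convert this using 1
  group

theorem card_T_smul (x : X) (g : H) : Nat.card (D.T (g • x)) = Nat.card (D.T x) := by
  symm
  refine Nat.card_congr ((MulAut.conj g).toEquiv.subtypeEquiv fun h => ?_)
  exact (D.mem_T_iff x g h).symm

/-- Elements of the stabiliser outside T x reverse the axis, so the product of two of them lies in T
x, and the index is two. -/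
theorem card_noniso [Finite H] {x : X} (hx : ¬ D.iso x)
    (hne : MulAction.stabilizer H x ≠ D.T x) :
    Nat.card (MulAction.stabilizer H x) = 2 * Nat.card (D.T x) := by
  obtain ⟨a, ha, haT⟩ : ∃ a ∈ MulAction.stabilizer H x, a ∉ D.T x := by
    by_contra! hc
    exact hne (le_antisymm hc (D.le_stab x))
  have hi : (D.T x).relIndex (MulAction.stabilizer H x) = 2 := by
    rw [Subgroup.relIndex_eq_two_iff]
    refine ⟨a, ha, fun b hb => ?_⟩
    by_cases hbT : b ∈ D.T x
    · refine Or.inr ⟨hbT, fun h => haT ?_⟩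
      exact ((D.T x).mul_mem_cancel_left hbT).mp h
    · exact Or.inl ⟨D.mul_mem x b a hx hb ha hbT haT, hbT⟩
  rw [← hi, mul_comm, ← Nat.card_congr (Subgroup.subgroupOfEquivOfLe (D.le_stab x)).toEquiv]
  exact (Subgroup.card_mul_index _).symm

/-- The contribution of the orbit of `x` to the number of nontrivial elements, divided by the order
of the group. -/
noncomputable def weight (x : X) : ℚ :=
  (Nat.card (D.T x) - 1) / Nat.card (MulAction.stabilizer H x)

/-- The proportion of nontrivial elements with axes in a set. -/
noncomputable def share (A : Finset X) : ℚ :=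
  (∑ x ∈ A, ((Nat.card (D.T x) : ℚ) - 1)) / Nat.card H

/-- The nontrivial elements are partitioned by their axes. This is the class equation on which the
count rests. -/
theorem share_univ [Finite H] [Fintype X] : D.share Finset.univ = 1 - 1 / Nat.card H := by
  classical
  have := Fintype.ofFinite H
  have hN : (Nat.card H : ℚ) ≠ 0 := by exact_mod_cast Nat.card_pos.ne'
  rw [share, eq_sub_iff_add_eq, ← add_div, div_eq_one_iff_eq hN]
  have key : (Finset.univ.erase (1 : H)) =
      Finset.univ.biUnion fun x : X => (Finset.univ.filter fun h => h ∈ D.T x).erase 1 := by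
    ext h
    simp only [Finset.mem_erase, Finset.mem_univ, and_true, Finset.mem_biUnion, Finset.mem_filter,
      true_and]
    refine ⟨fun h1 => ?_, fun ⟨x, h1, _⟩ => h1⟩
    obtain ⟨x, hx⟩ := D.exists_mem h h1
    exact ⟨x, h1, hx⟩
  have hc := congrArg Finset.card key
  rw [Finset.card_erase_of_mem (Finset.mem_univ _), Finset.card_univ, Finset.card_biUnion] at hc
  · have h1 : ∀ x : X, (((Finset.univ.filter fun h => h ∈ D.T x).erase 1).card : ℚ) =
        (Nat.card (D.T x) : ℚ) - 1 := by
      intro x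
      rw [Finset.card_erase_of_mem (by simp [(D.T x).one_mem]), Nat.cast_sub]
      · rw [Nat.card_eq_fintype_card, Fintype.card_subtype]
        simp
      · exact Finset.card_pos.mpr ⟨1, by simp [(D.T x).one_mem]⟩
    rw [← Finset.sum_congr rfl fun x _ => h1 x, ← Nat.cast_sum, ← hc,
      Nat.cast_sub Fintype.card_pos, Nat.card_eq_fintype_card]
    simp
  · intro x _ y _ hxy
    rw [Function.onFun, Finset.disjoint_left]
    intro h hh hh'
    simp only [Finset.mem_erase, Finset.mem_filter, Finset.mem_univ, true_and] at hh hh'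
    exact hxy (D.unique x y h hh.1 hh.2 hh'.2)

/-- A set of points that is a union of orbits. -/
def Inv (H : Type*) {X : Type*} [Group H] [MulAction H X] (A : Finset X) : Prop :=
  ∀ (g : H), ∀ y ∈ A, g • y ∈ A

theorem one_le_card_T [Finite H] (x : X) : 1 ≤ Nat.card (D.T x) := Nat.card_pos

theorem share_le [Finite H] [Fintype X] (A : Finset X) : D.share A ≤ 1 - 1 / Nat.card H := by
  rw [← D.share_univ, share, share]
  gcongr
  · intro x _ _
    have : (1 : ℚ) ≤ Nat.card (D.T x) := by exact_mod_cast D.one_le_card_T x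
    linarith
  · exact Finset.subset_univ A

theorem exists_of_share_lt [Finite H] [Fintype X] {A : Finset X}
    (h : D.share A < 1 - 1 / Nat.card H) : ∃ x ∉ A, 2 ≤ Nat.card (D.T x) := by
  by_contra! hc
  rw [← D.share_univ, share, share] at h
  refine h.ne ?_
  congr 1
  apply Finset.sum_subset (Finset.subset_univ A)
  intro x _ hx
  have : Nat.card (D.T x) = 1 := by
    have := D.one_le_card_T x
    have := hc x hx
    omega
  rw [this]
  simp

/-- The orbit of x has |H| / |stabiliser| points, and each of them carries |T x| - 1 nontrivial
elements. -/
theorem exists_inv_union [Finite H] [Fintype X] {A : Finset X} (hA : Inv H A) {x : X} (hx : x ∉ A) :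
    ∃ B : Finset X, Inv H B ∧ A ⊆ B ∧ (∀ y, y ∈ B ↔ y ∈ A ∨ y ∈ MulAction.orbit H x) ∧
      D.share B = D.share A + D.weight x := by
  classical
  have := Fintype.ofFinite H
  set O : Finset X := Finset.univ.filter fun y => y ∈ MulAction.orbit H x
  have hO : ∀ y, y ∈ O ↔ y ∈ MulAction.orbit H x := fun y => by simp [O]
  refine ⟨A ∪ O, ?_, Finset.subset_union_left, fun y => by rw [Finset.mem_union, hO], ?_⟩
  · intro g y hy
    rw [Finset.mem_union, hO] at hy ⊢
    refine hy.imp (hA g y) fun h => ?_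
    exact MulAction.mem_orbit_of_mem_orbit g h
  · have hd : Disjoint A O := by
      rw [Finset.disjoint_left]
      intro y hy hyO
      rw [hO] at hyO
      obtain ⟨g, rfl⟩ := hyO
      have := hA g⁻¹ _ hy
      simp only [inv_smul_smul] at this
      exact hx this
    rw [share, share, Finset.sum_union hd, add_div]
    congr 1
    have hN : (Nat.card H : ℚ) ≠ 0 := by exact_mod_cast Nat.card_pos.ne'
    have hs : (Nat.card (MulAction.stabilizer H x) : ℚ) ≠ 0 := by exact_mod_cast Nat.card_pos.ne'
    have hsum : ∑ y ∈ O, ((Nat.card (D.T y) : ℚ) - 1) = O.card * ((Nat.card (D.T x) : ℚ) - 1) := by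
      rw [Finset.sum_congr rfl (g := fun _ => (Nat.card (D.T x) : ℚ) - 1), Finset.sum_const,
        nsmul_eq_mul]
      intro y hy
      obtain ⟨g, rfl⟩ := (hO y).mp hy
      rw [D.card_T_smul]
    have hOc : O.card * Nat.card (MulAction.stabilizer H x) = Nat.card H := by
      have h1 := MulAction.card_orbit_mul_card_stabilizer_eq_card_group H x
      rw [Fintype.card_subtype] at h1
      rw [Nat.card_eq_fintype_card, Nat.card_eq_fintype_card]
      exact h1
    rw [hsum, weight, div_eq_div_iff hN hs, ← hOc]
    push_cast
    ring

theorem inv_empty : Inv H (∅ : Finset X) := fun _ _ h => absurd h (Finset.notMem_empty _)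

theorem share_empty : D.share ∅ = 0 := by simp [share]

theorem weight_noniso [Finite H] {x : X} (hx : ¬ D.iso x)
    (hne : MulAction.stabilizer H x ≠ D.T x) :
    D.weight x = 1 / 2 - 1 / Nat.card (D.T x) / 2 := by
  have : (Nat.card (D.T x) : ℚ) ≠ 0 := by exact_mod_cast Nat.card_pos.ne'
  rw [weight, D.card_noniso hx hne]
  push_cast
  field_simp

theorem weight_noniso' [Finite H] {x : X} (he : MulAction.stabilizer H x = D.T x) :
    D.weight x = 1 - 1 / Nat.card (D.T x) := by
  have : (Nat.card (D.T x) : ℚ) ≠ 0 := by exact_mod_cast Nat.card_pos.ne'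
  rw [weight, he]
  field_simp

theorem card_stabilizer_le [Finite H] {x : X} (h : MulAction.stabilizer H x ≠ ⊤) :
    2 * Nat.card (MulAction.stabilizer H x) ≤ Nat.card H := by
  have h1 := (MulAction.stabilizer H x).card_mul_index
  have h2 : (MulAction.stabilizer H x).index ≠ 1 := fun h' => h (Subgroup.index_eq_one.mp h')
  have h3 : (MulAction.stabilizer H x).index ≠ 0 := Subgroup.index_ne_zero_of_finite
  rw [← h1, mul_comm 2]
  exact Nat.mul_le_mul_left _ (by omega)

theorem inv_card_le [Finite H] {x : X} {k : ℕ} (hk : 0 < k) (h : k ≤ Nat.card (D.T x)) :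
    (1 : ℚ) / Nat.card (D.T x) ≤ 1 / k :=
  one_div_le_one_div_of_le (by exact_mod_cast hk) (by exact_mod_cast h)

theorem weight_noniso_ge [Finite H] {x : X} (hx : ¬ D.iso x) (h : 2 ≤ Nat.card (D.T x)) :
    1 / 4 ≤ D.weight x := by
  have := D.inv_card_le two_pos h
  push_cast at this
  by_cases hs : MulAction.stabilizer H x = D.T x
  · rw [D.weight_noniso' hs]; linarith
  · rw [D.weight_noniso hx hs]; linarith

theorem inv_card_pos [Finite H] (x : X) : (0 : ℚ) < 1 / Nat.card (D.T x) :=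
  one_div_pos.mpr (by exact_mod_cast Nat.card_pos)

theorem inv_card_le_of_base [Finite H] {x₀ : X} (h0 : ¬ D.iso x₀)
    (hs : MulAction.stabilizer H x₀ ≠ D.T x₀) (ht : MulAction.stabilizer H x₀ ≠ ⊤) :
    (1 : ℚ) / Nat.card H ≤ 1 / Nat.card (D.T x₀) / 4 := by
  have hN := card_stabilizer_le ht
  rw [D.card_noniso h0 hs] at hN
  rw [div_div]
  refine one_div_le_one_div_of_le ?_ ?_
  · have : (0 : ℚ) < Nat.card (D.T x₀) := by exact_mod_cast Nat.card_pos
    positivity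
  · have : ((2 * (2 * Nat.card (D.T x₀)) : ℕ) : ℚ) ≤ Nat.card H := by exact_mod_cast hN
    push_cast at this
    linarith

/-- The group contains a rotation about an isotropic point. -/
theorem exists_iso [Finite H] [Fintype X] {x₀ : X} (h0 : ¬ D.iso x₀)
    (hn : 6 ≤ Nat.card (D.T x₀)) (hs : MulAction.stabilizer H x₀ ≠ D.T x₀)
    (ht : MulAction.stabilizer H x₀ ≠ ⊤) : ∃ x, D.iso x ∧ 2 ≤ Nat.card (D.T x) := by
  -- Without isotropic axes each weight is 1/2 - 1/(2n) or 1 - 1/n with n = |T x|, as for finite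
  -- rotation groups of real space. When the first orbit has n ≥ 6, the weights can only add up in
  -- the dihedral way, with |H| = 2n. But |H| ≥ 4n, since the stabiliser of x₀ has order 2n and is
  -- proper.
  by_contra! hiso
  have hni : ∀ x, 2 ≤ Nat.card (D.T x) → ¬ D.iso x := fun x h h' => by
    have := hiso x h'
    omega
  have hNi := D.inv_card_le_of_base h0 hs ht
  have hNp : (0 : ℚ) < 1 / Nat.card H := one_div_pos.mpr (by exact_mod_cast Nat.card_pos)
  obtain ⟨A, hA, -, -, eA⟩ := D.exists_inv_union inv_empty (Finset.notMem_empty x₀)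
  rw [D.share_empty, zero_add, D.weight_noniso h0 hs] at eA
  have hn' := D.inv_card_le (by norm_num) hn
  have hnp := D.inv_card_pos x₀
  push_cast at hn'
  obtain ⟨y, hyA, hy⟩ := D.exists_of_share_lt (A := A) (by rw [eA]; linarith)
  obtain ⟨B, hB, -, -, eB⟩ := D.exists_inv_union hA hyA
  rw [eA] at eB
  have hBle := D.share_le B
  have hy2 := D.inv_card_le two_pos hy
  have hyp := D.inv_card_pos y
  push_cast at hy2
  have h3 : ∀ z, 2 ≤ Nat.card (D.T z) → Nat.card (D.T z) = 2 ∨ (1 : ℚ) / Nat.card (D.T z) ≤ 1 / 3 := by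
    intro z hz
    rcases Nat.lt_or_ge 2 (Nat.card (D.T z)) with h3 | h3
    · exact Or.inr (by exact_mod_cast D.inv_card_le three_pos h3)
    · exact Or.inl (by omega)
  by_cases hys : MulAction.stabilizer H y = D.T y
  · rw [D.weight_noniso' hys] at eB
    rcases h3 y hy with h3 | h3
    · rw [h3] at eB
      push_cast at eB
      obtain ⟨z, hzB, hz⟩ := D.exists_of_share_lt (A := B) (by rw [eB]; linarith)
      obtain ⟨C, -, -, -, eC⟩ := D.exists_inv_union hB hzB
      have := D.weight_noniso_ge (hni z hz) hz
      have hCle := D.share_le C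
      linarith
    · linarith
  · rw [D.weight_noniso (hni y hy) hys] at eB
    obtain ⟨z, hzB, hz⟩ := D.exists_of_share_lt (A := B) (by rw [eB]; linarith)
    obtain ⟨C, hC, -, -, eC⟩ := D.exists_inv_union hB hzB
    have hCle := D.share_le C
    have hz4 := D.weight_noniso_ge (hni z hz) hz
    have hz2 := D.inv_card_le two_pos hz
    push_cast at hz2
    rcases h3 y hy with hy3 | hy3
    · by_cases hzs : MulAction.stabilizer H z = D.T z
      · rw [D.weight_noniso' hzs] at eC
        linarith
      · rw [D.weight_noniso (hni z hz) hzs] at eC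
        rcases h3 z hz with hz3 | hz3
        · rw [hy3] at eB
          rw [hz3, eB] at eC
          push_cast at eC
          obtain ⟨u, huC, hu⟩ := D.exists_of_share_lt (A := C) (by rw [eC]; linarith)
          obtain ⟨E, -, -, -, eE⟩ := D.exists_inv_union hC huC
          have := D.weight_noniso_ge (hni u hu) hu
          have hEle := D.share_le E
          linarith
        · linarith
    · linarith

/-- The rotations about an isotropic point `x` act freely on an orbit, apart from the point `x`. -/
theorem card_dvd_orbit_diff [Finite H] [Finite X] {x y : X} (hx : D.iso x) (hy : D.iso y) :
    Nat.card (D.T x) ∣ Nat.card {z // z ∈ MulAction.orbit H y ∧ z ≠ x} := by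
  let S : SubMulAction (D.T x) X :=
    { carrier := {z | z ∈ MulAction.orbit H y ∧ z ≠ x}
      smul_mem' := by
        rintro ⟨g, hg⟩ z ⟨hz, hzx⟩
        refine ⟨MulAction.mem_orbit_of_mem_orbit g hz, fun h => hzx ?_⟩
        have h1 : g • z = x := h
        rw [eq_comm, ← inv_smul_eq_iff] at h1
        rw [← h1]
        exact D.le_stab x ((D.T x).inv_mem hg) }
  refine card_dvd_of_free (G := D.T x) (X := S) ?_
  rintro ⟨g, hg⟩ ⟨z, ⟨h, rfl⟩, hzx⟩ hgz
  have hgz' : g • h • y = h • y := congrArg Subtype.val hgz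
  by_contra hg1
  have hg1' : g ≠ 1 := fun e => hg1 (Subtype.ext e)
  exact hzx (D.fixed x _ g hx (D.iso_smul _ h hy) hg hg1' hgz').symm

/-- Free action of T x away from x makes the orbit of x congruent to 1 modulo p. If y lay outside
this orbit, T y would act freely on all of it, making its size divisible by p. -/
theorem mem_orbit_of_iso [Finite H] [Finite X] [Fact p.Prime] {x y : X} (hx : D.iso x)
    (hy : D.iso y) (hxT : 2 ≤ Nat.card (D.T x)) (hyT : 2 ≤ Nat.card (D.T y)) :
    y ∈ MulAction.orbit H x := by
  by_contra hyx
  have hp : ∀ {z}, D.iso z → 2 ≤ Nat.card (D.T z) → p ∣ Nat.card (D.T z) := by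
    intro z hz hzT
    obtain ⟨k, hk⟩ := (IsPGroup.iff_card.mp (D.pGroup z hz))
    rw [hk]
    refine dvd_pow_self p fun h0 => ?_
    rw [hk, h0] at hzT
    simp at hzT
  have h1 := (hp hx hxT).trans (D.card_dvd_orbit_diff hx hx)
  have h2 := (hp hy hyT).trans (D.card_dvd_orbit_diff hy hx)
  have e2 : Nat.card {z // z ∈ MulAction.orbit H x ∧ z ≠ y} = (MulAction.orbit H x).ncard := by
    change Set.ncard {z | z ∈ MulAction.orbit H x ∧ z ≠ y} = _
    congr 1
    ext z
    refine ⟨fun h => h.1, fun h => ⟨h, ?_⟩⟩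
    rintro rfl
    exact hyx h
  have e1 : Nat.card {z // z ∈ MulAction.orbit H x ∧ z ≠ x} + 1 = (MulAction.orbit H x).ncard := by
    have := Set.ncard_sdiff_singleton_add_one (MulAction.mem_orbit_self (M := H) x)
    rw [← this]
    rfl
  rw [e2, ← e1] at h2
  exact (Fact.out : p.Prime).one_lt.ne' (Nat.dvd_one.mp ((Nat.dvd_add_right h1).mp h2))

theorem odd_card_T [Finite H] [Fact p.Prime] (hp : p ≠ 2) {x : X} (hx : D.iso x) :
    Odd (Nat.card (D.T x)) := by
  obtain ⟨k, hk⟩ := IsPGroup.iff_card.mp (D.pGroup x hx)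
  rw [hk]
  exact ((Fact.out : p.Prime).odd_of_ne_two hp).pow

/-- T y acts by conjugation on the nontrivial elements u of T x, and the action is free. If u
commutes with a nontrivial element of T y, it fixes y and lies outside T y; then u² lies in T x and
T y and is trivial, while |T x| is odd. -/
theorem card_torus_dvd [Finite H] [Fact p.Prime] (hp : p ≠ 2) {x y : X} (hx : D.iso x)
    (hy : ¬ D.iso y) (hyx : D.T y ≤ MulAction.stabilizer H x) :
    Nat.card (D.T y) ∣ Nat.card (D.T x) - 1 := by
  classical
  have := Fintype.ofFinite H
  let _ : MulAction (D.T y) H := MulAction.compHom H (MulAut.conj.comp (D.T y).subtype)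
  let S : SubMulAction (D.T y) H :=
    { carrier := {u | u ∈ D.T x ∧ u ≠ 1}
      smul_mem' := by
        rintro ⟨g, hg⟩ u ⟨hu, hu1⟩
        change g * u * g⁻¹ ∈ D.T x ∧ g * u * g⁻¹ ≠ 1
        refine ⟨?_, fun h => hu1 (conj_eq_one_iff.mp h)⟩
        have h1 := D.conj_mem x g u hu
        rwa [show g • x = x from hyx hg] at h1 }
  have hS : Nat.card S = Nat.card (D.T x) - 1 := by
    change Nat.card {u | u ∈ D.T x ∧ u ≠ 1} = _
    have h1 := Set.ncard_sdiff_singleton_add_one (s := (D.T x : Set H)) (D.T x).one_mem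
    have h2 : Set.ncard (D.T x : Set H) = Nat.card (D.T x) := rfl
    rw [← h2, ← h1, Nat.add_sub_cancel]
    rfl
  rw [← hS]
  refine card_dvd_of_free ?_
  rintro ⟨h, hh⟩ ⟨u, hu, hu1⟩ hhu
  have hhu' : h * u * h⁻¹ = u := congrArg Subtype.val hhu
  by_contra hne
  have hne' : h ≠ 1 := fun e => hne (Subtype.ext e)
  have hc : u * h * u⁻¹ = h := by
    rw [mul_inv_eq_iff_eq_mul] at hhu' ⊢
    exact hhu'.symm
  have huy : u • y = y := by
    have h1 := D.conj_mem y u h hh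
    rw [hc] at h1
    exact D.unique _ _ h hne' h1 hh
  have hxy : ∀ g, g ≠ 1 → g ∈ D.T x → g ∈ D.T y → False := fun g h1 h2 h3 =>
    hy (D.unique x y g h1 h2 h3 ▸ hx)
  have huT : u ∉ D.T y := fun h => hxy u hu1 hu h
  have huu : u * u = 1 := by
    by_contra h1
    exact hxy _ h1 ((D.T x).mul_mem hu hu) (D.mul_mem y u u hy huy huy huT huT)
  have ho : orderOf u = 2 := orderOf_eq_prime (by rw [pow_two, huu]) hu1
  have hd : orderOf u ∣ Nat.card (D.T x) := by
    have := orderOf_dvd_natCard (⟨u, hu⟩ : D.T x)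
    rwa [Subgroup.orderOf_mk] at this
  rw [ho] at hd
  exact (Nat.not_even_iff_odd.mpr (D.odd_card_T hp hx)) (even_iff_two_dvd.mpr hd)

/-- Writing s = 1 + kQ and q = Q - 2 turns the class equation into e(1 + k(q + 2)) = f(1 + kq).
Hence 1 + kq divides 2e, which is at most 2(q + 1), so k ≤ 3. The case k = 1 is the conclusion, and
k = 2 contradicts the divisibility. The case k = 3 leaves Q = 3, e = 2, f = 5, the numbers of
Alt(5), which n ≥ 6 excludes. -/
theorem eq_of_orbit_equation {Q e f s n : ℕ} (hQ : 3 ≤ Q) (hQo : Odd Q) (he : 2 ≤ e)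
    (heQ : e ∣ Q - 1) (hs : 1 < s) (hsQ : Q ∣ s - 1) (hf : 0 < f)
    (heq : (1 : ℚ) / f = 1 / e - 2 * (1 / (Q * e)) + 2 * (1 / (Q * e * s)))
    (hn : n = e ∨ n = f) (h6 : 6 ≤ n) :
    s = Q + 1 ∧ ∃ d, (d = 1 ∨ d = 2) ∧ e * d = Q - 1 ∧ f * d = Q + 1 := by
  obtain ⟨k, hk⟩ := hsQ
  obtain ⟨q, rfl⟩ : ∃ q, Q = q + 2 := ⟨Q - 2, by omega⟩
  have hs' : s = 1 + k * (q + 2) := by rw [mul_comm k, ← hk]; omega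
  have hk0 : 0 < k := by
    rcases Nat.eq_zero_or_pos k with rfl | h
    · omega
    · exact h
  obtain ⟨d, hd⟩ := heQ
  rw [show q + 2 - 1 = q + 1 by omega] at hd
  have h1 : e * (1 + k * (q + 2)) = f * (1 + k * q) := by
    have hQ' : ((q + 2 : ℕ) : ℚ) ≠ 0 := by positivity
    have he' : (e : ℚ) ≠ 0 := by positivity
    have hf' : (f : ℚ) ≠ 0 := by positivity
    have hs'' : (s : ℚ) ≠ 0 := by positivity
    have h2 : ((q + 2 : ℕ) : ℚ) * e * s = f * (((q + 2 : ℕ) : ℚ) * s - 2 * s + 2) := by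
      field_simp at heq
      linear_combination heq
    have h3 : ((q + 2 : ℕ) : ℚ) * (e * (1 + k * (q + 2))) = ((q + 2 : ℕ) : ℚ) * (f * (1 + k * q)) := by
      rw [hs'] at h2
      push_cast at h2 ⊢
      linear_combination h2
    have := mul_left_cancel₀ hQ' h3
    exact_mod_cast this
  have hdvd : 1 + k * q ∣ 2 * e := by
    have h2 : 1 + k * q ∣ e * (1 + k * q) + k * (2 * e) := by
      rw [show e * (1 + k * q) + k * (2 * e) = e * (1 + k * (q + 2)) by ring, h1]
      exact dvd_mul_left _ _
    have h3 := (Nat.dvd_add_right (dvd_mul_left (1 + k * q) e)).mp h2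
    refine Nat.Coprime.dvd_of_dvd_mul_left ?_ h3
    simp
  have hle := Nat.le_of_dvd (by omega) hdvd
  have hd0 : 0 < d := by
    rcases Nat.eq_zero_or_pos d with rfl | h
    · omega
    · exact h
  have heq1 : e ≤ q + 1 := by rw [hd]; exact Nat.le_mul_of_pos_right _ hd0
  have hk3 : k ≤ 3 := by
    by_contra! h
    have : 4 * q ≤ k * q := Nat.mul_le_mul_right _ h
    omega
  have hqo : Odd q := by
    rw [Nat.odd_add] at hQo
    exact hQo.mpr even_two
  interval_cases k
  · refine ⟨by omega, d, ?_, by omega, ?_⟩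
    · have h2 : e * (q + 3) = e * (f * d) := by
        rw [show e * (q + 3) = e * (1 + 1 * (q + 2)) by ring, h1, show 1 + 1 * q = e * d by omega]
        ring
      have h3 := Nat.eq_of_mul_eq_mul_left (by omega) h2
      have h4 : d ∣ 2 := by
        rw [show q + 3 = q + 1 + 2 by omega, hd] at h3
        exact (Nat.dvd_add_right (dvd_mul_left d e)).mp (h3 ▸ dvd_mul_left d f)
      exact (Nat.dvd_prime Nat.prime_two).mp h4
    · have h2 : e * (q + 3) = e * (f * d) := by
        rw [show e * (q + 3) = e * (1 + 1 * (q + 2)) by ring, h1, show 1 + 1 * q = e * d by omega]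
        ring
      have h3 := Nat.eq_of_mul_eq_mul_left (by omega) h2
      omega
  · have h2 : 1 + 2 * q ∣ e := by
      refine Nat.Coprime.dvd_of_dvd_mul_left ?_ hdvd
      simp
    have := Nat.le_of_dvd (by omega) h2
    omega
  · have hq1 : q = 1 := by omega
    subst hq1
    have : e = 2 := by omega
    subst this
    omega

/-- The numerical form of Dickson's list for groups with a large torus and a rotation about an
isotropic point. -/
theorem card_eq [Finite H] [Fintype X] [Fact p.Prime] (hp : p ≠ 2) {x₀ x₁ : X} (h0 : ¬ D.iso x₀)
    (hn : 6 ≤ Nat.card (D.T x₀)) (hs : MulAction.stabilizer H x₀ ≠ D.T x₀)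
    (ht : MulAction.stabilizer H x₀ ≠ ⊤) (h1 : D.iso x₁) (hT : 2 ≤ Nat.card (D.T x₁)) :
    ∃ e f d : ℕ, (d = 1 ∨ d = 2) ∧ e * d = Nat.card (D.T x₁) - 1 ∧ f * d = Nat.card (D.T x₁) + 1 ∧
      Nat.card H = Nat.card (D.T x₁) * e * (Nat.card (D.T x₁) + 1) ∧
      (Nat.card (D.T x₀) = e ∨ Nat.card (D.T x₀) = f) := by
  have hQo := D.odd_card_T hp h1
  have hQ : 3 ≤ Nat.card (D.T x₁) := by
    rcases hQo with ⟨k, hk⟩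
    omega
  have hni : ∀ {A : Finset X}, x₁ ∈ A → Inv H A → ∀ x ∉ A, 2 ≤ Nat.card (D.T x) → ¬ D.iso x := by
    intro A hA hI x hx h2 hxi
    obtain ⟨g, rfl⟩ := D.mem_orbit_of_iso h1 hxi hT h2
    exact hx (hI g _ hA)
  have hNp : (0 : ℚ) < 1 / Nat.card H := one_div_pos.mpr (by exact_mod_cast Nat.card_pos)
  obtain ⟨A, hA, -, memA, eA⟩ := D.exists_inv_union inv_empty (Finset.notMem_empty x₁)
  have hx1A : x₁ ∈ A := (memA _).mpr (Or.inr (MulAction.mem_orbit_self _))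
  rw [D.share_empty, zero_add] at eA
  have hx0A : x₀ ∉ A := by
    intro h
    rcases (memA _).mp h with h | ⟨g, rfl⟩
    · exact absurd h (Finset.notMem_empty _)
    · exact h0 (D.iso_smul _ g h1)
  have hb := D.inv_card_le (by norm_num) hn
  have hbp := D.inv_card_pos x₀
  have hQi := D.inv_card_le (by norm_num) hQ
  push_cast at hb hQi
  -- Otherwise x₁ has weight at least 2/3, and adding the weight at least 5/12 of x₀ exceeds the
  -- total.
  have hst : MulAction.stabilizer H x₁ ≠ D.T x₁ := by
    intro he
    rw [D.weight_noniso' he] at eA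
    obtain ⟨B, hB, -, -, eB⟩ := D.exists_inv_union hA hx0A
    have := D.share_le B
    rw [D.weight_noniso h0 hs] at eB
    linarith
  obtain ⟨y, hy, hyx, hyc⟩ := D.torus x₁ h1 hst
  have heQ := D.card_torus_dvd hp h1 hy hyx
  set Q := Nat.card (D.T x₁) with hQdef
  set e := Nat.card (D.T y) with hedef
  have he0 : 0 < e := Nat.card_pos
  have he2 : 2 ≤ e := by
    by_contra! h
    apply hst
    symm
    apply Subgroup.eq_of_le_of_card_ge (D.le_stab x₁)
    rw [← hyc, ← hQdef, show e = 1 by omega, one_mul]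
  have hQpos : (0 : ℚ) < Q := by exact_mod_cast (show 0 < Q by omega)
  have hepos : (0 : ℚ) < e := by exact_mod_cast he0
  have hw : D.weight x₁ = 1 / e - 1 / (Q * e) := by
    rw [weight, ← hyc, ← hQdef]
    push_cast
    field_simp
  rw [hw] at eA
  have hae := D.inv_card_le two_pos he2
  have haep := D.inv_card_pos y
  rw [← hedef] at hae haep
  push_cast at hae
  have hc0 : (0 : ℚ) < 1 / (Q * e) := by positivity
  have hc3 : (1 : ℚ) / (Q * e) ≤ 1 / e / 3 := by
    have h3 : (1 : ℚ) / (Q * e) = 1 / e * (1 / Q) := by field_simp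
    have h4 : (1 : ℚ) / e * (1 / Q) ≤ 1 / e * (1 / 3) := mul_le_mul_of_nonneg_left hQi haep.le
    linarith
  have hNc : (1 : ℚ) / Nat.card H ≤ 1 / (Q * e) / 2 := by
    have := card_stabilizer_le (D.not_fixed x₁ h1)
    rw [← hyc] at this
    rw [div_div]
    refine one_div_le_one_div_of_le (by positivity) ?_
    have h' : ((2 * (e * Q) : ℕ) : ℚ) ≤ Nat.card H := by exact_mod_cast this
    push_cast at h'
    linarith
  have hyA : y ∉ A := by
    intro h
    rcases (memA _).mp h with h | ⟨g, rfl⟩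
    · exact absurd h (Finset.notMem_empty _)
    · exact hy (D.iso_smul _ g h1)
  obtain ⟨B, hB, hAB, memB, eB⟩ := D.exists_inv_union hA hyA
  have hys : MulAction.stabilizer H y ≠ D.T y := by
    intro h
    rw [D.weight_noniso' h, ← hedef, eA] at eB
    obtain ⟨z, hzB, hz⟩ := D.exists_of_share_lt (A := B) (by rw [eB]; linarith)
    obtain ⟨C, -, -, -, eC⟩ := D.exists_inv_union hB hzB
    have := D.weight_noniso_ge (hni (hAB hx1A) hB z hzB hz) hz
    have hCle := D.share_le C
    linarith
  rw [D.weight_noniso hy hys, ← hedef, eA] at eB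
  -- There are exactly three orbits of axes: those of x₁ and y and a third one with f rotations
  -- about each axis. A fourth, of weight at least 1/4, would exceed the total. The point x₀ lies in
  -- the orbit of y or in the third.
  have key : ∃ f : ℕ, 0 < f ∧ (1 : ℚ) / f = 1 / e - 2 * (1 / (Q * e)) + 2 * (1 / Nat.card H) ∧
      (Nat.card (D.T x₀) = e ∨ Nat.card (D.T x₀) = f) := by
    have fin : ∀ C : Finset X, Inv H C → x₁ ∈ C → ∀ f : ℕ, 2 ≤ f →
        D.share C = 1 + 1 / e / 2 - 1 / (Q * e) - 1 / f / 2 →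
        (1 : ℚ) / f = 1 / e - 2 * (1 / (Q * e)) + 2 * (1 / Nat.card H) := by
      intro C hC hxC f hf eC
      have hf' : (1 : ℚ) / f ≤ 1 / 2 :=
        one_div_le_one_div_of_le (by norm_num) (by exact_mod_cast hf)
      rcases (D.share_le C).lt_or_eq with h | h
      · obtain ⟨z, hzC, hz⟩ := D.exists_of_share_lt h
        obtain ⟨E, -, -, -, eE⟩ := D.exists_inv_union hC hzC
        have := D.weight_noniso_ge (hni hxC hC z hzC hz) hz
        have hEle := D.share_le E
        linarith
      · linarith
    by_cases hx0B : x₀ ∈ B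
    · have hne : Nat.card (D.T x₀) = e := by
        rcases (memB _).mp hx0B with h | ⟨g, rfl⟩
        · exact absurd h hx0A
        · exact D.card_T_smul y g
      rw [hne] at hb
      obtain ⟨z, hzB, hz⟩ := D.exists_of_share_lt (A := B) (by rw [eB]; linarith)
      obtain ⟨C, hC, hBC, -, eC⟩ := D.exists_inv_union hB hzB
      have hzi := hni (hAB hx1A) hB z hzB hz
      have hCle := D.share_le C
      have hz2 := D.inv_card_le two_pos hz
      push_cast at hz2
      have hzs : MulAction.stabilizer H z ≠ D.T z := by
        intro h
        rw [D.weight_noniso' h, eB] at eC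
        linarith
      rw [D.weight_noniso hzi hzs, eB] at eC
      exact ⟨_, by omega, fin C hC (hBC (hAB hx1A)) _ hz (by rw [eC]; ring), Or.inl hne⟩
    · obtain ⟨C, hC, hBC, -, eC⟩ := D.exists_inv_union hB hx0B
      rw [D.weight_noniso h0 hs, eB] at eC
      exact ⟨_, by omega, fin C hC (hBC (hAB hx1A)) _ (by omega) (by rw [eC]; ring), Or.inr rfl⟩
  obtain ⟨f, hf, heq, hnf⟩ := key
  have hcard : Nat.card H = Q * e * (MulAction.orbit H x₁).ncard := by
    have h2 := (MulAction.stabilizer H x₁).card_mul_index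
    rw [MulAction.index_stabilizer, ← hyc] at h2
    rw [← h2, mul_comm Q e]
  have hs1 : 1 < (MulAction.orbit H x₁).ncard := by
    by_contra! h
    have := card_stabilizer_le (D.not_fixed x₁ h1)
    rw [← hyc, hcard, mul_comm e] at this
    have h3 : Q * e * (MulAction.orbit H x₁).ncard ≤ Q * e * 1 := Nat.mul_le_mul_left _ h
    have h4 : 0 < Q * e := by positivity
    omega
  have hsQ : Q ∣ (MulAction.orbit H x₁).ncard - 1 := by
    have h2 := D.card_dvd_orbit_diff h1 h1
    have h3 := Set.ncard_sdiff_singleton_add_one (MulAction.mem_orbit_self (M := H) x₁)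
    rw [← h3, Nat.add_sub_cancel]
    exact h2
  rw [hcard] at heq
  push_cast at heq
  obtain ⟨hsq, d, hd, h3, h4⟩ := eq_of_orbit_equation hQ hQo he2 heQ hs1 hsQ hf heq hnf hn
  exact ⟨e, f, d, hd, h3, h4, by rw [hcard, hsq], hnf⟩

end RotationGroup

/-! ### Rotations of a three-dimensional space and half-turns. -/

namespace Rotation

variable {K : Type*} [Field K]

/-- A matrix of determinant `1` with `Aᵀ * A = 1`, as a rotation. -/
def mk (A : Matrix (Fin 3) (Fin 3) K) (h : Aᵀ * A = 1) (hd : A.det = 1) : SO3 K :=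
  ⟨A, mem_specialOrthogonalGroup_iff.mpr ⟨(mem_orthogonalGroup_iff' (Fin 3) K).mpr h, hd⟩⟩

theorem transpose_mul_self (h : SO3 K) : (h.1)ᵀ * h.1 = 1 :=
  (mem_orthogonalGroup_iff' (Fin 3) K).mp (mem_specialOrthogonalGroup_iff.mp h.2).1

theorem mul_transpose_self (h : SO3 K) : h.1 * (h.1)ᵀ = 1 :=
  (mem_orthogonalGroup_iff (Fin 3) K).mp (mem_specialOrthogonalGroup_iff.mp h.2).1

theorem det_eq_one (h : SO3 K) : h.1.det = 1 := (mem_specialOrthogonalGroup_iff.mp h.2).2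

instance : DistribMulAction (SO3 K) (Fin 3 → K) where
  smul h u := h.1 *ᵥ u
  one_smul u := one_mulVec u
  mul_smul g h u := (mulVec_mulVec u g.1 h.1).symm
  smul_zero h := mulVec_zero h.1
  smul_add h := mulVec_add h.1

theorem smul_def (h : SO3 K) (u : Fin 3 → K) : h • u = h.1 *ᵥ u := rfl

instance : SMulCommClass (SO3 K) K (Fin 3 → K) where
  smul_comm h c u := mulVec_smul h.1 c u

theorem ext_smul {g h : SO3 K} (e : ∀ u : Fin 3 → K, g • u = h • u) : g = h :=
  Subtype.ext (by
    apply (Matrix.toLin' (R := K)).injective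
    exact LinearMap.ext e)

theorem dotProduct_smul_smul (h : SO3 K) (u w : Fin 3 → K) : (h • u) ⬝ᵥ (h • w) = u ⬝ᵥ w := by
  rw [smul_def, smul_def, dotProduct_mulVec, vecMul_mulVec, transpose_mul_self h, vecMul_one]

theorem cross_mulVec (A : Matrix (Fin 3) (Fin 3) K) (u w : Fin 3 → K) :
    (A *ᵥ u) ⨯₃ (A *ᵥ w) = A.adjugateᵀ *ᵥ (u ⨯₃ w) := by
  ext i
  rw [adjugate_fin_three]
  fin_cases i <;>
    simp [cross_apply, mulVec, dotProduct, Fin.sum_univ_three] <;> ring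

theorem adjugate_eq_transpose (h : SO3 K) : h.1.adjugate = (h.1)ᵀ := by
  have h1 : h.1.adjugate * h.1 = 1 := by rw [adjugate_mul, det_eq_one, one_smul]
  calc h.1.adjugate = h.1.adjugate * (h.1 * (h.1)ᵀ) := by rw [mul_transpose_self, mul_one]
    _ = (h.1)ᵀ := by rw [← mul_assoc, h1, one_mul]

theorem cross_smul_smul (h : SO3 K) (u w : Fin 3 → K) : (h • u) ⨯₃ (h • w) = h • (u ⨯₃ w) := by
  rw [smul_def, smul_def, cross_mulVec, adjugate_eq_transpose, transpose_transpose]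
  rfl

/-- In odd dimension det (h - 1) = det (h(1 - hᵀ)) = -det (h - 1). -/
theorem exists_fixed (h2 : (2 : K) ≠ 0) (h : SO3 K) : ∃ u : Fin 3 → K, u ≠ 0 ∧ h • u = u := by
  have hd : (h.1 - 1).det = 0 := by
    have h1 : (h.1 - 1).det = -(h.1 - 1).det := by
      calc (h.1 - 1).det = (h.1 * (1 - h.1)ᵀ).det := by
            rw [transpose_sub, transpose_one, mul_sub, mul_one, mul_transpose_self]
        _ = (-(h.1 - 1)).det := by rw [det_mul, det_eq_one, one_mul, det_transpose, neg_sub]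
        _ = -(h.1 - 1).det := by rw [det_neg]; simp; ring
    have h3 : 2 * (h.1 - 1).det = 0 := by linear_combination h1
    exact (mul_eq_zero.mp h3).resolve_left h2
  obtain ⟨u, hu, hu'⟩ := exists_mulVec_eq_zero_iff.mpr hd
  refine ⟨u, hu, ?_⟩
  rw [sub_mulVec, one_mulVec, sub_eq_zero] at hu'
  exact hu'

theorem exists_dotProduct_ne_zero {n : Fin 3 → K} (hn : n ≠ 0) : ∃ w : Fin 3 → K, n ⬝ᵥ w ≠ 0 := by
  by_contra! h
  exact hn (dotProduct_eq_zero _ h)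

/-- The normal n = u × w is fixed as well, and h z - z is orthogonal to u and w, so h z = z + cn.
Comparing the products z·z and n·z gives 2(n·z)c = 0. This also covers isotropic n. -/
theorem eq_one_of_fixed (h2 : (2 : K) ≠ 0) {h : SO3 K} {u w : Fin 3 → K} (huw : u ⨯₃ w ≠ 0)
    (hu : h • u = u) (hw : h • w = w) : h = 1 := by
  have hn : h • (u ⨯₃ w) = u ⨯₃ w := by rw [← cross_smul_smul, hu, hw]
  have key : ∀ z, (u ⨯₃ w) ⬝ᵥ z ≠ 0 → h • z = z := by
    intro z hz
    obtain ⟨c, hc⟩ := Homology.exists_smul_cross (d := h • z - z) huw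
      (by rw [dotProduct_sub, sub_eq_zero]; nth_rw 1 [← hu]; exact dotProduct_smul_smul h u z)
      (by rw [dotProduct_sub, sub_eq_zero]; nth_rw 1 [← hw]; exact dotProduct_smul_smul h w z)
    have e1 : h • z = z + c • (u ⨯₃ w) := by rw [← hc]; abel
    have e2 := dotProduct_smul_smul h z z
    have e3 := dotProduct_smul_smul h (u ⨯₃ w) z
    rw [hn, e1, dotProduct_add, dotProduct_smul, smul_eq_mul] at e3
    rw [e1, add_dotProduct, dotProduct_add, dotProduct_add, smul_dotProduct, smul_dotProduct,
      dotProduct_smul, dotProduct_smul, dotProduct_comm z (u ⨯₃ w)] at e2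
    simp only [smul_eq_mul] at e2
    have e4 : 2 * ((u ⨯₃ w) ⬝ᵥ z) * c = 0 := by linear_combination e2 - c * e3
    have hc0 := (mul_eq_zero.mp e4).resolve_left (mul_ne_zero h2 hz)
    rw [e1, hc0, zero_smul, add_zero]
  obtain ⟨w0, hw0⟩ := exists_dotProduct_ne_zero huw
  apply ext_smul
  intro z
  rw [one_smul]
  by_cases hz : (u ⨯₃ w) ⬝ᵥ z = 0
  · have h1 := key (z + w0) (by rw [dotProduct_add, hz, zero_add]; exact hw0)
    rw [smul_add, key w0 hw0] at h1
    exact add_right_cancel h1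
  · exact key z hz

section Isotropic

theorem cross_isotropic {f w : Fin 3 → K} (hf0 : f ≠ 0) (hf : f ⬝ᵥ f = 0) (hw : f ⬝ᵥ w = 0) :
    ∃ κ : K, f ⨯₃ w = κ • f := by
  apply Homology.exists_smul_of_cross_eq_zero hf0
  rw [cross_cross_eq_smul_sub_smul', hf, hw]
  simp

theorem parallel_of_isotropic {f g : Fin 3 → K} (hf0 : f ≠ 0) (hg0 : g ≠ 0) (hf : f ⬝ᵥ f = 0)
    (hg : g ⬝ᵥ g = 0) (h : f ⬝ᵥ g = 0) : ∃ c : K, g = c • f := by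
  obtain ⟨κ, hκ⟩ := cross_isotropic hf0 hf h
  obtain ⟨μ, hμ⟩ := cross_isotropic hg0 hg (dotProduct_comm f g ▸ h)
  apply Homology.exists_smul_of_cross_eq_zero hf0
  by_cases hκ0 : κ = 0
  · rw [hκ, hκ0, zero_smul]
  · have e : κ • f + μ • g = 0 := by rw [← hκ, ← hμ, cross_anticomm']
    have e2 : f = (-(κ⁻¹ * μ)) • g := by
      have := congrArg (κ⁻¹ • ·) e
      simp only [smul_add, smul_smul, inv_mul_cancel₀ hκ0, one_smul, smul_zero] at this
      rw [neg_smul]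
      exact eq_neg_of_add_eq_zero_left this
    rw [e2, LinearMap.map_smul, LinearMap.smul_apply, cross_self, smul_zero]

/-- The map h - 1 sends the whole space into the plane orthogonal to f, that plane into the line of
f, and f to 0. -/
theorem sub_one_cubed {h : SO3 K} {f : Fin 3 → K} (hf0 : f ≠ 0) (hf : f ⬝ᵥ f = 0)
    (hh : h • f = f) : (h.1 - 1) ^ 3 = 0 := by
  have hs : ∀ u : Fin 3 → K, (h.1 - 1) *ᵥ u = h • u - u := fun u => by
    rw [sub_mulVec, one_mulVec, smul_def]
  have h1 : ∀ u : Fin 3 → K, f ⬝ᵥ (h • u - u) = 0 := by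
    intro u
    rw [dotProduct_sub, sub_eq_zero]
    nth_rw 1 [← hh]
    exact dotProduct_smul_smul h f u
  have h3 : ∀ u : Fin 3 → K, f ⬝ᵥ u = 0 → ∃ c : K, h • u - u = c • f := by
    intro u hu
    apply Homology.exists_smul_of_cross_eq_zero hf0
    obtain ⟨κ, hκ⟩ := cross_isotropic hf0 hf hu
    have e := cross_smul_smul h f u
    rw [hh, hκ, smul_comm, hh] at e
    rw [LinearMap.map_sub, e, hκ, sub_self]
  have h4 : ∀ u : Fin 3 → K, (h.1 - 1) ^ 3 *ᵥ u = 0 := by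
    intro u
    rw [pow_succ, pow_two, ← mulVec_mulVec, ← mulVec_mulVec, hs u]
    obtain ⟨c, hc⟩ := h3 _ (h1 u)
    rw [hs (h • u - u), hc, mulVec_smul, hs, hh, sub_self, smul_zero]
  apply (Matrix.toLin' (R := K)).injective
  rw [map_zero]
  exact LinearMap.ext h4

theorem pow_char_eq_one (p : ℕ) [Fact p.Prime] [CharP K p] (hp : p ≠ 2) {h : SO3 K} {f : Fin 3 → K}
    (hf0 : f ≠ 0) (hf : f ⬝ᵥ f = 0) (hh : h • f = f) : h ^ p = 1 := by
  have hp3 : 3 ≤ p := by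
    have := (Fact.out : p.Prime).two_le
    omega
  have e4 := pow_eq_zero_of_le hp3 (sub_one_cubed hf0 hf hh)
  rw [sub_pow_char_of_commute p (Commute.one_right _), one_pow] at e4
  exact Subtype.ext (sub_eq_zero.mp e4)

end Isotropic

section HalfTurn

/-- The half-turn about a nonisotropic vector. -/
def halfTurn (u : Fin 3 → K) (hu : u ⬝ᵥ u ≠ 0) : SO3 K :=
  mk (Homology.refl u ((u ⬝ᵥ u)⁻¹ • u)) (by
    have hp : ((u ⬝ᵥ u)⁻¹ • u) ⬝ᵥ u = 1 := by
      rw [smul_dotProduct, smul_eq_mul, inv_mul_cancel₀ hu]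
    have ht : (Homology.refl u ((u ⬝ᵥ u)⁻¹ • u))ᵀ = Homology.refl u ((u ⬝ᵥ u)⁻¹ • u) := by
      rw [Homology.refl, transpose_sub, transpose_smul, transpose_one, transpose_vecMulVec,
        vecMulVec_smul, smul_vecMulVec]
    rw [ht, Homology.refl_mul_self hp]) (by
    apply Homology.det_refl
    rw [smul_dotProduct, smul_eq_mul, inv_mul_cancel₀ hu])

theorem halfTurn_smul (u : Fin 3 → K) (hu : u ⬝ᵥ u ≠ 0) (w : Fin 3 → K) :
    halfTurn u hu • w = (2 * ((u ⬝ᵥ u)⁻¹ * (u ⬝ᵥ w))) • u - w := by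
  refine (Homology.refl_mulVec u ((u ⬝ᵥ u)⁻¹ • u) w).trans ?_
  rw [smul_dotProduct, smul_eq_mul]

theorem halfTurn_smul_self (u : Fin 3 → K) (hu : u ⬝ᵥ u ≠ 0) : halfTurn u hu • u = u := by
  rw [halfTurn_smul, inv_mul_cancel₀ hu]
  module

theorem halfTurn_smul_of_orthogonal {u : Fin 3 → K} (hu : u ⬝ᵥ u ≠ 0) {w : Fin 3 → K}
    (hw : u ⬝ᵥ w = 0) : halfTurn u hu • w = -w := by
  rw [halfTurn_smul, hw]
  module

theorem halfTurn_mul_self (u : Fin 3 → K) (hu : u ⬝ᵥ u ≠ 0) : halfTurn u hu * halfTurn u hu = 1 := by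
  apply ext_smul
  intro w
  rw [mul_smul, halfTurn_smul u hu w, smul_sub, smul_comm, halfTurn_smul_self, halfTurn_smul, one_smul]
  abel

theorem halfTurn_ne_one (h2 : (2 : K) ≠ 0) (u : Fin 3 → K) (hu : u ⬝ᵥ u ≠ 0) : halfTurn u hu ≠ 1 :=
  fun e => Homology.refl_ne_one h2 u ((u ⬝ᵥ u)⁻¹ • u) (congrArg Subtype.val e)

theorem halfTurn_conj (g : SO3 K) (u : Fin 3 → K) (hu : u ⬝ᵥ u ≠ 0) (hu' : (g • u) ⬝ᵥ (g • u) ≠ 0) :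
    g * halfTurn u hu * g⁻¹ = halfTurn (g • u) hu' := by
  apply ext_smul
  intro w
  obtain ⟨w, rfl⟩ : ∃ z : Fin 3 → K, w = g • z := ⟨g⁻¹ • w, (smul_inv_smul g w).symm⟩
  rw [mul_smul, mul_smul, inv_smul_smul, halfTurn_smul, halfTurn_smul, dotProduct_smul_smul,
    dotProduct_smul_smul, smul_sub, smul_comm]

theorem halfTurn_smul_vec {c : K} {u : Fin 3 → K} (hu : u ⬝ᵥ u ≠ 0)
    (hcu : (c • u) ⬝ᵥ (c • u) ≠ 0) : halfTurn (c • u) hcu = halfTurn u hu := by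
  have hc : c ≠ 0 := by
    rintro rfl
    simp at hcu
  apply ext_smul
  intro w
  rw [halfTurn_smul, halfTurn_smul]
  simp only [smul_dotProduct, dotProduct_smul, smul_eq_mul, smul_smul]
  congr 2
  field_simp

end HalfTurn

end Rotation

/-! ### Rotation groups acting on points of the projective plane. -/

namespace Rotation

variable {K : Type*} [Field K] {H : Subgroup (SO3 K)}

theorem smul_mk (h : H) {v : Fin 3 → K} (hv : v ≠ 0) : h • Projectivization.mk K v hv =
    Projectivization.mk K (h.1 • v) ((smul_ne_zero_iff_ne h.1).mpr hv) := rfl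

theorem smul_eq_of_parallel {g : SO3 K} {w f : Fin 3 → K} {c : K} (hc : f = c • w)
    (hw : g • w = w) : g • f = f := by
  rw [hc, smul_comm, hw]

theorem smul_mk_eq_iff (h : H) {v : Fin 3 → K} (hv : v ≠ 0) :
    h • Projectivization.mk K v hv = Projectivization.mk K v hv ↔ ∃ c : K, h.1 • v = c • v := by
  rw [smul_mk, Projectivization.mk_eq_mk_iff']
  exact ⟨fun ⟨c, hc⟩ => ⟨c, hc.symm⟩, fun ⟨c, hc⟩ => ⟨c, hc.symm⟩⟩

theorem mk_eq_mk_of_cross {u v : Fin 3 → K} (hu : u ≠ 0) (hv : v ≠ 0) (h : u ⨯₃ v = 0) :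
    Projectivization.mk K u hu = Projectivization.mk K v hv := by
  obtain ⟨c, hc⟩ := Homology.exists_smul_of_cross_eq_zero hu h
  symm
  rw [Projectivization.mk_eq_mk_iff']
  exact ⟨c, hc.symm⟩

/-- The rotations in `H` about the point `x`. -/
noncomputable def rotations (H : Subgroup (SO3 K)) (x : ℙ K (Fin 3 → K)) : Subgroup H :=
  MulAction.stabilizer H x.rep

theorem mem_rotations_mk {h : H} {v : Fin 3 → K} {hv : v ≠ 0} :
    h ∈ rotations H (Projectivization.mk K v hv) ↔ h.1 • v = v := by
  obtain ⟨a, ha⟩ := Projectivization.exists_smul_eq_mk_rep K v hv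
  rw [rotations, MulAction.mem_stabilizer_iff, ← ha]
  change h.1 • (a : K) • v = (a : K) • v ↔ _
  rw [smul_comm]
  exact (smul_right_injective _ a.ne_zero).eq_iff

/-- The isotropic points. -/
def isotropic (x : ℙ K (Fin 3 → K)) : Prop := x.rep ⬝ᵥ x.rep = 0

theorem isotropic_mk {v : Fin 3 → K} {hv : v ≠ 0} :
    isotropic (Projectivization.mk K v hv) ↔ v ⬝ᵥ v = 0 := by
  obtain ⟨a, ha⟩ := Projectivization.exists_smul_eq_mk_rep K v hv
  rw [isotropic, ← ha]
  change ((a : K) • v) ⬝ᵥ ((a : K) • v) = 0 ↔ _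
  simp [smul_dotProduct, dotProduct_smul]

/-- The eigenvalue of an element that fixes a point. -/
noncomputable def eigenvalue (H : Subgroup (SO3 K)) {f : Fin 3 → K} (hf : f ≠ 0) :
    MulAction.stabilizer H (Projectivization.mk K f hf) →* K where
  toFun h := ((smul_mk_eq_iff h.1 hf).mp h.2).choose
  map_one' := by
    have h := ((smul_mk_eq_iff (1 : H) hf).mp (one_smul _ _)).choose_spec
    have h' : f = _ • f := (one_smul (SO3 K) f).symm.trans h
    apply smul_left_injective K hf
    simp only [one_smul]
    exact h'.symm
  map_mul' g h := by
    have h1 := ((smul_mk_eq_iff g.1 hf).mp g.2).choose_spec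
    have h2 := ((smul_mk_eq_iff h.1 hf).mp h.2).choose_spec
    have h3 := ((smul_mk_eq_iff (g * h).1 hf).mp (g * h).2).choose_spec
    have key : ∀ (g h : SO3 K) (a b c : K), g • f = a • f → h • f = b • f → (g * h) • f = c • f →
        c = a * b := by
      intro g h a b c e1 e2 e3
      rw [mul_smul, e2, smul_comm, e1, smul_smul] at e3
      rw [mul_comm]
      exact (smul_left_injective K hf e3).symm
    exact key _ _ _ _ _ h1 h2 h3

theorem eigenvalue_spec {f : Fin 3 → K} (hf : f ≠ 0)
    (h : MulAction.stabilizer H (Projectivization.mk K f hf)) :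
    h.1.1 • f = eigenvalue H hf h • f :=
  ((smul_mk_eq_iff h.1 hf).mp h.2).choose_spec

theorem eigenvalue_eq_one_iff {f : Fin 3 → K} (hf : f ≠ 0)
    (h : MulAction.stabilizer H (Projectivization.mk K f hf)) :
    eigenvalue H hf h = 1 ↔ h.1.1 • f = f := by
  rw [eigenvalue_spec hf h]
  constructor
  · intro h1; rw [h1, one_smul]
  · intro h1
    apply smul_left_injective K hf
    simp only [one_smul]
    exact h1

theorem eq_of_isotropic_fixed (h2 : (2 : K) ≠ 0) {f g : Fin 3 → K} (hf0 : f ≠ 0) (hg0 : g ≠ 0)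
    (hf : f ⬝ᵥ f = 0) (hg : g ⬝ᵥ g = 0) {h : SO3 K} (h1 : h ≠ 1) (hhf : h • f = f) {c : K}
    (hhg : h • g = c • g) : f ⨯₃ g = 0 := by
  by_contra hfg
  have hne : f ⬝ᵥ g ≠ 0 := by
    intro h0
    obtain ⟨a, rfl⟩ := parallel_of_isotropic hf0 hg0 hf hg h0
    exact hfg (by rw [LinearMap.map_smul, cross_self, smul_zero])
  have hc := dotProduct_smul_smul h f g
  rw [hhf, hhg, dotProduct_smul, smul_eq_mul] at hc
  have hc1 : c = 1 := by
    apply mul_right_cancel₀ hne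
    rw [hc, one_mul]
  rw [hc1, one_smul] at hhg
  exact h1 (eq_one_of_fixed h2 hfg hhf hhg)

/-- Rotations about a nonisotropic vector preserve the isotropic lines orthogonal to it. -/
theorem exists_smul_of_rotation (h2 : (2 : K) ≠ 0) {f w : Fin 3 → K} (hf0 : f ≠ 0)
    (hf : f ⬝ᵥ f = 0) (hw : w ⬝ᵥ w ≠ 0) (hwf : w ⬝ᵥ f = 0) {g : SO3 K} (hg : g • w = w) :
    ∃ c : K, g • f = c • f := by
  have hgf0 : g • f ≠ 0 := (smul_ne_zero_iff_ne g).mpr hf0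
  have hgf : (g • f) ⬝ᵥ (g • f) = 0 := by rw [dotProduct_smul_smul, hf]
  obtain ⟨κ, hκ⟩ := cross_isotropic hf0 hf (w := w) (by rw [dotProduct_comm]; exact hwf)
  have hκ' : w ⨯₃ f = (-κ) • f := by rw [neg_smul, ← hκ, cross_anticomm]
  have hκ0 : κ ≠ 0 := by
    rintro rfl
    rw [neg_zero, zero_smul] at hκ'
    obtain ⟨c, rfl⟩ := Homology.exists_smul_of_cross_eq_zero (fun h => hw (by rw [h]; simp)) hκ'
    rw [dotProduct_smul, smul_eq_mul, mul_eq_zero] at hwf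
    rcases hwf with rfl | h
    · simp at hf0
    · exact hw h
  have hκg : w ⨯₃ (g • f) = (-κ) • (g • f) := by
    have := cross_smul_smul g w f
    rw [hg, hκ', smul_comm] at this
    exact this
  -- The map w × commutes with g, so f and g f are eigenvectors of it with one eigenvalue, which is
  -- nonzero; as the map is skew, they are orthogonal.
  have h0 : f ⬝ᵥ (g • f) = 0 := by
    have e1 : (w ⨯₃ f) ⬝ᵥ (g • f) = -(f ⬝ᵥ w ⨯₃ (g • f)) := by
      simp only [cross_apply, dotProduct, Fin.sum_univ_three]
      simp
      ring
    rw [hκ', hκg, smul_dotProduct, dotProduct_smul, smul_eq_mul] at e1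
    have e2 : 2 * κ * (f ⬝ᵥ (g • f)) = 0 := by linear_combination -e1
    exact (mul_eq_zero.mp e2).resolve_left (mul_ne_zero h2 hκ0)
  exact parallel_of_isotropic hf0 hgf0 hf hgf h0

/-- The eigenvalue at f maps the stabiliser onto a cyclic group with kernel the rotations about f. A
preimage of a generator has a fixed vector w, which is nonisotropic and orthogonal to f. The
rotations about w map isomorphically onto the same cyclic group. -/
theorem exists_torus [Finite K] (h2 : (2 : K) ≠ 0) {f : Fin 3 → K} (hf0 : f ≠ 0) (hf : f ⬝ᵥ f = 0)
    (hne : MulAction.stabilizer H (Projectivization.mk K f hf0) ≠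
      rotations H (Projectivization.mk K f hf0)) :
    ∃ y, ¬ isotropic y ∧
      rotations H y ≤ MulAction.stabilizer H (Projectivization.mk K f hf0) ∧
      Nat.card (rotations H y) * Nat.card (rotations H (Projectivization.mk K f hf0)) =
        Nat.card (MulAction.stabilizer H (Projectivization.mk K f hf0)) := by
  set x := Projectivization.mk K f hf0 with hx
  have hTS : rotations H x ≤ MulAction.stabilizer H x := by
    intro h hh
    rw [hx, mem_rotations_mk] at hh
    rw [MulAction.mem_stabilizer_iff, hx, smul_mk_eq_iff]
    exact ⟨1, by rw [hh, one_smul]⟩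
  let l : MulAction.stabilizer H x →* Kˣ := (eigenvalue H hf0).toHomUnits
  have hl : ∀ h, l h = 1 ↔ h.1 ∈ rotations H x := by
    intro h
    rw [show h.1 ∈ rotations H x ↔ h.1.1 • f = f from mem_rotations_mk,
      ← eigenvalue_eq_one_iff hf0 h, ← Units.val_inj]
    rfl
  have hker : l.ker = (rotations H x).subgroupOf (MulAction.stabilizer H x) := by
    ext h
    rw [MonoidHom.mem_ker, hl, Subgroup.mem_subgroupOf]
  obtain ⟨⟨_, h, rfl⟩, hgen⟩ := IsCyclic.exists_generator (α := l.range)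
  have hh1 : l h ≠ 1 := by
    intro h1
    apply hne
    refine le_antisymm (fun g hg => ?_) hTS
    obtain ⟨n, hn⟩ := Subgroup.mem_zpowers_iff.mp (hgen ⟨l ⟨g, hg⟩, _, rfl⟩)
    have hn' := congrArg Subtype.val hn
    have : l ⟨g, hg⟩ = 1 := by
      refine hn'.symm.trans ?_
      change (l h) ^ n = 1
      rw [h1, _root_.one_zpow]
    exact (hl ⟨g, hg⟩).mp this
  obtain ⟨w, hw0, hhw⟩ := exists_fixed h2 h.1.1
  have hspec := eigenvalue_spec hf0 h
  have hl1 : eigenvalue H hf0 h ≠ 1 := fun h' => hh1 (Units.ext h')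
  have hwf : w ⬝ᵥ f = 0 := by
    have e := dotProduct_smul_smul h.1.1 w f
    rw [hhw, hspec, dotProduct_smul, smul_eq_mul] at e
    have e2 : (eigenvalue H hf0 h - 1) * (w ⬝ᵥ f) = 0 := by linear_combination e
    exact (mul_eq_zero.mp e2).resolve_left (sub_ne_zero.mpr hl1)
  have hw : w ⬝ᵥ w ≠ 0 := by
    intro h0
    obtain ⟨c, hc⟩ := parallel_of_isotropic hw0 hf0 h0 hf hwf
    apply hl1
    exact (eigenvalue_eq_one_iff hf0 h).mpr (smul_eq_of_parallel hc hhw)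
  have hle : rotations H (Projectivization.mk K w hw0) ≤ MulAction.stabilizer H x := by
    intro g hg
    rw [mem_rotations_mk] at hg
    rw [MulAction.mem_stabilizer_iff, hx, smul_mk_eq_iff]
    exact exists_smul_of_rotation h2 hf0 hf hw hwf hg
  refine ⟨Projectivization.mk K w hw0, by rwa [isotropic_mk], hle, ?_⟩
  let m : rotations H (Projectivization.mk K w hw0) →* Kˣ := l.comp (Subgroup.inclusion hle)
  have hwfc : w ⨯₃ f ≠ 0 := by
    intro h0
    obtain ⟨c, hc⟩ := Homology.exists_smul_of_cross_eq_zero hw0 h0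
    apply hl1
    exact (eigenvalue_eq_one_iff hf0 h).mpr (smul_eq_of_parallel hc hhw)
  have hm : Function.Injective m := by
    rw [injective_iff_map_eq_one]
    rintro ⟨g, hg⟩ hg1
    have h3 := (hl _).mp hg1
    have h4 : g.1 • f = f := mem_rotations_mk.mp h3
    rw [mem_rotations_mk] at hg
    exact Subtype.ext (Subtype.ext (eq_one_of_fixed h2 hwfc hg h4))
  have hrange : m.range = l.range := by
    apply le_antisymm
    · rintro _ ⟨g, rfl⟩
      exact ⟨_, rfl⟩
    · intro u hu
      obtain ⟨n, hn⟩ := Subgroup.mem_zpowers_iff.mp (hgen ⟨u, hu⟩)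
      refine ⟨⟨h.1, mem_rotations_mk.mpr hhw⟩ ^ n, ?_⟩
      rw [map_zpow]
      exact congrArg Subtype.val hn
  have e1 : Nat.card (rotations H (Projectivization.mk K w hw0)) = Nat.card l.range := by
    rw [← hrange]
    exact Nat.card_congr (MonoidHom.ofInjective hm).toEquiv
  have e2 : Nat.card (rotations H x) = Nat.card l.ker := by
    rw [hker]
    exact (Nat.card_congr (Subgroup.subgroupOfEquivOfLe hTS).toEquiv).symm
  rw [e1, e2, mul_comm, ← Subgroup.index_ker, Subgroup.card_mul_index]

/-- A group of rotations that fixes no isotropic point. -/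
noncomputable def axes [Finite K] (p : ℕ) [Fact p.Prime] [CharP K p] (hp : p ≠ 2) (h2 : (2 : K) ≠ 0)
    (H : Subgroup (SO3 K)) (hH : ∀ f : Fin 3 → K, f ≠ 0 → f ⬝ᵥ f = 0 →
      ∃ h ∈ H, ¬ ∃ c : K, h • f = c • f) : RotationGroup p H (ℙ K (Fin 3 → K)) where
  T := rotations H
  iso := isotropic
  le_stab x h hh := by
    induction x using Projectivization.ind with | _ v hv =>
    rw [mem_rotations_mk] at hh
    rw [MulAction.mem_stabilizer_iff, smul_mk_eq_iff]
    exact ⟨1, by rw [hh, one_smul]⟩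
  conj_mem x g h hh := by
    induction x using Projectivization.ind with | _ v hv =>
    rw [mem_rotations_mk] at hh
    rw [smul_mk, mem_rotations_mk]
    change (g.1 * h.1 * g.1⁻¹) • g.1 • v = g.1 • v
    rw [mul_smul, mul_smul, inv_smul_smul, hh]
  iso_smul x g hx := by
    induction x using Projectivization.ind with | _ v hv =>
    rw [isotropic_mk] at hx
    rw [smul_mk, isotropic_mk]
    exact (dotProduct_smul_smul g.1 v v).trans hx
  exists_mem h _ := by
    obtain ⟨u, hu, hhu⟩ := exists_fixed h2 h.1
    exact ⟨Projectivization.mk K u hu, mem_rotations_mk.mpr hhu⟩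
  unique x y h h1 hx hy := by
    induction x using Projectivization.ind with | _ u hu =>
    induction y using Projectivization.ind with | _ v hv =>
    rw [mem_rotations_mk] at hx hy
    apply mk_eq_mk_of_cross
    by_contra hc
    exact h1 (Subtype.ext (eq_one_of_fixed h2 hc hx hy))
  mul_mem x a b hx ha hb haT hbT := by
    induction x using Projectivization.ind with | _ v hv =>
    rw [isotropic_mk] at hx
    rw [mem_rotations_mk] at haT hbT ⊢
    have key : ∀ g : H, g • Projectivization.mk K v hv = Projectivization.mk K v hv →
        g.1 • v ≠ v → g.1 • v = -v := by
      intro g hg hgT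
      obtain ⟨c, hc⟩ := (smul_mk_eq_iff g hv).mp hg
      have e := dotProduct_smul_smul g.1 v v
      rw [hc, smul_dotProduct, dotProduct_smul, smul_eq_mul, smul_eq_mul] at e
      have e2 : (c - 1) * (c + 1) = 0 := by
        apply mul_right_cancel₀ hx
        linear_combination e
      rcases mul_eq_zero.mp e2 with h | h
      · exact absurd (by rw [hc, sub_eq_zero.mp h, one_smul]) hgT
      · rw [hc, eq_neg_of_add_eq_zero_left h, neg_one_smul]
    change (a.1 * b.1) • v = v
    rw [mul_smul, key b hb hbT, smul_neg, key a ha haT, neg_neg]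
  pGroup x hx := by
    induction x using Projectivization.ind with | _ v hv =>
    rw [isotropic_mk] at hx
    rintro ⟨h, hh⟩
    rw [mem_rotations_mk] at hh
    refine ⟨1, ?_⟩
    rw [pow_one]
    exact Subtype.ext (Subtype.ext (pow_char_eq_one p hp hv hx hh))
  fixed x y h hx hy hh h1 hhy := by
    induction x using Projectivization.ind with | _ u hu =>
    induction y using Projectivization.ind with | _ v hv =>
    rw [isotropic_mk] at hx hy
    rw [mem_rotations_mk] at hh
    obtain ⟨c, hc⟩ := (smul_mk_eq_iff h hv).mp hhy
    exact mk_eq_mk_of_cross hu hv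
      (eq_of_isotropic_fixed h2 hu hv hx hy (fun e => h1 (Subtype.ext e)) hh hc)
  torus x hx hne := by
    induction x using Projectivization.ind with | _ v hv =>
    rw [isotropic_mk] at hx
    exact exists_torus h2 hv hx hne
  not_fixed x hx ht := by
    induction x using Projectivization.ind with | _ v hv =>
    rw [isotropic_mk] at hx
    obtain ⟨h, hh, hc⟩ := hH v hv hx
    have : (⟨h, hh⟩ : H) ∈ MulAction.stabilizer H (Projectivization.mk K v hv) := by
      rw [ht]; trivial
    exact hc ((smul_mk_eq_iff _ hv).mp this)

end Rotation

/-! ### Field of definition and the index bound. -/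

namespace Rotation

variable {K : Type*} [Field K] {H : Subgroup (SO3 K)}

/-- For v not orthogonal to f, a rotation g about f is determined by the scalar β in f × (g v - v) =
β f. -/
theorem card_rotations_le [Finite K] (h2 : (2 : K) ≠ 0) {x : ℙ K (Fin 3 → K)} (hx : isotropic x) :
    Nat.card (rotations H x) ≤ Nat.card K := by
  induction x using Projectivization.ind with | _ f hf0 =>
  rw [isotropic_mk] at hx
  obtain ⟨v, hv⟩ := exists_dotProduct_ne_zero hf0
  have hfg : ∀ g : rotations H (Projectivization.mk K f hf0), g.1.1 • f = f := fun g =>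
    mem_rotations_mk.mp g.2
  have hdot : ∀ g : rotations H (Projectivization.mk K f hf0), f ⬝ᵥ (g.1.1 • v) = f ⬝ᵥ v := by
    intro g
    have := dotProduct_smul_smul g.1.1 f v
    rwa [hfg g] at this
  have hex : ∀ g : rotations H (Projectivization.mk K f hf0), ∃ κ : K,
      f ⨯₃ (g.1.1 • v - v) = κ • f := fun g =>
    cross_isotropic hf0 hx (by rw [dotProduct_sub, hdot, sub_self])
  choose β hβ using hex
  refine Nat.card_le_card_of_injective β fun g g' e => ?_
  have h1 : f ⨯₃ (g.1.1 • v - g'.1.1 • v) = 0 := by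
    have h3 := (hβ g).trans ((congrArg (· • f) e).trans (hβ g').symm)
    rw [LinearMap.map_sub, LinearMap.map_sub] at h3
    rw [LinearMap.map_sub, sub_eq_zero]
    exact sub_left_injective h3
  obtain ⟨c, hc⟩ := Homology.exists_smul_of_cross_eq_zero hf0 h1
  have hgv : g.1.1 • v = g'.1.1 • v + c • f := by rw [← hc]; abel
  have hc0 : c = 0 := by
    have h3 := dotProduct_smul_smul g.1.1 v v
    rw [hgv, add_dotProduct, dotProduct_add, dotProduct_add, dotProduct_smul_smul, smul_dotProduct,
      smul_dotProduct, dotProduct_smul, dotProduct_smul, hx, dotProduct_comm _ f, hdot] at h3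
    simp only [smul_eq_mul] at h3
    have h4 : 2 * (f ⬝ᵥ v) * c = 0 := by linear_combination h3
    exact (mul_eq_zero.mp h4).resolve_left (mul_ne_zero h2 hv)
  rw [hc0, zero_smul, add_zero] at hgv
  have hfv : f ⨯₃ v ≠ 0 := by
    intro h0
    obtain ⟨a, rfl⟩ := Homology.exists_smul_of_cross_eq_zero hf0 h0
    rw [dotProduct_smul, hx, smul_zero] at hv
    exact hv rfl
  have h5 : g'.1.1⁻¹ * g.1.1 = 1 := by
    apply eq_one_of_fixed h2 hfv
    · rw [mul_smul, hfg g, inv_smul_eq_iff, hfg g']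
    · rw [mul_smul, hgv, inv_smul_smul]
  exact Subtype.ext (Subtype.ext (inv_mul_eq_one.mp h5).symm)

theorem trace_adjugate (h : SO3 K) : h.1.adjugate.trace = h.1.trace := by
  rw [adjugate_eq_transpose, trace_transpose]

theorem add_inv_mul_sub_one (h : SO3 K) :
    (h.1 + h⁻¹.1) * (h.1 - 1) = (h.1.trace - 1) • (h.1 - 1) := by
  have e := Homology.sub_one_mul_sq (det_eq_one h) (trace_adjugate h)
  have hi : h⁻¹.1 * h.1 = 1 := congrArg Subtype.val (inv_mul_cancel h)
  have hi' : h.1 * h⁻¹.1 = 1 := congrArg Subtype.val (mul_inv_cancel h)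
  have e2 := congrArg (h⁻¹.1 * ·) e
  generalize h.1.trace - 1 = t at *
  generalize h⁻¹.1 = B at *
  generalize h.1 = A at *
  simp only [mul_sub, mul_smul_comm] at e2
  have e3 : B * ((A - 1) * A ^ 2) = A * (A - 1) := by
    rw [show B * ((A - 1) * A ^ 2) = (B * A) * (A * A - A) by noncomm_ring, hi]
    noncomm_ring
  have e4 : B * ((A - 1) * A) = A - 1 := by
    rw [show B * ((A - 1) * A) = (B * A) * A - B * A by noncomm_ring, hi]
    noncomm_ring
  rw [e3, e4, hi, mul_one] at e2
  rw [add_mul, e2, mul_sub B, hi]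
  simp only [mul_one, smul_sub]
  abel

/-- The element h + h⁻¹ acts on the image of h - 1 as the scalar tr h - 1. It equals its own p^k-th
power, because the two commuting summands are fixed or exchanged. -/
theorem trace_pow (p : ℕ) [Fact p.Prime] [CharP K p] {h : SO3 K} (h1 : h ≠ 1) (k : ℕ)
    (hk : h ^ (p ^ k) = h ∨ h ^ (p ^ k) = h⁻¹) :
    (h.1.trace - 1) ^ (p ^ k) = h.1.trace - 1 := by
  have hc : Commute h.1 h⁻¹.1 := by
    have := (Commute.refl h).inv_right
    exact congrArg Subtype.val this
  have e1 : (h.1 + h⁻¹.1) ^ (p ^ k) = h.1 + h⁻¹.1 := by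
    rw [add_pow_char_pow_of_commute p k hc]
    have hp : ∀ g : SO3 K, g.1 ^ (p ^ k) = (g ^ (p ^ k)).1 := fun g => rfl
    rw [hp, hp, inv_pow]
    rcases hk with hk | hk
    · rw [hk]
    · rw [hk, inv_inv, add_comm]
  have e2 : ∀ n : ℕ, (h.1 + h⁻¹.1) ^ n * (h.1 - 1) = (h.1.trace - 1) ^ n • (h.1 - 1) := by
    intro n
    induction n with
    | zero => rw [pow_zero, pow_zero, one_mul, one_smul]
    | succ n ih =>
      rw [pow_succ, mul_assoc, add_inv_mul_sub_one, mul_smul_comm, ih, smul_smul, pow_succ,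
        mul_comm]
  have e3 := e2 (p ^ k)
  rw [e1, add_inv_mul_sub_one] at e3
  have hne : h.1 - 1 ≠ 0 := fun e => h1 (Subtype.ext (sub_eq_zero.mp e))
  exact (smul_left_injective K hne e3).symm

theorem card_le_of_pow_eq [Finite K] {Q : ℕ} (hQ : 1 < Q) (h : ∀ a : K, a ^ Q = a) :
    Nat.card K ≤ Q := by
  have := Fintype.ofFinite K
  classical
  rw [Nat.card_eq_fintype_card, ← Finset.card_univ, ← FiniteField.X_pow_card_sub_X_natDegree_eq K hQ]
  apply Polynomial.card_le_degree_of_subset_roots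
  intro a _
  rw [Polynomial.mem_roots (FiniteField.X_pow_card_sub_X_ne_zero K hQ)]
  simp [h]

/-- The vector `u` has a large rotation group in `H`, and its line is inverted but not fixed. -/
structure IsBase (H : Subgroup (SO3 K)) (u : Fin 3 → K) : Prop where
  ne_zero : u ≠ 0
  noniso : u ⬝ᵥ u ≠ 0
  card : 6 ≤ Nat.card (rotations H (Projectivization.mk K u ne_zero))
  flip : ∃ a ∈ H, a • u = -u
  move : ∃ a ∈ H, ¬ ∃ c : K, a • u = c • u

theorem IsBase.stab_ne_rotations (h2 : (2 : K) ≠ 0) {u : Fin 3 → K} (h : IsBase H u) :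
    MulAction.stabilizer H (Projectivization.mk K u h.ne_zero) ≠
      rotations H (Projectivization.mk K u h.ne_zero) := by
  intro e
  obtain ⟨a, ha, hau⟩ := h.flip
  have h1 : (⟨a, ha⟩ : H) ∈ MulAction.stabilizer H (Projectivization.mk K u h.ne_zero) := by
    rw [MulAction.mem_stabilizer_iff, smul_mk_eq_iff]
    exact ⟨-1, by rw [hau, neg_one_smul]⟩
  rw [e, mem_rotations_mk] at h1
  have h3 : (2 : K) • u = 0 := by
    rw [two_smul]
    nth_rw 1 [← h1]
    rw [hau, neg_add_cancel]
  exact (smul_ne_zero h2 h.ne_zero) h3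

theorem IsBase.stab_ne_top {u : Fin 3 → K} (h : IsBase H u) :
    MulAction.stabilizer H (Projectivization.mk K u h.ne_zero) ≠ ⊤ := by
  intro e
  obtain ⟨a, ha, hau⟩ := h.move
  apply hau
  rw [← smul_mk_eq_iff (⟨a, ha⟩ : H) h.ne_zero, ← MulAction.mem_stabilizer_iff, e]
  trivial

theorem IsBase.mono [Finite K] {u : Fin 3 → K} (h : IsBase H u) {H' : Subgroup (SO3 K)} (hle : H ≤ H') :
    IsBase H' u where
  ne_zero := h.ne_zero
  noniso := h.noniso
  card := by
    refine h.card.trans ?_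
    refine Nat.card_le_card_of_injective (fun g => ⟨⟨g.1.1, hle g.1.2⟩, ?_⟩) ?_
    · exact mem_rotations_mk.mpr (mem_rotations_mk.mp g.2)
    · intro g g' e
      exact Subtype.ext (Subtype.ext (congrArg (fun a => a.1.1) e))
  flip := h.flip.imp fun a ha => ⟨hle ha.1, ha.2⟩
  move := h.move.imp fun a ha => ⟨hle ha.1, ha.2⟩

theorem pow_eq_or_inv {G : Type*} [Group G] {g : G} {Q n : ℕ} (hQ : 0 < Q) (hg : g ^ n = 1)
    (hn : n ∣ Q - 1 ∨ n ∣ Q + 1) : g ^ Q = g ∨ g ^ Q = g⁻¹ := by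
  have key : ∀ m, n ∣ m → g ^ m = 1 := by
    rintro _ ⟨k, rfl⟩
    rw [pow_mul, hg, one_pow]
  rcases hn with h | h
  · left
    have h1 := key _ h
    rw [show Q = Q - 1 + 1 by omega, pow_succ, h1, one_mul]
  · right
    have h1 := key _ h
    rw [pow_succ] at h1
    exact eq_inv_of_mul_eq_one_left h1

/-- A group of rotations with two base vectors, over a field generated by the corresponding traces,
has index at most two. -/
theorem card_le_two_mul [Finite K] (p : ℕ) [Fact p.Prime] [CharP K p] (hp : p ≠ 2)
    (h2 : (2 : K) ≠ 0) (hH : ∀ f : Fin 3 → K, f ≠ 0 → f ⬝ᵥ f = 0 → ∃ h ∈ H, ¬ ∃ c : K, h • f = c • f)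
    {u u' : Fin 3 → K} (hu : IsBase H u) (hu' : IsBase H u') {r r' : SO3 K} (hr : r ∈ H)
    (hr' : r' ∈ H) (hr1 : r ≠ 1) (hr1' : r' ≠ 1) (hru : r • u = u) (hru' : r' • u' = u')
    (hK : ∀ k : ℕ, (r.1.trace - 1) ^ (p ^ k) = r.1.trace - 1 →
      (r'.1.trace - 1) ^ (p ^ k) = r'.1.trace - 1 → ∀ a : K, a ^ (p ^ k) = a) :
    Nat.card (SO3 K) ≤ 2 * Nat.card H := by
  have := Fintype.ofFinite (ℙ K (Fin 3 → K))
  let D := axes p hp h2 H hH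
  have ni : ∀ {w : Fin 3 → K} (hw : w ≠ 0), w ⬝ᵥ w ≠ 0 → ¬ isotropic (Projectivization.mk K w hw) :=
    fun hw h => by rwa [isotropic_mk]
  obtain ⟨x₁, hx₁, hT⟩ := D.exists_iso (x₀ := Projectivization.mk K u hu.ne_zero)
    (ni _ hu.noniso) hu.card (hu.stab_ne_rotations h2) hu.stab_ne_top
  obtain ⟨e, f, d, hd, hed, hfd, hcard, hn⟩ := D.card_eq hp (x₀ := Projectivization.mk K u hu.ne_zero)
    (ni _ hu.noniso) hu.card (hu.stab_ne_rotations h2) hu.stab_ne_top hx₁ hT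
  obtain ⟨e', f', d', hd', hed', hfd', -, hn'⟩ := D.card_eq hp (x₀ := Projectivization.mk K u' hu'.ne_zero)
    (ni _ hu'.noniso) hu'.card (hu'.stab_ne_rotations h2) hu'.stab_ne_top hx₁ hT
  obtain ⟨k, hk⟩ := IsPGroup.iff_card.mp (D.pGroup x₁ hx₁)
  have hQK : Nat.card (D.T x₁) ≤ Nat.card K := card_rotations_le h2 hx₁
  set Q := Nat.card (D.T x₁)
  have hQ0 : 0 < Q := by omega
  have tr : ∀ {w : Fin 3 → K} (hw : w ≠ 0) {e f d : ℕ} {s : SO3 K}, s ∈ H → s • w = w → s ≠ 1 →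
      e * d = Q - 1 → f * d = Q + 1 →
      (Nat.card (D.T (Projectivization.mk K w hw)) = e ∨
        Nat.card (D.T (Projectivization.mk K w hw)) = f) →
      (s.1.trace - 1) ^ (p ^ k) = s.1.trace - 1 := by
    intro w hw e f d s hs hsw hs1 he hf hn
    apply trace_pow p hs1 k
    rw [← hk]
    have hs' : s ^ Nat.card (D.T (Projectivization.mk K w hw)) = 1 := by
      have h3 : (⟨⟨s, hs⟩, mem_rotations_mk.mpr hsw⟩ : D.T (Projectivization.mk K w hw)) ^
        Nat.card (D.T (Projectivization.mk K w hw)) = 1 := pow_card_eq_one'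
      exact congrArg (fun a => a.1.1) h3
    apply pow_eq_or_inv hQ0 hs'
    rcases hn with h | h
    · exact Or.inl ⟨d, by rw [h, he]⟩
    · exact Or.inr ⟨d, by rw [h, hf]⟩
  -- The rotations about either base vector have order dividing Q - 1 or Q + 1, so both traces are
  -- fixed by a ↦ a^Q, and hence so is all of K.
  have hall := hK k (tr _ hr hru hr1 hed hfd hn) (tr _ hr' hru' hr1' hed' hfd' hn')
  rw [← hk] at hall
  have hKQ := card_le_of_pow_eq (by omega) hall
  -- The same count for the full rotation group bounds its order by Q(Q - 1)(Q + 1).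
  let D' := axes p hp h2 (⊤ : Subgroup (SO3 K)) fun f h0 h => (hH f h0 h).imp fun g hg => ⟨trivial, hg.2⟩
  have ht := hu.mono (le_top : H ≤ ⊤)
  obtain ⟨x₂, hx₂, hT'⟩ := D'.exists_iso (x₀ := Projectivization.mk K u hu.ne_zero)
    (ni _ ht.noniso) ht.card (ht.stab_ne_rotations h2) ht.stab_ne_top
  obtain ⟨e₂, f₂, d₂, hd₂, hed₂, hfd₂, hcard₂, -⟩ := D'.card_eq hp
    (x₀ := Projectivization.mk K u hu.ne_zero)
    (ni _ ht.noniso) ht.card (ht.stab_ne_rotations h2) ht.stab_ne_top hx₂ hT'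
  have hQ₂ : Nat.card (D'.T x₂) ≤ Q := (card_rotations_le h2 hx₂).trans hKQ
  rw [Nat.card_congr Subgroup.topEquiv.toEquiv] at hcard₂
  rw [hcard₂, hcard]
  have he₂ : e₂ ≤ Q - 1 := by
    have : e₂ ≤ e₂ * d₂ := Nat.le_mul_of_pos_right _ (by omega)
    omega
  have he : Q - 1 ≤ 2 * e := by
    rcases hd with rfl | rfl <;> omega
  calc Nat.card (D'.T x₂) * e₂ * (Nat.card (D'.T x₂) + 1) ≤ Q * (2 * e) * (Q + 1) := by
        gcongr
        omega
    _ = 2 * (Q * e * (Q + 1)) := by ring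

end Rotation

/-! ### Groups of index at most two: SO(3) and Ω(3). -/

namespace Rotation

variable {K : Type*} [Field K] {H : Subgroup (SO3 K)}

theorem halfTurn_congr {u w : Fin 3 → K} (h : u = w) (hu : u ⬝ᵥ u ≠ 0) (hw : w ⬝ᵥ w ≠ 0) :
    halfTurn u hu = halfTurn w hw := by
  subst h
  rfl

/-- Half-turns about vectors of the same norm are conjugate. -/
theorem exists_conj (h2 : (2 : K) ≠ 0) {u w : Fin 3 → K} (hu : u ⬝ᵥ u ≠ 0) (hw : w ⬝ᵥ w ≠ 0)
    (h : u ⬝ᵥ u = w ⬝ᵥ w) : ∃ g : SO3 K, g * halfTurn u hu * g⁻¹ = halfTurn w hw := by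
  have hpm : ∀ {z : Fin 3 → K} (hz : z ⬝ᵥ z ≠ 0), z ⬝ᵥ z = 2 * (z ⬝ᵥ u) →
      halfTurn z hz • u = z - u := by
    intro z hz e
    rw [halfTurn_smul]
    have : 2 * ((z ⬝ᵥ z)⁻¹ * (z ⬝ᵥ u)) = 1 := by
      rw [show 2 * ((z ⬝ᵥ z)⁻¹ * (z ⬝ᵥ u)) = (z ⬝ᵥ z)⁻¹ * (2 * (z ⬝ᵥ u)) by ring, ← e,
        inv_mul_cancel₀ hz]
    rw [this, one_smul]
  -- The half-turn about u + w exchanges u and w. If u + w is isotropic, then u - w is not, and its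
  -- half-turn sends u to -w, which has the same half-turn as w.
  by_cases h0 : (u + w) ⬝ᵥ (u + w) = 0
  · have h1 : (u - w) ⬝ᵥ (u - w) ≠ 0 := by
      intro h1
      have : 2 * (2 * (u ⬝ᵥ u)) = 0 := by
        simp only [add_dotProduct, dotProduct_add, sub_dotProduct, dotProduct_sub] at h0 h1
        linear_combination h0 + h1 + 2 * h
      exact hu ((mul_eq_zero.mp ((mul_eq_zero.mp this).resolve_left h2)).resolve_left h2)
    have e := hpm h1 (by
      simp only [sub_dotProduct, dotProduct_sub]
      rw [← h, dotProduct_comm u w]; ring)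
    have e' : halfTurn (u - w) h1 • u = (-1 : K) • w := by
      rw [e]; module
    have hne : (halfTurn (u - w) h1 • u) ⬝ᵥ (halfTurn (u - w) h1 • u) ≠ 0 := by
      rwa [dotProduct_smul_smul]
    refine ⟨halfTurn (u - w) h1, ?_⟩
    rw [halfTurn_conj _ u hu hne]
    have hne' : ((-1 : K) • w) ⬝ᵥ ((-1 : K) • w) ≠ 0 := by rw [← e']; exact hne
    rw [halfTurn_congr e' hne hne', halfTurn_smul_vec hw]
  · have e := hpm h0 (by
      simp only [add_dotProduct, dotProduct_add]
      rw [← h, dotProduct_comm u w]; ring)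
    have e' : halfTurn (u + w) h0 • u = w := by
      rw [e]; module
    have hne : (halfTurn (u + w) h0 • u) ⬝ᵥ (halfTurn (u + w) h0 • u) ≠ 0 := by
      rwa [dotProduct_smul_smul]
    refine ⟨halfTurn (u + w) h0, ?_⟩
    rw [halfTurn_conj _ u hu hne, halfTurn_congr e' hne hw]

theorem halfTurn_mul_mem_commutator (h2 : (2 : K) ≠ 0) {u w : Fin 3 → K} (hu : u ⬝ᵥ u ≠ 0)
    (hw : w ⬝ᵥ w ≠ 0) (h : u ⬝ᵥ u = w ⬝ᵥ w) : halfTurn u hu * halfTurn w hw ∈ commutator (SO3 K) := by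
  obtain ⟨g, hg⟩ := exists_conj h2 hu hw h
  have hi : (halfTurn u hu)⁻¹ = halfTurn u hu := inv_eq_of_mul_eq_one_left (halfTurn_mul_self u hu)
  have h3 := Subgroup.commutator_mem_commutator (Subgroup.mem_top (halfTurn u hu))
    (Subgroup.mem_top g)
  rw [commutatorElement_def, hi] at h3
  rw [commutator_def, ← hg]
  simpa only [mul_assoc] using h3

theorem single_noniso (i : Fin 3) : (Pi.single i 1 : Fin 3 → K) ⬝ᵥ Pi.single i 1 ≠ 0 := by
  simp

theorem eq_one_of_fixes_singles (h2 : (2 : K) ≠ 0) {h : SO3 K}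
    (h0 : h • (Pi.single 0 1 : Fin 3 → K) = Pi.single 0 1)
    (h1 : h • (Pi.single 1 1 : Fin 3 → K) = Pi.single 1 1) : h = 1 := by
  refine eq_one_of_fixed h2 ?_ h0 h1
  intro e
  have := congrFun e 2
  simp [cross_apply] at this

/-- The half-turn about one basis vector is the product of those about the other two, which have the
same norm. -/
theorem halfTurn_single_mem_commutator (h2 : (2 : K) ≠ 0) :
    halfTurn (Pi.single 0 1 : Fin 3 → K) (single_noniso 0) ∈ commutator (SO3 K) := by
  have h12 := halfTurn_mul_mem_commutator h2 (single_noniso (K := K) 1) (single_noniso 2)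
    (by simp)
  have : halfTurn (Pi.single 0 1 : Fin 3 → K) (single_noniso 0) *
      (halfTurn (Pi.single 1 1) (single_noniso 1) * halfTurn (Pi.single 2 1) (single_noniso 2)) = 1 := by
    apply eq_one_of_fixes_singles h2
    · rw [mul_smul, mul_smul, halfTurn_smul_of_orthogonal (single_noniso 2) (by simp), smul_neg,
        halfTurn_smul_of_orthogonal (single_noniso 1) (by simp), neg_neg, halfTurn_smul_self]
    · rw [mul_smul, mul_smul, halfTurn_smul_of_orthogonal (single_noniso 2) (by simp), smul_neg,
        halfTurn_smul_self, smul_neg, halfTurn_smul_of_orthogonal (single_noniso 0) (by simp), neg_neg]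
  rw [mul_eq_one_iff_eq_inv] at this
  rw [this]
  exact inv_mem h12

/-- Half-turns about vectors of the same norm up to squares are conjugate. -/
theorem halfTurn_mem_of_mul_sq (h2 : (2 : K) ≠ 0) {N : Subgroup (SO3 K)} (hN : N.Normal)
    {u w : Fin 3 → K} (hu : u ⬝ᵥ u ≠ 0) (hw : w ⬝ᵥ w ≠ 0) {c : K} (h : w ⬝ᵥ w = c * c * (u ⬝ᵥ u))
    (hm : halfTurn u hu ∈ N) : halfTurn w hw ∈ N := by
  have hcu : (c • u) ⬝ᵥ (c • u) = w ⬝ᵥ w := by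
    rw [smul_dotProduct, dotProduct_smul, h, smul_eq_mul, smul_eq_mul]; ring
  have hcu0 : (c • u) ⬝ᵥ (c • u) ≠ 0 := by rwa [hcu]
  rw [← halfTurn_smul_vec hu hcu0] at hm
  obtain ⟨g, hg⟩ := exists_conj h2 hcu0 hw hcu
  rw [← hg]
  exact hN.conj_mem _ hm g

theorem halfTurn_mem_commutator (h2 : (2 : K) ≠ 0) {w : Fin 3 → K} (hw : w ⬝ᵥ w ≠ 0)
    (h : IsSquare (w ⬝ᵥ w)) : halfTurn w hw ∈ commutator (SO3 K) := by
  obtain ⟨c, hc⟩ := h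
  refine halfTurn_mem_of_mul_sq h2 inferInstance (single_noniso 0) hw (c := c) ?_
    (halfTurn_single_mem_commutator h2)
  rw [hc]; simp

theorem exists_orthogonal_noniso (h2 : (2 : K) ≠ 0) {a : Fin 3 → K} (ha : a ⬝ᵥ a ≠ 0) :
    ∃ b : Fin 3 → K, a ⬝ᵥ b = 0 ∧ b ⬝ᵥ b ≠ 0 := by
  by_contra! hc
  have h : ∀ i, a ⬝ᵥ a - a i * a i = 0 := by
    intro i
    -- The vectors a × e_i are orthogonal to a and have norms a·a - a_i², whose sum 2(a·a) is
    -- nonzero.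
    have := hc (a ⨯₃ Pi.single i 1) (dot_self_cross _ _)
    rw [cross_dot_cross] at this
    simp only [dotProduct_single, single_dotProduct, mul_one, one_mul] at this
    simpa using this
  have h3 : a ⬝ᵥ a = a 0 * a 0 + a 1 * a 1 + a 2 * a 2 := by
    simp [dotProduct, Fin.sum_univ_three]
  have : 2 * (a ⬝ᵥ a) = 0 := by linear_combination h 0 + h 1 + h 2 - h3
  exact ha ((mul_eq_zero.mp this).resolve_left h2)

/-- A rotation that inverts a nonisotropic vector is a half-turn. -/
theorem exists_eq_halfTurn (p : ℕ) [Fact p.Prime] [CharP K p] (hp : p ≠ 2)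
    (h2 : (2 : K) ≠ 0) {t : SO3 K} {a : Fin 3 → K} (ha : a ⬝ᵥ a ≠ 0) (hta : t • a = -a) :
    ∃ (c : Fin 3 → K) (hc : c ⬝ᵥ c ≠ 0), t = halfTurn c hc := by
  have ha0 : a ≠ 0 := by rintro rfl; simp at ha
  obtain ⟨c, hc0, htc⟩ := exists_fixed h2 t
  have hca : c ⬝ᵥ a = 0 := by
    have e := dotProduct_smul_smul t c a
    rw [htc, hta, dotProduct_neg] at e
    have : 2 * (c ⬝ᵥ a) = 0 := by linear_combination -e
    exact (mul_eq_zero.mp this).resolve_left h2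
  have hcross : c ⨯₃ a ≠ 0 := by
    intro h0
    obtain ⟨l, rfl⟩ := Homology.exists_smul_of_cross_eq_zero hc0 h0
    rw [dotProduct_smul, smul_dotProduct] at ha
    rw [dotProduct_smul] at hca
    rw [smul_comm, hca, smul_zero] at ha
    exact ha rfl
  have htt : t * t = 1 := by
    apply eq_one_of_fixed h2 hcross
    · rw [mul_smul, htc, htc]
    · rw [mul_smul, hta, smul_neg, hta, neg_neg]
  have hc : c ⬝ᵥ c ≠ 0 := by
    intro h0
    have h1 := pow_char_eq_one p hp hc0 h0 htc
    obtain ⟨m, hm⟩ := (Fact.out : p.Prime).odd_of_ne_two hp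
    rw [hm, pow_succ, pow_mul, pow_two, htt, one_pow, one_mul] at h1
    rw [h1, one_smul] at hta
    have h3 : (2 : K) • a = 0 := by
      rw [two_smul]; nth_rw 1 [hta]; exact neg_add_cancel a
    exact (smul_ne_zero h2 ha0) h3
  refine ⟨c, hc, ?_⟩
  have : t * halfTurn c hc = 1 := by
    apply eq_one_of_fixed h2 hcross
    · rw [mul_smul, halfTurn_smul_self, htc]
    · rw [mul_smul, halfTurn_smul_of_orthogonal hc hca, smul_neg, hta, neg_neg]
  rw [mul_eq_one_iff_eq_inv, inv_eq_of_mul_eq_one_left (halfTurn_mul_self c hc)] at this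
  exact this

/-- A rotation about a nonisotropic vector is a product of two half-turns. One about an isotropic
vector satisfies g^p = 1 with p odd, so it is a square and lies in any subgroup of index two. -/
theorem eq_top_of_halfTurn_mem (p : ℕ) [Fact p.Prime] [CharP K p] (hp : p ≠ 2)
    (h2 : (2 : K) ≠ 0) (hi : H.index = 2)
    (hall : ∀ (u : Fin 3 → K) (hu : u ⬝ᵥ u ≠ 0), halfTurn u hu ∈ H) : H = ⊤ := by
  rw [eq_top_iff]
  intro g _
  obtain ⟨a, ha0, hga⟩ := exists_fixed h2 g
  by_cases ha : a ⬝ᵥ a = 0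
  · have h1 := pow_char_eq_one p hp ha0 ha hga
    obtain ⟨m, hm⟩ := (Fact.out : p.Prime).odd_of_ne_two hp
    have : g = (g ^ (m + 1)) ^ 2 := by
      rw [← pow_mul, show (m + 1) * 2 = p + 1 by omega, pow_succ, h1, one_mul]
    rw [this]
    exact Subgroup.sq_mem_of_index_two hi _
  · obtain ⟨b, hab, hb⟩ := exists_orthogonal_noniso h2 ha
    have hta : (halfTurn b hb * g) • a = -a := by
      rw [mul_smul, hga, halfTurn_smul_of_orthogonal hb (by rwa [dotProduct_comm])]
    obtain ⟨c, hc, e⟩ := exists_eq_halfTurn p hp h2 ha hta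
    have := hall c hc
    rw [← e] at this
    exact (H.mul_mem_cancel_left (hall b hb)).mp this

theorem exists_mul_sq_of_not_isSquare [Finite K] {a b : K} (ha : ¬ IsSquare a) (hb : ¬ IsSquare b) :
    ∃ c, b = c * c * a := by
  have := Fintype.ofFinite K
  classical
  have ha0 : a ≠ 0 := by rintro rfl; simp at ha
  have hb0 : b ≠ 0 := by rintro rfl; simp at hb
  have h1 : quadraticChar K (b * a) = 1 := by
    rw [map_mul, quadraticChar_neg_one_iff_not_isSquare.mpr ha,
      quadraticChar_neg_one_iff_not_isSquare.mpr hb]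
    norm_num
  obtain ⟨d, hd⟩ := (quadraticChar_one_iff_isSquare (mul_ne_zero hb0 ha0)).mp h1
  refine ⟨d / a, ?_⟩
  field_simp
  rw [hd, pow_two]

/-- A subgroup of index two contains the commutator subgroup, hence all half-turns about vectors of
square norm. If some generator has nonsquare norm, its conjugates give all the remaining half-turns;
otherwise the generators all lie in the commutator subgroup. -/
theorem eq_top_or_eq_commutator [Finite K] (p : ℕ) [Fact p.Prime] [CharP K p] (hp : p ≠ 2)
    (h2 : (2 : K) ≠ 0) {ι : Type*} {u : ι → Fin 3 → K} (hu : ∀ i, u i ⬝ᵥ u i ≠ 0)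
    (hH : H = Subgroup.closure (Set.range fun i => halfTurn (u i) (hu i)))
    (hc : Nat.card (SO3 K) ≤ 2 * Nat.card H) : H = ⊤ ∨ H = commutator (SO3 K) := by
  have h1 := H.card_mul_index
  have hpos : 0 < Nat.card H := Nat.card_pos
  have hi : H.index ≤ 2 := by
    rw [← h1, mul_comm 2] at hc
    exact Nat.le_of_mul_le_mul_left hc hpos
  have hi0 : H.index ≠ 0 := Subgroup.index_ne_zero_of_finite
  obtain hi1 | hi2 : H.index = 1 ∨ H.index = 2 := by omega
  · exact Or.inl (Subgroup.index_eq_one.mp hi1)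
  · have hle : commutator (SO3 K) ≤ H := by
      rw [commutator_def, Subgroup.commutator_le]
      intro a _ b _
      rw [commutatorElement_def]
      simp only [Subgroup.mul_mem_iff_of_index_two hi2, inv_mem_iff]
      tauto
    have hn := Subgroup.normal_of_index_eq_two hi2
    by_cases hsq : ∀ i, IsSquare (u i ⬝ᵥ u i)
    · right
      refine le_antisymm ?_ hle
      rw [hH, Subgroup.closure_le]
      rintro _ ⟨i, rfl⟩
      exact halfTurn_mem_commutator h2 (hu i) (hsq i)
    · left
      push Not at hsq
      obtain ⟨i, hi⟩ := hsq
      refine eq_top_of_halfTurn_mem p hp h2 hi2 fun w hw => ?_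
      by_cases hws : IsSquare (w ⬝ᵥ w)
      · exact hle (halfTurn_mem_commutator h2 hw hws)
      · obtain ⟨c, hc⟩ := exists_mul_sq_of_not_isSquare hi hws
        refine halfTurn_mem_of_mul_sq h2 hn (hu i) hw hc ?_
        rw [hH]
        exact Subgroup.subset_closure ⟨i, rfl⟩

theorem parallel_of_halfTurn_fixed (h2 : (2 : K) ≠ 0) {u w : Fin 3 → K} (hu : u ⬝ᵥ u ≠ 0)
    (h : halfTurn u hu • w = w) : ∃ c : K, w = c • u := by
  refine ⟨(u ⬝ᵥ u)⁻¹ * (u ⬝ᵥ w), ?_⟩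
  rw [halfTurn_smul, sub_eq_iff_eq_add, ← two_smul K w, mul_smul] at h
  exact (smul_right_injective _ h2 h).symm

/-- Commuting with the half-turns about the basis vectors makes z diagonal. Commuting with a product
of two half-turns that cycles the basis up to sign makes it a scalar c, and preservation of the
cross product gives c² = c. -/
theorem eq_one_of_commute (h2 : (2 : K) ≠ 0) {z : SO3 K} (hz : ∀ g ∈ commutator (SO3 K), z * g = g * z) :
    z = 1 := by
  have hs : ∀ i : Fin 3, ∃ c : K, z • (Pi.single i 1 : Fin 3 → K) = c • Pi.single i 1 := by
    intro i
    apply parallel_of_halfTurn_fixed h2 (single_noniso i)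
    rw [← mul_smul, ← hz _ (halfTurn_mem_commutator h2 (single_noniso i) (by simp)), mul_smul,
      halfTurn_smul_self]
  choose c hc using hs
  have n0 : (Pi.single 0 1 + Pi.single 1 1 : Fin 3 → K) ⬝ᵥ (Pi.single 0 1 + Pi.single 1 1) = 2 := by
    simp [dotProduct, Fin.sum_univ_three, one_add_one_eq_two]
  have n1 : (Pi.single 1 1 + Pi.single 2 1 : Fin 3 → K) ⬝ᵥ (Pi.single 1 1 + Pi.single 2 1) = 2 := by
    simp [dotProduct, Fin.sum_univ_three, one_add_one_eq_two]
  have hM := hz _ (halfTurn_mul_mem_commutator h2 (n0 ▸ h2) (n1 ▸ h2) (n0.trans n1.symm))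
  have key : ∀ {M : SO3 K} {i j : Fin 3}, z * M = M * z →
      M • (Pi.single i 1 : Fin 3 → K) = -Pi.single j 1 → c i = c j := by
    intro M i j hM hij
    have := congrArg (· • (Pi.single i 1 : Fin 3 → K)) hM
    simp only [mul_smul, hij, hc, smul_neg] at this
    rw [smul_comm, hij, smul_neg] at this
    have := congrFun (neg_injective this) j
    simpa using this.symm
  have h01 : c 0 = c 1 := by
    refine key hM ?_
    rw [mul_smul, halfTurn_smul_of_orthogonal (u := Pi.single 1 1 + Pi.single 2 1) _ (by simp),
      smul_neg, halfTurn_smul]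
    congr 1
    rw [n0]
    ext k
    fin_cases k <;> simp [h2]
  have h12 : c 1 = c 2 := by
    refine key hM ?_
    rw [mul_smul, halfTurn_smul _ _ (Pi.single 1 1), n1]
    have : (2 * ((2 : K)⁻¹ * ((Pi.single 1 1 + Pi.single 2 1 : Fin 3 → K) ⬝ᵥ Pi.single 1 1))) •
        (Pi.single 1 1 + Pi.single 2 1 : Fin 3 → K) - Pi.single 1 1 = Pi.single 2 1 := by
      ext k
      fin_cases k <;> simp [h2]
    rw [this, halfTurn_smul_of_orthogonal (u := Pi.single 0 1 + Pi.single 1 1) _ (by simp)]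
  have hcr := cross_smul_smul z (Pi.single 0 1) (Pi.single 1 1)
  have e2 : (Pi.single 0 1 : Fin 3 → K) ⨯₃ Pi.single 1 1 = Pi.single 2 1 := by
    ext k
    fin_cases k <;> simp [cross_apply]
  rw [hc, hc, LinearMap.map_smul, LinearMap.map_smul, LinearMap.smul_apply, e2, hc, smul_smul] at hcr
  have h3 := congrFun hcr 2
  simp only [Pi.smul_apply, Pi.single_eq_same, smul_eq_mul, mul_one] at h3
  have hc0 : c 2 ≠ 0 := by
    intro h0
    have := hc 2
    rw [h0, zero_smul] at this
    have := (smul_ne_zero_iff_ne z).mpr (Pi.single_ne_zero_iff.mpr (one_ne_zero (α := K)) : (Pi.single 2 1 : Fin 3 → K) ≠ 0)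
    contradiction
  have hc1 : c 2 = 1 := by
    rw [h01, h12] at h3
    exact mul_right_cancel₀ hc0 (by rw [h3, one_mul])
  apply eq_one_of_fixes_singles h2
  · rw [hc, h01, h12, hc1, one_smul]
  · rw [hc, h12, hc1, one_smul]

theorem center_SO3 (h2 : (2 : K) ≠ 0) : Subgroup.center (SO3 K) = ⊥ := by
  rw [Subgroup.eq_bot_iff_forall]
  intro z hz
  exact eq_one_of_commute h2 fun g _ => (Subgroup.mem_center_iff.mp hz g).symm

theorem center_Omega3 (h2 : (2 : K) ≠ 0) : Subgroup.center (Omega3 K) = ⊥ := by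
  rw [Subgroup.eq_bot_iff_forall]
  intro z hz
  apply Subtype.ext
  exact eq_one_of_commute h2 fun g hg =>
    (congrArg Subtype.val (Subgroup.mem_center_iff.mp hz ⟨g, hg⟩)).symm

theorem equiv_POmega3_or_PSO3 [Finite K] (p : ℕ) [Fact p.Prime] [CharP K p] (hp : p ≠ 2)
    (h2 : (2 : K) ≠ 0) {ι : Type*} {u : ι → Fin 3 → K} (hu : ∀ i, u i ⬝ᵥ u i ≠ 0)
    (hH : H = Subgroup.closure (Set.range fun i => halfTurn (u i) (hu i)))
    (hc : Nat.card (SO3 K) ≤ 2 * Nat.card H) :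
    Nonempty (H ≃* POmega3 K) ∨ Nonempty (H ≃* PSO3 K) := by
  rcases eq_top_or_eq_commutator p hp h2 hu hH hc with rfl | rfl
  · right
    exact ⟨Subgroup.topEquiv.trans ((QuotientGroup.quotientMulEquivOfEq (center_SO3 h2)).trans
      QuotientGroup.quotientBot).symm⟩
  · left
    exact ⟨((QuotientGroup.quotientMulEquivOfEq (center_Omega3 h2)).trans
      QuotientGroup.quotientBot).symm⟩

end Rotation

/-! ### Coordinates in which the invariant form is a sum of three squares. -/

namespace Rotation

variable {K F : Type*} [Field K] [Field F]

theorem exists_sum_sq_eq [Finite K] (p : ℕ) [Fact p.Prime] [CharP K p] (hp : p ≠ 2) {a b : K}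
    (ha : a ≠ 0) (hb : b ≠ 0) (κ : K) : ∃ s t, a * s ^ 2 + b * t ^ 2 = κ := by
  have := Fintype.ofFinite K
  have hodd : Fintype.card K % 2 = 1 := by
    apply FiniteField.odd_card_of_char_ne_two
    rw [ringChar.eq K p]
    exact hp
  obtain ⟨s, t, h⟩ := FiniteField.exists_root_sum_quadratic
    (f := Polynomial.C a * Polynomial.X ^ 2 + Polynomial.C 0 * Polynomial.X + Polynomial.C 0)
    (g := Polynomial.C b * Polynomial.X ^ 2 + Polynomial.C 0 * Polynomial.X + Polynomial.C (-κ))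
    (Polynomial.degree_quadratic ha) (Polynomial.degree_quadratic hb) hodd
  refine ⟨s, t, ?_⟩
  simp at h
  linear_combination h

/-- Over a finite field of odd characteristic, every nondegenerate ternary form is similar to the
sum of three squares. -/
theorem exists_similar [Finite K] (p : ℕ) [Fact p.Prime] [CharP K p] (hp : p ≠ 2)
    {d : Fin 3 → K} (hd : ∀ i, d i ≠ 0) :
    ∃ (P : Matrix (Fin 3) (Fin 3) K) (κ : K), κ ≠ 0 ∧ Pᵀ * diagonal d * P = κ • 1 := by
  -- The pair (s, t) represents the discriminant by the first two coefficients, and (a, b)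
  -- represents d 0 * d 1 as a sum of two squares. The columns of P are then orthogonal, of common
  -- norm κ = d 0 * d 1 * d 2.
  obtain ⟨s, t, h1⟩ := exists_sum_sq_eq p hp (hd 0) (hd 1) (d 0 * d 1 * d 2)
  obtain ⟨a, b, h2⟩ := exists_sum_sq_eq p hp (one_ne_zero (α := K)) one_ne_zero (d 0 * d 1)
  have d0 := hd 0
  have d1 := hd 1
  refine ⟨!![s, -a * t / d 0, b * t / d 0; t, a * s / d 1, -b * s / d 1; 0, b, a],
    d 0 * d 1 * d 2, mul_ne_zero (mul_ne_zero d0 d1) (hd 2), ?_⟩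
  have e1 : a ^ 2 * t ^ 2 / d 0 + a ^ 2 * s ^ 2 / d 1 + d 2 * b ^ 2 = d 0 * d 1 * d 2 := by
    field_simp
    linear_combination a ^ 2 * h1 + (d 0 * d 1 * d 2) * h2
  have e2 : b ^ 2 * t ^ 2 / d 0 + b ^ 2 * s ^ 2 / d 1 + d 2 * a ^ 2 = d 0 * d 1 * d 2 := by
    field_simp
    linear_combination b ^ 2 * h1 + (d 0 * d 1 * d 2) * h2
  have e3 : t ^ 2 / d 0 + s ^ 2 / d 1 = d 2 := by
    field_simp
    linear_combination h1
  ext i j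
  rw [mul_apply, Fin.sum_univ_three]
  simp only [mul_diagonal, Matrix.smul_apply]
  fin_cases i <;> fin_cases j <;> simp
  · linear_combination h1
  · field_simp; ring
  · field_simp; ring
  · field_simp; ring
  · field_simp at e1 ⊢; linear_combination e1
  · field_simp at e3 ⊢; linear_combination (-a * b) * e3
  · field_simp; ring
  · field_simp at e3 ⊢; linear_combination (-a * b) * e3
  · field_simp at e2 ⊢; linear_combination e2

/-- Coordinates of the centres of a normalized frame. -/
def coordV (x z : K) : Fin 4 → Fin 3 → K := ![![1, 0, 0], ![1, 1 - x, 0], ![0, 1, z], ![0, 0, 1]]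

/-- Coordinates of the axes of a normalized frame. -/
def coordφ (x z : K) : Fin 4 → Fin 3 → K := ![![1, 0, 0], ![x, 1, 0], ![0, 1 - z, 1], ![0, 0, 1]]

/-- Coefficients of the quadratic form that is preserved by a normalized frame. -/
def formCoeff (x z : K) : Fin 3 → K := ![x * (1 - x) * z * (1 - z), z * (1 - z), 1]

/-- Values of the quadratic form at the centres. -/
def formValue (x z : K) : Fin 4 → K := ![x * (1 - x) * z * (1 - z), (1 - x) * z * (1 - z), z, 1]

/-- Each axis is the polar of its centre with respect to the form; this makes the homologies
isometries. -/
theorem formCoeff_mul_coordV (x z : K) (i : Fin 4) (j : Fin 3) :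
    formCoeff x z j * coordV x z i j = formValue x z i * coordφ x z i j := by
  fin_cases i <;> fin_cases j <;> simp [formCoeff, coordV, formValue, coordφ] <;> ring

theorem coord_pair (x z : K) (i : Fin 4) : coordφ x z i ⬝ᵥ coordV x z i = 1 := by
  fin_cases i <;> simp [coordφ, coordV, dotProduct, Fin.sum_univ_three]

theorem formCoeff_ne_zero {x z : K} (hx : x ≠ 0) (hx1 : x ≠ 1) (hz : z ≠ 0) (hz1 : z ≠ 1) (j : Fin 3) :
    formCoeff x z j ≠ 0 := by
  have h1 := sub_ne_zero.mpr hx1.symm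
  have h2 := sub_ne_zero.mpr hz1.symm
  fin_cases j <;> simp [formCoeff, hx, hz, h1, h2]

theorem formValue_ne_zero {x z : K} (hx : x ≠ 0) (hx1 : x ≠ 1) (hz : z ≠ 0) (hz1 : z ≠ 1) (i : Fin 4) :
    formValue x z i ≠ 0 := by
  have h1 := sub_ne_zero.mpr hx1.symm
  have h2 := sub_ne_zero.mpr hz1.symm
  fin_cases i <;> simp [formValue, hx, hz, h1, h2]

/-- A basis in which the quadratic form of a normalized frame is a multiple of the sum of three
squares. -/
theorem exists_coordinates [Finite K] (p : ℕ) [Fact p.Prime] [CharP K p] (hp : p ≠ 2) {x z : K}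
    (hx : x ≠ 0) (hx1 : x ≠ 1) (hz : z ≠ 0) (hz1 : z ≠ 1) :
    ∃ (P P' : Matrix (Fin 3) (Fin 3) K) (u : Fin 4 → Fin 3 → K), P * P' = 1 ∧
      (∀ i, P' *ᵥ coordV x z i = u i) ∧ (∀ i, u i ⬝ᵥ u i ≠ 0) ∧
      (∀ i, coordφ x z i ᵥ* P = (u i ⬝ᵥ u i)⁻¹ • u i) := by
  obtain ⟨P, κ, hκ, hP⟩ := exists_similar p hp (formCoeff_ne_zero hx hx1 hz hz1)
  have hP' : (κ⁻¹ • (Pᵀ * diagonal (formCoeff x z))) * P = 1 := by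
    rw [smul_mul_assoc, hP, smul_smul, inv_mul_cancel₀ hκ, one_smul]
  have hu : ∀ i, (κ⁻¹ • (Pᵀ * diagonal (formCoeff x z))) *ᵥ coordV x z i =
      (κ⁻¹ * formValue x z i) • (coordφ x z i ᵥ* P) := by
    intro i
    rw [smul_mulVec, ← mulVec_mulVec, mul_smul]
    congr 1
    have : diagonal (formCoeff x z) *ᵥ coordV x z i = formValue x z i • coordφ x z i := by
      ext j
      rw [mulVec_diagonal]
      exact formCoeff_mul_coordV x z i j
    rw [this, mulVec_smul, mulVec_transpose]
  have hc : ∀ i, κ⁻¹ * formValue x z i ≠ 0 := fun i =>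
    mul_ne_zero (inv_ne_zero hκ) (formValue_ne_zero hx hx1 hz hz1 i)
  have huu : ∀ i, ((κ⁻¹ • (Pᵀ * diagonal (formCoeff x z))) *ᵥ coordV x z i) ⬝ᵥ
      ((κ⁻¹ • (Pᵀ * diagonal (formCoeff x z))) *ᵥ coordV x z i) = κ⁻¹ * formValue x z i := by
    intro i
    nth_rw 1 [hu]
    rw [smul_dotProduct, ← dotProduct_mulVec, mulVec_mulVec, mul_eq_one_comm.mp hP', one_mulVec,
      coord_pair, smul_eq_mul, mul_one]
  refine ⟨P, _, _, mul_eq_one_comm.mp hP', fun i => rfl, fun i => ?_, fun i => ?_⟩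
  · rw [huu]; exact hc i
  · rw [huu, hu, smul_smul, inv_mul_cancel₀ (hc i), one_smul]

/-- Rotations as elements of `SL(3)`. -/
def toSL : SO3 K →* SpecialLinearGroup (Fin 3) K where
  toFun A := ⟨A.1, det_eq_one A⟩
  map_one' := rfl
  map_mul' _ _ := rfl

theorem toPSL_toSL_injective (f : K →+* F) {g g' : Matrix (Fin 3) (Fin 3) F} (hg : g * g' = 1) :
    Function.Injective ((Homology.toPSL f hg).comp toSL) := by
  rw [injective_iff_map_eq_one]
  intro A hA
  have h1 := Homology.eq_one_of_toPSL_eq_one f hg hA fun c hc => by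
    have h2 := transpose_mul_self A
    have hc' : A.1 = c • (1 : Matrix (Fin 3) (Fin 3) K) := hc
    rw [hc'] at h2
    have := congrFun (congrFun h2 0) 0
    simp at this
    rw [pow_two, this]
  have h3 : A.1 = 1 := congrArg (fun B : SpecialLinearGroup (Fin 3) K => B.1) h1
  exact Subtype.ext h3

theorem toPSL_halfTurn (f : K →+* F) {g g' : Matrix (Fin 3) (Fin 3) F} (hg : g * g' = 1)
    {u : Fin 3 → K} (hu : u ⬝ᵥ u ≠ 0) {w ψ : Fin 3 → F} (h' : ψ ⬝ᵥ w = 1)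
    (hw : g' *ᵥ w = f ∘ u) (hψ : ψ ᵥ* g = f ∘ ((u ⬝ᵥ u)⁻¹ • u)) :
    Homology.toPSL f hg (toSL (halfTurn u hu)) = QuotientGroup.mk (Homology.reflSL w ψ h') :=
  Homology.toPSL_reflSL f hg (v := u) (φ := (u ⬝ᵥ u)⁻¹ • u)
    (by rw [smul_dotProduct, smul_eq_mul, inv_mul_cancel₀ hu]) h' hw hψ

theorem six_le_card {G : Type*} [Group G] [Finite G] {r s : G} (hr : Odd (orderOf r))
    (hr1 : orderOf r ≠ 1) (hs : orderOf s = 2) : 6 ≤ Nat.card G := by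
  have h1 := orderOf_dvd_natCard r
  have h2 := orderOf_dvd_natCard s
  rw [hs] at h2
  have h3 := (Nat.coprime_two_right.mpr hr).mul_dvd_of_dvd_of_dvd h1 h2
  have h4 := Nat.le_of_dvd Nat.card_pos h3
  obtain ⟨k, hk⟩ := hr
  omega

/-- The product of the half-turns about a and b is a rotation about d of odd order greater than 1,
and the half-turn about d has order 2, so there are at least six rotations about d. The half-turn
about a reverses d, and that about c moves its line. -/
theorem isBase_of [Finite K] (h2 : (2 : K) ≠ 0) {H : Subgroup (SO3 K)} {a b c d : Fin 3 → K}
    (ha : a ⬝ᵥ a ≠ 0) (hb : b ⬝ᵥ b ≠ 0) (hc : c ⬝ᵥ c ≠ 0) (hd : d ⬝ᵥ d ≠ 0)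
    (haH : halfTurn a ha ∈ H) (hbH : halfTurn b hb ∈ H) (hcH : halfTurn c hc ∈ H)
    (hdH : halfTurn d hd ∈ H) (had : a ⬝ᵥ d = 0) (hbd : b ⬝ᵥ d = 0) (hcd : c ⬝ᵥ d ≠ 0)
    (hp : ∀ t : K, c ≠ t • d) (ho : Odd (orderOf (halfTurn a ha * halfTurn b hb)))
    (ho1 : orderOf (halfTurn a ha * halfTurn b hb) ≠ 1) : IsBase H d where
  ne_zero := by rintro rfl; simp at hd
  noniso := hd
  card := by
    have hd0 : d ≠ 0 := by rintro rfl; simp at hd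
    have m1 : (⟨_, H.mul_mem haH hbH⟩ : H) ∈ rotations H (Projectivization.mk K d hd0) := by
      rw [mem_rotations_mk]
      change (halfTurn a ha * halfTurn b hb) • d = d
      rw [mul_smul, halfTurn_smul_of_orthogonal hb hbd, smul_neg, halfTurn_smul_of_orthogonal ha had,
        neg_neg]
    have m2 : (⟨_, hdH⟩ : H) ∈ rotations H (Projectivization.mk K d hd0) :=
      mem_rotations_mk.mpr (halfTurn_smul_self d hd)
    refine six_le_card (r := ⟨_, m1⟩) (s := ⟨_, m2⟩) ?_ ?_ ?_
    · rwa [Subgroup.orderOf_mk, Subgroup.orderOf_mk]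
    · rwa [Subgroup.orderOf_mk, Subgroup.orderOf_mk]
    · rw [Subgroup.orderOf_mk, Subgroup.orderOf_mk]
      exact orderOf_eq_prime (by rw [pow_two, halfTurn_mul_self]) (halfTurn_ne_one h2 d hd)
  flip := ⟨_, haH, halfTurn_smul_of_orthogonal ha had⟩
  move := by
    refine ⟨_, hcH, ?_⟩
    rintro ⟨t, ht⟩
    rw [halfTurn_smul, sub_eq_iff_eq_add] at ht
    set m := 2 * ((c ⬝ᵥ c)⁻¹ * (c ⬝ᵥ d)) with hm
    have hm0 : m ≠ 0 := mul_ne_zero h2 (mul_ne_zero (inv_ne_zero hc) hcd)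
    apply hp (m⁻¹ * (t + 1))
    rw [mul_smul, add_smul, one_smul, ← ht, smul_smul, inv_mul_cancel₀ hm0, one_smul]

end Rotation

/-! ### The invariant conic. -/

namespace Homology

variable {F : Type*} [Field F]

open Rotation

/-- The quadratic form with the given values at the rows of an invertible matrix. -/
noncomputable def rowForm (d : Fin 3 → F) (g' : Matrix (Fin 3) (Fin 3) F) :
    QuadraticForm F (Fin 3 → F) :=
  (QuadraticMap.weightedSumSquares F d).comp (Matrix.toLin' g')

theorem rowForm_apply (d : Fin 3 → F) (g' : Matrix (Fin 3) (Fin 3) F) (u : Fin 3 → F) :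
    rowForm d g' u = ∑ j, d j * ((g' *ᵥ u) j * (g' *ᵥ u) j) := by
  rw [rowForm, QuadraticMap.comp_apply, QuadraticMap.weightedSumSquares_apply]
  rfl

theorem rowForm_polarBilin_nondegenerate (h2 : (2 : F) ≠ 0) {d : Fin 3 → F} (hd : ∀ j, d j ≠ 0)
    {g g' : Matrix (Fin 3) (Fin 3) F} (hg : g * g' = 1) :
    (rowForm d g').polarBilin.Nondegenerate := by
  have hB : ∀ u w, (rowForm d g').polarBilin u w = ∑ j, 2 * d j * ((g' *ᵥ u) j * (g' *ᵥ w) j) := by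
    intro u w
    rw [QuadraticMap.polarBilin_apply_apply, QuadraticMap.polar, rowForm_apply, rowForm_apply,
      rowForm_apply, mulVec_add, ← Finset.sum_sub_distrib, ← Finset.sum_sub_distrib]
    refine Finset.sum_congr rfl fun j _ => ?_
    rw [Pi.add_apply]
    ring
  have key : ∀ u, (∀ w, (rowForm d g').polarBilin u w = 0) → u = 0 := by
    intro u hu
    have h0 : g' *ᵥ u = 0 := by
      ext j
      have := hu (g *ᵥ Pi.single j 1)
      rw [hB, mulVec_mulVec, mul_eq_one_comm.mp hg, one_mulVec, Finset.sum_eq_single j] at this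
      · simpa [h2, hd j] using this
      · intro k _ hk
        rw [Pi.single_eq_of_ne hk, mul_zero, mul_zero]
      · intro hj
        exact absurd (Finset.mem_univ j) hj
    have := congrArg (g *ᵥ ·) h0
    simpa only [mulVec_mulVec, hg, one_mulVec, mulVec_zero] using this
  refine ⟨key, fun w hw => key w fun u => ?_⟩
  rw [← hw u]
  rw [hB, hB]
  exact Finset.sum_congr rfl fun j _ => by ring

/-- The conic of a quadratic form. -/
def conicOf (Q : QuadraticForm F (Fin 3 → F)) : Set (PG2 F) := {P | Q P.rep = 0}

theorem mk_mem_conicOf (Q : QuadraticForm F (Fin 3 → F)) {v : Fin 3 → F} (hv : v ≠ 0) :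
    Projectivization.mk F v hv ∈ conicOf Q ↔ Q v = 0 := by
  obtain ⟨a, ha⟩ := Projectivization.exists_smul_eq_mk_rep F v hv
  rw [conicOf, Set.mem_ofPred_eq, ← ha, Units.smul_def, QuadraticMap.map_smul, smul_eq_mul,
    mul_eq_zero, or_iff_right (mul_ne_zero a.ne_zero a.ne_zero)]

theorem preservesSet_conicOf {S : Frame F} {ρ : Fin 4 → PSL3 F}
    (h : ∀ i, (QuotientGroup.mk (S.gen i) : PSL3 F) = ρ i) {Q : QuadraticForm F (Fin 3 → F)}
    (hQ : ∀ i u, Q (S.gen i • u) = Q u) :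
    PreservesSet (Subgroup.closure (Set.range ρ)) (conicOf Q) := by
  apply preservesSet_of_gen
  · intro i
    rw [← h, ← QuotientGroup.mk_mul, S.gen_mul_self]
    rfl
  · intro i P
    induction P using Projectivization.ind with | _ v hv =>
    rw [← h, ProjectiveSpecialLinearGroup.smul_proj_mk, Projectivization.smul_mk, mk_mem_conicOf,
      mk_mem_conicOf, hQ]
    exact id

namespace Frame

/-- With t = φ·w, the polar form B and Dv = dφ, one has Q(2tv - w) - Q(w) = 4t²Q(v) - 2tB(v, w).
This vanishes because Q(v) = d and B(v, w) = 2dt. -/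
theorem rowForm_gen {S : Frame F} {g g' : Matrix (Fin 3) (Fin 3) F} (hg : g * g' = 1) {x z : F}
    (hv : ∀ i, g' *ᵥ S.v i = coordV x z i) (hφ : ∀ i, S.φ i ᵥ* g = coordφ x z i) (i : Fin 4)
    (u : Fin 3 → F) : rowForm (formCoeff x z) g' (S.gen i • u) = rowForm (formCoeff x z) g' u := by
  have e1 : S.φ i ⬝ᵥ u = coordφ x z i ⬝ᵥ (g' *ᵥ u) := by
    rw [← hφ, ← dotProduct_mulVec, mulVec_mulVec, hg, one_mulVec]
  rw [rowForm_apply, rowForm_apply, gen_smul, mulVec_sub, mulVec_smul, hv, e1]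
  have e2 := coord_pair x z i
  have e3 := formCoeff_mul_coordV x z i
  generalize g' *ᵥ u = w
  generalize formCoeff x z = D at *
  generalize coordV x z i = v at *
  generalize coordφ x z i = φ at *
  generalize formValue x z i = d at *
  simp only [Pi.sub_apply, Pi.smul_apply, smul_eq_mul, dotProduct, Fin.sum_univ_three] at e2 ⊢
  linear_combination (4 * (φ 0 * w 0 + φ 1 * w 1 + φ 2 * w 2) *
    ((φ 0 * w 0 + φ 1 * w 1 + φ 2 * w 2) * v 0 - w 0)) * e3 0 +
    (4 * (φ 0 * w 0 + φ 1 * w 1 + φ 2 * w 2) *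
    ((φ 0 * w 0 + φ 1 * w 1 + φ 2 * w 2) * v 1 - w 1)) * e3 1 +
    (4 * (φ 0 * w 0 + φ 1 * w 1 + φ 2 * w 2) *
    ((φ 0 * w 0 + φ 1 * w 1 + φ 2 * w 2) * v 2 - w 2)) * e3 2 +
    (4 * (φ 0 * w 0 + φ 1 * w 1 + φ 2 * w 2) ^ 2 * d) * e2

/-- Coordinates for a normalized frame. -/
theorem exists_basis {S : Frame F} {x z : F} (hN : S.Normal x z) (hx1 : x ≠ 1) :
    ∃ g g' : Matrix (Fin 3) (Fin 3) F, g * g' = 1 ∧ (∀ i, g' *ᵥ S.v i = coordV x z i) ∧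
      ∀ i, S.φ i ᵥ* g = coordφ x z i := by
  obtain ⟨e1, e2, e3, e4, e5, e6⟩ := S.orth'
  have h21 := hN.h21
  have p0 := S.pair 0
  have p1 := S.pair 1
  have p2 := S.pair 2
  have p3 := S.pair 3
  have h01 := hN.h01
  have h12 := hN.h12
  have h23 := hN.h23
  have h10 := hN.h10
  have h32 := hN.h32
  have hx := sub_ne_zero.mpr hx1.symm
  -- The rows are the dual basis of the columns; the factor 1/(1 - x) normalises the pairing of the
  -- two middle vectors.
  refine ⟨ofCols (S.v 0) ((1 - x)⁻¹ • (S.v 1 - S.v 0)) (S.v 3),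
    ofRows (S.φ 0) (S.φ 1 - x • S.φ 0) (S.φ 3), ?_, fun i => ?_, fun i => ?_⟩
  · rw [mul_eq_one_comm, ofRows_mul_ofCols]
    simp only [sub_dotProduct, dotProduct_sub, dotProduct_smul, smul_dotProduct, smul_eq_mul, *]
    ext i j
    fin_cases i <;> fin_cases j <;> simp [hx]
  · rw [ofRows_mulVec]
    fin_cases i <;> ext j <;> fin_cases j <;> simp [coordV, sub_dotProduct, *]
  · rw [vecMul_ofCols]
    fin_cases i <;> ext j <;> fin_cases j <;> simp [coordφ, dotProduct_sub, *]

end Frame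

end Homology

/-! ### The irreducible case. -/

namespace Homology

variable {F : Type*} [Field F]

open Rotation

theorem pow_char_eq_of_trace {K : Type*} [Field K] (p : ℕ) [Fact p.Prime] [CharP K p]
    (h2 : (2 : K) ≠ 0) {x : K} {k : ℕ} (h : (4 * x - 1 - 1) ^ p ^ k = 4 * x - 1 - 1) :
    x ^ p ^ k = x := by
  have h4 : (4 : K) ≠ 0 := by
    rw [show (4 : K) = 2 * 2 by norm_num]
    exact mul_ne_zero h2 h2
  have h' : iterateFrobenius K p k (4 * x - 1 - 1) = 4 * x - 1 - 1 := h
  rw [map_sub, map_sub, map_mul, map_one, map_ofNat] at h'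
  have h3 : iterateFrobenius K p k x = x := mul_left_cancel₀ h4 (by linear_combination h')
  exact h3

theorem pow_char_eq_of_closure [Finite F] (p : ℕ) [Fact p.Prime] [CharP F p] {s : Set F} {k : ℕ}
    (hs : ∀ a ∈ s, a ^ p ^ k = a) (a : Subfield.closure s) : a ^ p ^ k = a := by
  have h := RingHom.eqOn_field_closure (f := iterateFrobenius F p k) (g := RingHom.id F) hs a.2
  exact Subtype.ext h

namespace Frame

/-- The normalised coordinates lie in the field generated by x and z, so the generators come from
half-turns over that field. The traces of the two outer products generate it, as the index bound
`card_le_two_mul` requires. -/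
theorem irreducible_case [Finite F] (p : ℕ) [CharP F p] [Fact p.Prime] (hp : p ≠ 2)
    (h2 : (2 : F) ≠ 0) {ρ : Fin 4 → PSL3 F} {S : Frame F} (hS : S.Indep)
    (h : ∀ i, (QuotientGroup.mk (S.gen i) : PSL3 F) = ρ i) {x z : F} (hN : S.Normal x z)
    (hx1 : x ≠ 1) (hz1 : z ≠ 1) :
    (∃ K : Subfield F, Nonempty (Subgroup.closure (Set.range ρ) ≃* POmega3 K) ∨
      Nonempty (Subgroup.closure (Set.range ρ) ≃* PSO3 K)) ∧
    ∃ C : Set (PG2 F), IsConic C ∧ PreservesSet (Subgroup.closure (Set.range ρ)) C := by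
  obtain ⟨g, g', hg, hgv, hgφ⟩ := exists_basis hN hx1
  refine ⟨?_, conicOf (rowForm (formCoeff x z) g'), ⟨_, rowForm_polarBilin_nondegenerate h2
    (formCoeff_ne_zero hN.x_ne hx1 hN.z_ne hz1) hg, rfl⟩,
    preservesSet_conicOf h fun i u => rowForm_gen hg hgv hgφ i u⟩
  let K := Subfield.closure {x, z}
  refine ⟨K, ?_⟩
  let f : K →+* F := K.subtype
  have hfinj : Function.Injective f := Subtype.val_injective
  have : CharP K p := (f.charP_iff hfinj p).mpr inferInstance
  obtain ⟨X, hX⟩ : ∃ X : K, f X = x := ⟨⟨x, Subfield.subset_closure (by simp)⟩, rfl⟩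
  obtain ⟨Z, hZ⟩ : ∃ Z : K, f Z = z := ⟨⟨z, Subfield.subset_closure (by simp)⟩, rfl⟩
  have h2K : (2 : K) ≠ 0 := by
    intro h0
    apply h2
    rw [← map_ofNat f 2, h0, map_zero]
  have hX0 : X ≠ 0 := fun h0 => hN.x_ne (by rw [← hX, h0, map_zero])
  have hZ0 : Z ≠ 0 := fun h0 => hN.z_ne (by rw [← hZ, h0, map_zero])
  have hX1 : X ≠ 1 := fun h0 => hx1 (by rw [← hX, h0, map_one])
  have hZ1 : Z ≠ 1 := fun h0 => hz1 (by rw [← hZ, h0, map_one])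
  have hfV : ∀ i, coordV x z i = f ∘ coordV X Z i := by
    intro i
    ext j
    fin_cases i <;> fin_cases j <;> simp [coordV, hX, hZ]
  have hfφ : ∀ i, coordφ x z i = f ∘ coordφ X Z i := by
    intro i
    ext j
    fin_cases i <;> fin_cases j <;> simp [coordφ, hX, hZ]
  obtain ⟨P, P', u, hP, huv, hu, huφ⟩ := exists_coordinates p hp hX0 hX1 hZ0 hZ1
  have hgP : (g * P.map f) * (P'.map f * g') = 1 := by
    rw [show g * P.map f * (P'.map f * g') = g * (P.map f * P'.map f) * g' by noncomm_ring,
      ← Matrix.map_mul, hP, Matrix.map_one f (map_zero f) (map_one f), mul_one, hg]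
  let Ψ := (toPSL f hgP).comp toSL
  have hΨ : Function.Injective Ψ := toPSL_toSL_injective f hgP
  let s : Fin 4 → SO3 K := fun i => halfTurn (u i) (hu i)
  have hs : ∀ i, Ψ (s i) = ρ i := by
    intro i
    rw [← h]
    refine toPSL_halfTurn f hgP (hu i) _ ?_ ?_
    · rw [← mulVec_mulVec, hgv, hfV, ← huv]
      exact (RingHom.map_mulVec f P' _ · |>.symm) |> funext
    · rw [← vecMul_vecMul, hgφ, hfφ, ← huφ]
      exact (RingHom.map_vecMul f P _ · |>.symm) |> funext
  obtain ⟨E⟩ := exists_equiv_closure Ψ hΨ hs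
  have hord : ∀ i j, orderOf (s i * s j) = orderOf (S.gen i * S.gen j) := by
    intro i j
    rw [← orderOf_mk_gen_mul h, ← hs, ← hs, ← map_mul, orderOf_injective Ψ hΨ]
  have hdot : ∀ i j, u i ⬝ᵥ u j = (u i ⬝ᵥ u i) * (coordφ X Z i ⬝ᵥ coordV X Z j) := by
    intro i j
    have : coordφ X Z i ⬝ᵥ coordV X Z j = (u i ⬝ᵥ u i)⁻¹ * (u i ⬝ᵥ u j) := by
      rw [← smul_eq_mul, ← smul_dotProduct, ← huφ, ← huv j, ← dotProduct_mulVec, mulVec_mulVec, hP,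
        one_mulVec]
    rw [this, mul_inv_cancel_left₀ (hu i)]
  have hpar : ∀ {i j} {t : K}, u i = t • u j → coordV X Z i = t • coordV X Z j := by
    intro i j t e
    have := congrArg (P *ᵥ ·) e
    simpa only [mulVec_smul, ← huv, mulVec_mulVec, hP, one_mulVec] using this
  have htr : ∀ i j, (s i * s j).1.trace =
      4 * ((coordφ X Z i ⬝ᵥ coordV X Z j) * (coordφ X Z j ⬝ᵥ coordV X Z i)) - 1 := by
    intro i j
    refine (trace_refl_mul (u i) ((u i ⬝ᵥ u i)⁻¹ • u i) (u j) ((u j ⬝ᵥ u j)⁻¹ • u j) ?_ ?_).trans ?_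
    · rw [smul_dotProduct, smul_eq_mul, inv_mul_cancel₀ (hu i)]
    · rw [smul_dotProduct, smul_eq_mul, inv_mul_cancel₀ (hu j)]
    · rw [smul_dotProduct, smul_dotProduct, smul_eq_mul, smul_eq_mul, hdot i j, hdot j i,
        inv_mul_cancel_left₀ (hu i), inv_mul_cancel_left₀ (hu j)]
  set H := Subgroup.closure (Set.range s) with hH
  have hsH : ∀ i, s i ∈ H := fun i => Subgroup.subset_closure ⟨i, rfl⟩
  have hperp : ∀ {i j}, coordφ X Z i ⬝ᵥ coordV X Z j = 0 → u i ⬝ᵥ u j = 0 := by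
    intro i j e
    rw [hdot, e, mul_zero]
  have hnperp : ∀ {i j}, coordφ X Z i ⬝ᵥ coordV X Z j ≠ 0 → u i ⬝ᵥ u j ≠ 0 := by
    intro i j e
    rw [hdot]
    exact mul_ne_zero (hu i) e
  -- The first two half-turns rotate about u 3, and the last two about u 0; both products have odd
  -- order.
  have hb3 : IsBase H (u 3) := by
    refine isBase_of h2K (hu 0) (hu 1) (hu 2) (hu 3) (hsH 0) (hsH 1) (hsH 2) (hsH 3)
      (hperp (by simp [coordφ, coordV])) (hperp (by simp [coordφ, coordV]))
      (hnperp (by simp [coordφ, coordV])) (fun t e => ?_) ?_ ?_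
    · have := congrFun (hpar e) 1
      simp [coordV] at this
    · rw [show halfTurn (u 0) (hu 0) * halfTurn (u 1) (hu 1) = s 0 * s 1 from rfl, hord]
      exact odd_orderOf_zero_one h2 hS
    · rw [show halfTurn (u 0) (hu 0) * halfTurn (u 1) (hu 1) = s 0 * s 1 from rfl, hord]
      exact hS.orderOf_ne_one (by decide)
  have hb0 : IsBase H (u 0) := by
    refine isBase_of h2K (hu 3) (hu 2) (hu 1) (hu 0) (hsH 3) (hsH 2) (hsH 1) (hsH 0)
      (hperp (by simp [coordφ, coordV])) (hperp (by simp [coordφ, coordV]))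
      (hnperp (by simp [coordφ, coordV, hX0])) (fun t e => ?_) ?_ ?_
    · have := congrFun (hpar e) 1
      simp [coordV, sub_eq_zero, hX1.symm] at this
    · rw [show halfTurn (u 3) (hu 3) * halfTurn (u 2) (hu 2) = s 3 * s 2 from rfl, hord, ← orderOf_inv,
        _root_.mul_inv_rev, inv_eq_of_mul_eq_one_left (S.gen_mul_self 2),
        inv_eq_of_mul_eq_one_left (S.gen_mul_self 3)]
      exact odd_orderOf_two_three h2 hS
    · rw [show halfTurn (u 3) (hu 3) * halfTurn (u 2) (hu 2) = s 3 * s 2 from rfl, hord]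
      exact hS.orderOf_ne_one (by decide)
  have hH0 : ∀ w : Fin 3 → K, w ≠ 0 → w ⬝ᵥ w = 0 → ∃ h ∈ H, ¬ ∃ c : K, h • w = c • w := by
    intro w hw0 hw
    by_contra! hc
    -- A half-turn fixing an isotropic line has its axis vector orthogonal to it. The vectors u 0, u
    -- 1 and u 3 span the space, so w would be zero.
    have hor : ∀ i, u i ⬝ᵥ w = 0 := by
      intro i
      obtain ⟨c, hc⟩ := hc (s i) (hsH i)
      by_contra hne
      have e : halfTurn (u i) (hu i) • w = c • w := hc
      rw [halfTurn_smul, sub_eq_iff_eq_add] at e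
      have hm : 2 * ((u i ⬝ᵥ u i)⁻¹ * (u i ⬝ᵥ w)) ≠ 0 :=
        mul_ne_zero h2K (mul_ne_zero (inv_ne_zero (hu i)) hne)
      have e2 := congrArg (fun v => v ⬝ᵥ v) e
      simp only [smul_dotProduct, dotProduct_smul, add_dotProduct, dotProduct_add, hw, mul_zero,
        add_zero, smul_eq_mul] at e2
      exact mul_ne_zero hm (mul_ne_zero hm (hu i)) e2
    have hφw : ∀ i, coordφ X Z i ⬝ᵥ (P *ᵥ w) = 0 := by
      intro i
      rw [dotProduct_mulVec, huφ, smul_dotProduct, hor, smul_zero]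
    have h0 := hφw 0
    have h1 := hφw 1
    have h3 := hφw 3
    simp only [coordφ, dotProduct, Fin.sum_univ_three] at h0 h1 h3
    have hPw : P *ᵥ w = 0 := by
      generalize P *ᵥ w = y at *
      simp at h0 h1 h3
      funext j
      fin_cases j
      · exact h0
      · simpa [h0] using h1
      · exact h3
    apply hw0
    have := congrArg (P' *ᵥ ·) hPw
    simpa only [mulVec_mulVec, mul_eq_one_comm.mp hP, one_mulVec, mulVec_zero] using this
  have hr : s 0 * s 1 ≠ 1 := fun e => hS.orderOf_ne_one (i := 0) (j := 1) (by decide)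
    (by rw [← hord, e, orderOf_one])
  have hr' : s 2 * s 3 ≠ 1 := fun e => hS.orderOf_ne_one (i := 2) (j := 3) (by decide)
    (by rw [← hord, e, orderOf_one])
  have hcard : Nat.card (SO3 K) ≤ 2 * Nat.card H := by
    refine card_le_two_mul p hp h2K hH0 hb3 hb0 (r := s 0 * s 1) (r' := s 2 * s 3)
      (H.mul_mem (hsH 0) (hsH 1)) (H.mul_mem (hsH 2) (hsH 3)) hr hr' ?_ ?_ ?_
    · rw [mul_smul, show s 1 • u 3 = -u 3 from halfTurn_smul_of_orthogonal (hu 1)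
        (hperp (by simp [coordφ, coordV])), smul_neg, show s 0 • u 3 = -u 3 from
        halfTurn_smul_of_orthogonal (hu 0) (hperp (by simp [coordφ, coordV])), neg_neg]
    · rw [mul_smul, show s 3 • u 0 = -u 0 from halfTurn_smul_of_orthogonal (hu 3)
        (hperp (by simp [coordφ, coordV])), smul_neg, show s 2 • u 0 = -u 0 from
        halfTurn_smul_of_orthogonal (hu 2) (hperp (by simp [coordφ, coordV])), neg_neg]
    · intro k hk1 hk2
      have e1 : (coordφ X Z 0 ⬝ᵥ coordV X Z 1) * (coordφ X Z 1 ⬝ᵥ coordV X Z 0) = X := by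
        simp [coordφ, coordV]
      have e2 : (coordφ X Z 2 ⬝ᵥ coordV X Z 3) * (coordφ X Z 3 ⬝ᵥ coordV X Z 2) = Z := by
        simp [coordφ, coordV]
      rw [htr, e1] at hk1
      rw [htr, e2] at hk2
      have hk1' := congrArg f (pow_char_eq_of_trace p h2K hk1)
      have hk2' := congrArg f (pow_char_eq_of_trace p h2K hk2)
      rw [map_pow, hX] at hk1'
      rw [map_pow, hZ] at hk2'
      refine pow_char_eq_of_closure p ?_
      rintro a (rfl | rfl)
      · exact hk1'
      · exact hk2'
  rcases equiv_POmega3_or_PSO3 p hp h2K hu hH hcard with e | e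
  · exact Or.inl (e.map E.trans)
  · exact Or.inr (e.map E.trans)

end Frame

end Homology

/-! ### Parabolic subgroups and the final assembly. -/

namespace Homology

variable {F : Type*} [Field F]

theorem eq_one_of_commute_generators {Γ : Type*} [Group Γ] {s : Set Γ}
    (hs : IsSym4OrAlt5 (Subgroup.closure s)) {c : Γ} (hc : c ∈ s) (h : ∀ d ∈ s, Commute c d) :
    c = 1 := by
  have hcent : ∀ d ∈ Subgroup.closure s, Commute c d := by
    intro d hd
    have hle : Subgroup.closure s ≤ Subgroup.centralizer {c} := by
      rw [Subgroup.closure_le]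
      intro d hd
      exact Subgroup.mem_centralizer_singleton_iff.mpr (h d hd).symm.eq
    exact (show d * c = c * d from Subgroup.mem_centralizer_singleton_iff.mp (hle hd)).symm
  have := (isSym4OrAlt5_cases hs).1 ⟨c, Subgroup.subset_closure hc⟩
    fun d => Subtype.ext (hcent d.1 d.2).eq
  exact congrArg Subtype.val this

/-- If ρ 1 and ρ 2 commuted, ρ 2 would be central in a group with trivial centre. -/
theorem orderOf_mul_ne_two {Γ : Type*} [Group Γ] {ρ : Fin 4 → Γ} (hρ : IsStringCGroup ρ)
    (h : IsSym4OrAlt5 (Subgroup.closure {ρ 0, ρ 1, ρ 2})) : orderOf (ρ 1 * ρ 2) ≠ 2 := by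
  intro h2
  have hsq : ∀ i, ρ i * ρ i = 1 := fun i => by
    rw [← pow_two, ← hρ.involution i, pow_orderOf_eq_one]
  have hcomm : Commute (ρ 2) (ρ 1) := by
    have e : (ρ 1 * ρ 2) * (ρ 1 * ρ 2) = 1 := by rw [← pow_two, ← h2, pow_orderOf_eq_one]
    have e' := mul_eq_one_iff_eq_inv.mp e
    rw [_root_.mul_inv_rev, inv_eq_of_mul_eq_one_left (hsq 1),
      inv_eq_of_mul_eq_one_left (hsq 2)] at e'
    exact e'.symm
  have h1 : ρ 2 = 1 := by
    refine eq_one_of_commute_generators h (by simp) ?_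
    rintro d (rfl | rfl | rfl)
    · exact (hρ.string 0 2 (by decide)).symm
    · exact hcomm
    · exact Commute.refl _
  have := hρ.involution 2
  rw [h1, orderOf_one] at this
  omega

namespace Frame

/-- The structure of the group, when the second and third homologies do not commute. -/
theorem connected_case [Finite F] (p : ℕ) [CharP F p] [Fact p.Prime] (hp : p ≠ 2)
    (h2 : (2 : F) ≠ 0) {ρ : Fin 4 → PSL3 F} {S : Frame F} (hS : S.Indep)
    (h : ∀ i, (QuotientGroup.mk (S.gen i) : PSL3 F) = ρ i) (h12 : S.φ 1 ⬝ᵥ S.v 2 ≠ 0) :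
    (Nonempty (Subgroup.closure (Set.range ρ) ≃* heisenbergSemidirect p) ∧
        ∃ (P : PG2 F) (L : Set (PG2 F)), IsLine L ∧ P ∈ L ∧
          FixesPoint (Subgroup.closure (Set.range ρ)) P ∧
          PreservesSet (Subgroup.closure (Set.range ρ)) L) ∨
      ((∃ K : Subfield F, Nonempty (Subgroup.closure (Set.range ρ) ≃* POmega3 K) ∨
        Nonempty (Subgroup.closure (Set.range ρ) ≃* PSO3 K)) ∧
      ∃ C : Set (PG2 F), IsConic C ∧ PreservesSet (Subgroup.closure (Set.range ρ)) C) := by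
  obtain ⟨T, x, z, hN, hT⟩ := exists_normal h2 hS h12
  have hTI := hS.of_gen_eq hT
  have hT' : ∀ i, (QuotientGroup.mk (T.gen i) : PSL3 F) = ρ i := fun i => by rw [hT, h]
  have hxz := hN.eq_one_iff p h2 hTI
  by_cases hx : x = 1
  · obtain rfl := hxz.mp hx
    subst hx
    exact Or.inl (heisenberg_case p h2 hT' hN)
  · exact Or.inr (irreducible_case p hp h2 hTI hT' hN hx (mt hxz.mpr hx))

end Frame

end Homology

theorem theorem5p3 {F : Type*} [Field F] [Finite F] (p : ℕ) [CharP F p]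
    (hq : Odd (Nat.card F)) (ρ : Fin 4 → PSL3 F) (hρ : IsStringCGroup ρ)
    (G G₁ G₄ : Subgroup (PSL3 F))
    (hG : G = Subgroup.closure (Set.range ρ))
    (hG₁ : G₁ = Subgroup.closure {ρ 1, ρ 2, ρ 3})
    (hG₄ : G₄ = Subgroup.closure {ρ 0, ρ 1, ρ 2}) :
    -- the group is in the list
    ((Nonempty (G ≃* DihedralGroup p × DihedralGroup p) ∧
        ((∃ P P' : PG2 F, P ≠ P' ∧ FixesPoint G P ∧ FixesPoint G P') ∨
          ∃ L L' : Set (PG2 F), IsLine L ∧ IsLine L' ∧ L ≠ L' ∧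
            PreservesSet G L ∧ PreservesSet G L')) ∨
      (Nonempty (G ≃* heisenbergSemidirect p) ∧
        ∃ (P : PG2 F) (L : Set (PG2 F)), IsLine L ∧ P ∈ L ∧
          FixesPoint G P ∧ PreservesSet G L) ∨
      ((∃ K : Subfield F, Nonempty (G ≃* POmega3 K) ∨ Nonempty (G ≃* PSO3 K)) ∧
        ∃ C : Set (PG2 F), IsConic C ∧ PreservesSet G C)) ∧
    -- the types with exceptional parabolic subgroups
    (IsSym4OrAlt5 G₁ → IsSym4OrAlt5 G₄ →
      IsExceptionalType (orderOf (ρ 0 * ρ 1)) (orderOf (ρ 1 * ρ 2)) (orderOf (ρ 2 * ρ 3))) ∧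
    -- the table of these types
    (IsExceptionalType (orderOf (ρ 0 * ρ 1)) (orderOf (ρ 1 * ρ 2)) (orderOf (ρ 2 * ρ 3)) →
      ∃ R : Fin 4 → Matrix.SpecialLinearGroup (Fin 3) F,
        (∀ i, R i ^ 2 = 1 ∧ (QuotientGroup.mk (R i) : PSL3 F) = ρ i) ∧
        ∃ a a' X : F,
          (R 0 * R 1 : Matrix.SpecialLinearGroup (Fin 3) F).1.trace = 1 + 2 * a ∧
          (R 2 * R 3 : Matrix.SpecialLinearGroup (Fin 3) F).1.trace = 1 + 2 * a' ∧
          ExceptionalTable p (orderOf (ρ 0 * ρ 1)) (orderOf (ρ 1 * ρ 2)) (orderOf (ρ 2 * ρ 3))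
            a a' X) := by
  have : Fact p.Prime := ⟨(CharP.char_is_prime_or_zero F p).resolve_right
    (CharP.char_ne_zero_of_finite F p)⟩
  have hp : p ≠ 2 := by
    rintro rfl
    have : Fintype F := Fintype.ofFinite F
    obtain ⟨n, -, hn⟩ := FiniteField.card F 2
    rw [Nat.card_eq_fintype_card, hn] at hq
    exact (Nat.not_odd_iff_even.mpr ((even_two).pow_of_ne_zero n.ne_zero)) hq
  have h2 : (2 : F) ≠ 0 := Ring.two_ne_zero (by rwa [ringChar.eq F p])
  obtain ⟨S, hS, h⟩ := Homology.Frame.exists_frame h2 hρ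
  have hord := Homology.Frame.orderOf_mk_gen_mul h
  refine ⟨?_, ?_, ?_⟩
  · subst hG
    by_cases h12 : S.φ 1 ⬝ᵥ S.v 2 = 0
    · by_cases h21 : S.φ 2 ⬝ᵥ S.v 1 = 0
      · exact Or.inl (Homology.Frame.reducible_case p hp hρ hS h h12 h21)
      -- Only φ_2·v_1 is known to be nonzero here. Reversing the generators moves it into the
      -- required position and does not change the group.
      · have hr := Homology.Frame.connected_case p hp h2 hS.rev (ρ := ρ ∘ Fin.rev)
          (fun i => h i.rev) h21
        rw [Set.range_comp, Fin.rev_surjective.range_eq, Set.image_univ] at hr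
        exact Or.inr hr
    · exact Or.inr (Homology.Frame.connected_case p hp h2 hS h h12)
  · subst hG₁ hG₄
    intro h₁ h₄
    refine Homology.isExceptionalType_of_orders (Subgroup.subset_closure (by simp))
      (Subgroup.subset_closure (by simp)) (Subgroup.subset_closure (by simp))
      (Subgroup.subset_closure (by simp)) (Subgroup.subset_closure (by simp))
      (Subgroup.subset_closure (by simp)) h₄ h₁ ?_ ?_ ?_ (Homology.orderOf_mul_ne_two hρ h₄) ?_ ?_
    · exact hord 0 1 ▸ Homology.Frame.odd_orderOf_zero_one h2 hS
    · exact hord 0 1 ▸ hS.orderOf_ne_one (by decide)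
    · exact hord 1 2 ▸ hS.orderOf_ne_one (by decide)
    · exact hord 2 3 ▸ Homology.Frame.odd_orderOf_two_three h2 hS
    · exact hord 2 3 ▸ hS.orderOf_ne_one (by decide)
  · rw [hord, hord, hord]
    intro hk
    obtain ⟨X, hX⟩ := Homology.exceptionalTable_of_gram p h2 hk _ _ _ S.gram_eq
      S.of_orderOf_eq_three S.of_orderOf_eq_five S.of_orderOf_eq_three S.of_orderOf_eq_four
      S.of_orderOf_eq_five S.of_orderOf_eq_three S.of_orderOf_eq_five
    -- The trace 4x - 1 equals 1 + 2a for a = 2x - 1, and similarly for z.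
    refine ⟨S.gen, fun i => ⟨by rw [pow_two, S.gen_mul_self], h i⟩, _, _, X, ?_, ?_, hX⟩ <;>
    · rw [S.trace_gen_mul]
      ring
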